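/- Let $K\subset\mathbb R$ be a real quadratic field with discriminant $D$, ring of integers $\mathcal O_K$ and conjugation $x\mapsto x'$. Let $\mathfrak a$ be a (non-zero) fractional ideal of $K$ with norm $N(\mathfrak a)$ and let $m\ge 1$ be an integer. Put $$\Gamma(\mathfrak a)=\begin{pmatrix}\mathcal O_K&\mathfrak a^{-1}\\ \mathfrak a&\mathcal O_K\end{pmatrix}\cap \mathrm{SL}_2(K),$$ acting on $\mathbb H^2$ by $M(z_1,z_2)=(Mz_1,M'z_2)$, and let $X(\mathfrak a)=\Gamma(\mathfrak a)\backslash\mathbb H^2$. Write $z_j=x_j+iy_j$, $\eta_j=\frac1{4\pi}\frac{dx_j\,dy_j}{y_j^2}$ and $\omega=\eta_1+\eta_2$, so that $\omega^2=2\eta_1\eta_2$. Let $$V=\{A\in K^{2\times2}: A^\top=A'\},\qquad L(\mathfrak a)=\left\{\begin{pmatrix}a&\lambda'\\ \lambda&b\end{pmatrix}\in V: a\in\mathbb Z,\ b\in N(\mathfrak a)\mathbb Z,\ \lambda\in\mathfrak a\right\},$$ where $V$ carries the quadratic form $\det$; let $L(\mathfrak a)^\vee$ be the dual lattice with respect to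 the bilinear form $\det(A+B)-\det A-\det B$, and let $\mathrm{SL}_2(K)$ act on $V$ by $M.A=MA(M')^\top$. For $A=\begin{pmatrix}a&\lambda'\\ \lambda&b\end{pmatrix}\in V$ with $\det A\neq 0$ and $z\in\mathbb H^2$ put $$g(A,z)=\frac{|bz_1z_2-\lambda z_1-\lambda' z_2+a|^2}{4y_1y_2\det A}.$$ Let $Q_{s-1}$ be the Legendre function of the second kind. Let $T(\mathfrak a,m)\subset\mathbb H^2$ be the union of the curves $T_A=\{z:g(A,z)=0\}$ over all $A\in L(\mathfrak a)^\vee$ with $\det A=m/(N(\mathfrak a)D)$. For $\mathrm{Re}(s)>1$ and $z\in\mathbb H^2\setminus T(\mathfrak a,m)$ put $$\Phi(\mathfrak a,m,s,z)=\sum_{A\in L(\mathfrak a)^\vee,\ \det A=m/(N(\mathfrak a)D)}Q_{s-1}(1+2g(A,z)).$$ Let $$\mathrm{vol}(T(\mathfrak a,m))=\sum_{A\in\Gamma(\mathfrak a)\backslash L(\mathfrak a)^\vee/\{\pm1\},\ \det A=m/(N(\mathfrak a)D)}\ \int_{\Gamma'_{\pm A}\backslash\mathbb H}\frac1{4\pi}\frac{dx\,dy}{y^2},\qquad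 \Gamma'_{\pm A}=\{M': M\in\Gamma(\mathfrak a),\ M.A=\pm A\}.$$ (The integral in each summand is $\frac12\int\omega$ over the curve $\Gamma_{\pm A}\backslash T_A$, where $\Gamma_{\pm A}=\{M\in\Gamma(\mathfrak a): M.A=\pm A\}$.) **Theorem.** The groups of transformations induced by $\Gamma(\mathfrak a)$ on $\mathbb H^2$ and by each $\Gamma'_{\pm A}$ on $\mathbb H$ have fundamental domains, and $\mathrm{vol}(T(\mathfrak a,m))$ is finite. For every $s\in\mathbb C$ with $\mathrm{Re}(s)>1$ the series $\Phi(\mathfrak a,m,s,z)$ converges absolutely for all $z\in\mathbb H^2\setminus T(\mathfrak a,m)$, the function $\Phi(\mathfrak a,m,s,\cdot)$ is integrable over $X(\mathfrak a)$ (that is, over every fundamental domain of $\Gamma(\mathfrak a)$), and $$\int_{X(\mathfrak a)}\Phi(\mathfrak a,m,s,z)\,\omega^2=\frac{2\,\mathrm{vol}(T(\mathfrak a,m))}{s(s-1)}.$$ -/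

import Mathlib

open MeasureTheory NumberField UpperHalfPlane
open scoped nonZeroDivisors MatrixGroups ENNReal

noncomputable section

namespace HilbertModular

/-! ### The Legendre function of the second kind -/

/-- The Legendre function of the second kind `Q_{s-1}(t)` for real `t > 1` and `Re s > 0`, in the
classical definition of Whittaker and Watson:
`Q_ν(t) = 2 ^ (-ν-1) * ∫_{-1}^{1} (1 - v ^ 2) ^ ν * (t - v) ^ (-ν-1) dv` with `ν = s - 1`. -/
def legendreQ (s : ℂ) (t : ℝ) : ℂ :=
  (2 : ℂ) ^ (-s) * ∫ v in (-1 : ℝ)..1, ((1 - v ^ 2 : ℝ) : ℂ) ^ (s - 1) * ((t - v : ℝ) : ℂ) ^ (-s)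

/-! ### Measures -/

/-- The measure on the upper half plane given by `η = (4π)⁻¹ dx dy / y ^ 2`
(the Mathlib volume of `ℍ` is `dx dy / y ^ 2`). -/
def eta : Measure ℍ := ENNReal.ofReal (1 / (4 * Real.pi)) • volume

/-- The measure on `ℍ × ℍ` given by the volume form
`ω ^ 2 = (η₁ + η₂) ∧ (η₁ + η₂) = 2 η₁ ∧ η₂`. -/
def omegaSq : Measure (ℍ × ℍ) := (2 : ℝ≥0∞) • eta.prod eta

section Lattice

variable {K : Type*} [Field K] [NumberField K]

/-! ### The quadratic space `V` and its lattices; `x' = τ x` is the conjugation of `K` -/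

/-- `V = {A ∈ K^{2×2} | Aᵀ = A'}`, that is, the matrices `(a, l'; l, b)` with `a, b` rational. -/
def quadSpace (τ : K ≃ₐ[ℚ] K) : Set (Matrix (Fin 2) (Fin 2) K) :=
  {A | A.transpose = A.map τ}

/-- The lattice `L(𝔞)` of all `(a, l'; l, b) ∈ V` with `a ∈ ℤ`, `b ∈ N(𝔞)ℤ` and `l ∈ 𝔞`. -/
def lattice (τ : K ≃ₐ[ℚ] K) (𝔞 : (FractionalIdeal (𝓞 K)⁰ K)ˣ) :
    Set (Matrix (Fin 2) (Fin 2) K) :=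
  {A | A ∈ quadSpace τ ∧ (∃ n : ℤ, A 0 0 = (n : K)) ∧
    (∃ n : ℤ, A 1 1 = ((FractionalIdeal.absNorm (𝔞 : FractionalIdeal (𝓞 K)⁰ K) : ℚ) : K) * n) ∧
    A 1 0 ∈ (𝔞 : FractionalIdeal (𝓞 K)⁰ K)}

/-- The dual lattice `L(𝔞)^∨` in `V` with respect to the bilinear form
`(A, B) = det (A + B) - det A - det B` of the quadratic form `det`. -/
def dualLattice (τ : K ≃ₐ[ℚ] K) (𝔞 : (FractionalIdeal (𝓞 K)⁰ K)ˣ) :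
    Set (Matrix (Fin 2) (Fin 2) K) :=
  {B | B ∈ quadSpace τ ∧ ∀ A ∈ lattice τ 𝔞, ∃ n : ℤ, (A + B).det - A.det - B.det = (n : K)}

/-- The vectors `A ∈ L(𝔞)^∨` with `det A = m / (N(𝔞) D)`, where `D` is the discriminant of `K`. -/
def vectors (τ : K ≃ₐ[ℚ] K) (𝔞 : (FractionalIdeal (𝓞 K)⁰ K)ˣ) (m : ℕ) :
    Set (Matrix (Fin 2) (Fin 2) K) :=
  {A | A ∈ dualLattice τ 𝔞 ∧
    A.det = (((m : ℚ) / (FractionalIdeal.absNorm (𝔞 : FractionalIdeal (𝓞 K)⁰ K) *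
      (NumberField.discr K : ℚ)) : ℚ) : K)}

/-- `M.A = M A (M')ᵀ`. -/
def matAct (τ : K ≃ₐ[ℚ] K) (M : SL(2, K)) (A : Matrix (Fin 2) (Fin 2) K) :
    Matrix (Fin 2) (Fin 2) K :=
  M.1 * A * (M.1.map τ).transpose

theorem matAct_one (τ : K ≃ₐ[ℚ] K) (A : Matrix (Fin 2) (Fin 2) K) : matAct τ 1 A = A := by
  simp [matAct]

theorem matAct_mul (τ : K ≃ₐ[ℚ] K) (M N : SL(2, K)) (A : Matrix (Fin 2) (Fin 2) K) :
    matAct τ (M * N) A = matAct τ M (matAct τ N A) := by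
  have h : (M.1 * N.1).map τ = M.1.map τ * N.1.map τ := Matrix.map_mul
  simp only [matAct, Matrix.SpecialLinearGroup.coe_mul]
  change M.1 * N.1 * A * ((M.1 * N.1).map τ).transpose = _
  rw [h, Matrix.transpose_mul]
  simp only [Matrix.mul_assoc]

theorem matAct_neg (τ : K ≃ₐ[ℚ] K) (M : SL(2, K)) (A : Matrix (Fin 2) (Fin 2) K) :
    matAct τ M (-A) = -matAct τ M A := by
  simp [matAct]

theorem matAct_inv_eq {τ : K ≃ₐ[ℚ] K} {M : SL(2, K)} {A B : Matrix (Fin 2) (Fin 2) K}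
    (h : matAct τ M A = B) : matAct τ M⁻¹ B = A := by
  rw [← h, ← matAct_mul, inv_mul_cancel, matAct_one]

/-! ### The Hilbert modular group -/

/-- The Hilbert modular group `Γ(𝔞)`: the matrices of `SL₂(K)` with diagonal entries in `𝓞 K`,
upper right entry in `𝔞⁻¹` and lower left entry in `𝔞`. -/
def hilbertGroup (𝔞 : (FractionalIdeal (𝓞 K)⁰ K)ˣ) : Subgroup SL(2, K) where
  carrier := {M | M.1 0 0 ∈ (1 : FractionalIdeal (𝓞 K)⁰ K) ∧
    M.1 0 1 ∈ ((𝔞⁻¹ : (FractionalIdeal (𝓞 K)⁰ K)ˣ) : FractionalIdeal (𝓞 K)⁰ K) ∧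
    M.1 1 0 ∈ (𝔞 : FractionalIdeal (𝓞 K)⁰ K) ∧
    M.1 1 1 ∈ (1 : FractionalIdeal (𝓞 K)⁰ K)}
  one_mem' := by
    have zero (I : FractionalIdeal (𝓞 K)⁰ K) : (0 : K) ∈ I :=
      Submodule.zero_mem (I : Submodule (𝓞 K) K)
    refine ⟨?_, ?_, ?_, ?_⟩
    · simp
    · simpa using zero _
    · simpa using zero _
    · simp
  mul_mem' := by
    rintro M N ⟨a1, b1, c1, d1⟩ ⟨a2, b2, c2, d2⟩
    have add {I : FractionalIdeal (𝓞 K)⁰ K} {x y : K} (hx : x ∈ I) (hy : y ∈ I) : x + y ∈ I :=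
      Submodule.add_mem (I : Submodule (𝓞 K) K) hx hy
    simp only [Set.mem_ofPred_eq, Matrix.SpecialLinearGroup.coe_mul, Matrix.mul_apply,
      Fin.sum_univ_two]
    refine ⟨add ?_ ?_, add ?_ ?_, add ?_ ?_, add ?_ ?_⟩
    · simpa using FractionalIdeal.mul_mem_mul a1 a2
    · simpa using FractionalIdeal.mul_mem_mul b1 c2
    · simpa using FractionalIdeal.mul_mem_mul a1 b2
    · simpa using FractionalIdeal.mul_mem_mul b1 d2
    · simpa using FractionalIdeal.mul_mem_mul c1 a2
    · simpa using FractionalIdeal.mul_mem_mul d1 c2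
    · simpa using FractionalIdeal.mul_mem_mul c1 b2
    · simpa using FractionalIdeal.mul_mem_mul d1 d2
  inv_mem' := by
    rintro M ⟨a, b, c, d⟩
    have neg {I : FractionalIdeal (𝓞 K)⁰ K} {x : K} (hx : x ∈ I) : -x ∈ I :=
      Submodule.neg_mem (I : Submodule (𝓞 K) K) hx
    rw [Set.mem_ofPred_eq, Matrix.SpecialLinearGroup.SL2_inv_expl]
    exact ⟨d, neg b, neg c, a⟩

/-- The stabilizer `Γ(𝔞)_{±A} = {M ∈ Γ(𝔞) | M.A = A or M.A = -A}`. -/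
def stabPM (τ : K ≃ₐ[ℚ] K) (𝔞 : (FractionalIdeal (𝓞 K)⁰ K)ˣ) (A : Matrix (Fin 2) (Fin 2) K) :
    Subgroup SL(2, K) where
  carrier := {M | M ∈ hilbertGroup 𝔞 ∧ (matAct τ M A = A ∨ matAct τ M A = -A)}
  one_mem' := ⟨one_mem _, Or.inl (matAct_one τ A)⟩
  mul_mem' := by
    rintro M N ⟨hM, h1⟩ ⟨hN, h2⟩
    refine ⟨mul_mem hM hN, ?_⟩
    rw [matAct_mul]
    rcases h1 with h1 | h1 <;> rcases h2 with h2 | h2 <;> simp [h1, h2, matAct_neg]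
  inv_mem' := by
    rintro M ⟨hM, h⟩
    refine ⟨inv_mem hM, ?_⟩
    rcases h with h | h
    · exact Or.inl (matAct_inv_eq h)
    · refine Or.inr ?_
      have := matAct_inv_eq h
      rw [matAct_neg] at this
      exact neg_eq_iff_eq_neg.mp this

/-- The equivalence relation on the vectors of given determinant whose quotient is
`Γ(𝔞) \ L(𝔞)^∨ / {±1}`: `A` and `B` are related if `M.A = B` or `M.A = -B` for an
`M ∈ Γ(𝔞)`. -/
def orbitSetoid (τ : K ≃ₐ[ℚ] K) (𝔞 : (FractionalIdeal (𝓞 K)⁰ K)ˣ) (m : ℕ) :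
    Setoid (vectors τ 𝔞 m) where
  r A B := ∃ M ∈ hilbertGroup 𝔞, matAct τ M A.1 = B.1 ∨ matAct τ M A.1 = -B.1
  iseqv := by
    refine ⟨fun A => ⟨1, one_mem _, Or.inl (matAct_one τ _)⟩, ?_, ?_⟩
    · rintro A B ⟨M, hM, h⟩
      refine ⟨M⁻¹, inv_mem hM, ?_⟩
      rcases h with h | h
      · exact Or.inl (matAct_inv_eq h)
      · refine Or.inr ?_
        have := matAct_inv_eq h
        rw [matAct_neg] at this
        rw [← this, neg_neg]
    · rintro A B C ⟨M, hM, h1⟩ ⟨N, hN, h2⟩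
      refine ⟨N * M, mul_mem hN hM, ?_⟩
      rw [matAct_mul]
      rcases h1 with h1 | h1 <;> rcases h2 with h2 | h2 <;> simp [h1, h2, matAct_neg]

/-! ### The actions on `ℍ` and `ℍ × ℍ`; the field `K` is embedded in `ℝ` by `ι` -/

/-- `SL₂(K)` acts on `ℍ` by Möbius transformations through a real embedding of `K`. -/
def moebius (ι : K →+* ℝ) : SL(2, K) →* Equiv.Perm ℍ :=
  (MulAction.toPermHom SL(2, ℝ) ℍ).comp (Matrix.SpecialLinearGroup.map ι)

/-- The second real embedding `x ↦ x'` of `K`. -/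
def conjEmb (ι : K →+* ℝ) (τ : K ≃ₐ[ℚ] K) : K →+* ℝ := ι.comp (τ : K →+* K)

/-- `SL₂(K)` acts on `ℍ × ℍ` by `M (z₁, z₂) = (M z₁, M' z₂)`. -/
def hilbertAct (ι : K →+* ℝ) (τ : K ≃ₐ[ℚ] K) : SL(2, K) →* Equiv.Perm (ℍ × ℍ) where
  toFun M := Equiv.prodCongr (moebius ι M) (moebius (conjEmb ι τ) M)
  map_one' := by ext1 z; simp
  map_mul' M N := by
    ext1 z
    simp only [map_mul]
    rfl

/-- The group of transformations of `ℍ × ℍ` given by the elements of `Γ(𝔞)`, isomorphic to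
`Γ(𝔞) / {±1}`. Its orbits are the points of the Hilbert modular surface `X(𝔞)`, and the integral
over `X(𝔞)` of a `Γ(𝔞)`-invariant function is its integral over a fundamental domain. -/
def transfGroup (ι : K →+* ℝ) (τ : K ≃ₐ[ℚ] K) (𝔞 : (FractionalIdeal (𝓞 K)⁰ K)ˣ) :
    Subgroup (Equiv.Perm (ℍ × ℍ)) :=
  (hilbertGroup 𝔞).map (hilbertAct ι τ)

/-- The group of transformations of `ℍ` given by the matrices `M'` with `M ∈ Γ(𝔞)_{±A}`. -/
def stabTransfGroup (ι : K →+* ℝ) (τ : K ≃ₐ[ℚ] K) (𝔞 : (FractionalIdeal (𝓞 K)⁰ K)ˣ)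
    (A : Matrix (Fin 2) (Fin 2) K) : Subgroup (Equiv.Perm ℍ) :=
  (stabPM τ 𝔞 A).map (moebius (conjEmb ι τ))

/-! ### The Hirzebruch--Zagier divisor and the automorphic Green function -/

/-- `h(A, z) = |b z₁ z₂ - l z₁ - l' z₂ + a| ^ 2 / (4 y₁ y₂)` for `A = (a, l'; l, b)`. -/
def hForm (ι : K →+* ℝ) (A : Matrix (Fin 2) (Fin 2) K) (z : ℍ × ℍ) : ℝ :=
  ‖(ι (A 1 1) : ℂ) * z.1 * z.2 - (ι (A 1 0) : ℂ) * z.1 - (ι (A 0 1) : ℂ) * z.2 + (ι (A 0 0) : ℂ)‖ ^ 2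
    / (4 * z.1.im * z.2.im)

/-- `g(A, z) = h(A, z) / det A`. -/
def gForm (ι : K →+* ℝ) (A : Matrix (Fin 2) (Fin 2) K) (z : ℍ × ℍ) : ℝ :=
  hForm ι A z / ι A.det

/-- The support in `ℍ × ℍ` of the Hirzebruch--Zagier divisor `T(𝔞, m)`: the union of the curves
`T_A = {z | h(A, z) = 0}`. -/
def divisorT (ι : K →+* ℝ) (τ : K ≃ₐ[ℚ] K) (𝔞 : (FractionalIdeal (𝓞 K)⁰ K)ˣ) (m : ℕ) :
    Set (ℍ × ℍ) :=
  {z | ∃ A ∈ vectors τ 𝔞 m, hForm ι A z = 0}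

/-- `vol(T(𝔞, m))`: the sum over `A ∈ Γ(𝔞) \ L(𝔞)^∨ / {±1}` with `det A = m / (N(𝔞) D)` of the
volumes of `Γ(𝔞)'_{±A} \ ℍ` with respect to `η`. -/
def volT (ι : K →+* ℝ) (τ : K ≃ₐ[ℚ] K) (𝔞 : (FractionalIdeal (𝓞 K)⁰ K)ˣ) (m : ℕ) : ℝ≥0∞ :=
  ∑' q : Quotient (orbitSetoid τ 𝔞 m), covolume (stabTransfGroup ι τ 𝔞 q.out.1) ℍ eta

/-- The summand `Q_{s-1}(1 + 2 g(A, z))`. -/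
def greenTerm (ι : K →+* ℝ) (s : ℂ) (z : ℍ × ℍ) (A : Matrix (Fin 2) (Fin 2) K) : ℂ :=
  legendreQ s (1 + 2 * gForm ι A z)

/-- The automorphic Green function `Φ(𝔞, m, s, z)`. -/
def greenPhi (ι : K →+* ℝ) (τ : K ≃ₐ[ℚ] K) (𝔞 : (FractionalIdeal (𝓞 K)⁰ K)ˣ) (m : ℕ)
    (s : ℂ) (z : ℍ × ℍ) : ℂ :=
  ∑' A : vectors τ 𝔞 m, greenTerm ι s z A.1

end Lattice

end HilbertModular

end

set_option linter.unusedSectionVars false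

noncomputable section

namespace HilbertModular

/-! A vector A of positive determinant defines a real Möbius transformation γ_A whose graph {(γ_A
z₂, z₂)} is T_A, and 1 + 2g(A,z) = cosh d(z₁, γ_A z₂) (`one_add_two_mul_gForm`). The sum over the
vectors is therefore a sum of point-pair invariants, which can be unfolded for any measurable φ ≥ 0
in place of the Legendre function.

Fix one Γ(𝔞)-orbit of vectors up to sign, with representative A₀. The integrals over a fundamental
domain F, summed over the orbit, assemble to twice an integral over a fundamental domain of the
stabilizer of ±A₀; the factor 2 comes from A₀ and -A₀. If S is a fundamental domain for the
stabilizer acting through M' on the second factor, then ℍ × S is one on ℍ². For fixed z₂ the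
integral over z₁ is taken in polar coordinates around γ_{A₀} z₂ and equals ½∫₁^∞ φ, independently of
z₂. Summing over orbits gives `setLIntegral_tsum_vectors`: ∫_F Σ_A φ(1+2g(A,z)) ω² = 2 vol(T) ∫₁^∞
φ(t) dt. The theorem follows from ∫₁^∞ Q_{s-1}(t) dt = 1/(s(s-1)) (`integral_legendreQ`), once
vol(T) is known to be finite.

Finiteness comes from the same identity, read backwards with φ the indicator of t ≤ 3: the right
side is 4 vol(T), so it suffices to bound the left side. Reduction theory covers ℍ² by
Γ(𝔞)-translates of finitely many cuspidal boxes. Minkowski's theorem gives a pair (c,d) with small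
denominator, the class of the ideal c𝔞⁻¹ + d𝓞 determines the cusp, and units and translations reduce
each cusp neighbourhood to a box. In a box the number of A with g(A,z) ≤ 1 is O(y₁)
(`exists_tsum_indicator_le`), and y₁ is integrable there.

For pointwise convergence, φ(t) = t^(-p) with p > 1 gives a convergent sum at almost every point of
F, hence at some point. Moving the point by a hyperbolic distance d changes every 1+2g by a factor
at most e^d, so the sum converges everywhere, and Q_{s-1}(t) = O(t^(-Re s)) transfers this to Φ. -/

/-! ### Integration in hyperbolic polar coordinates. -/

theorem lintegral_upperHalfPlane (f : ℂ → ℝ≥0∞) (hf : Measurable f) :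
    ∫⁻ z : ℍ, f z = ∫⁻ y in Set.Ioi (0 : ℝ), ∫⁻ x : ℝ,
      f ⟨x, y⟩ * ENNReal.ofReal (1 / y ^ 2) := by
  have hm : Measurable fun z : ℍ => (((1 / NNReal.mk z.im z.im_pos.le : NNReal) ^ 2 : NNReal) : ℝ≥0∞) := by
    have : Measurable fun z : ℍ => z.im := UpperHalfPlane.continuous_im.measurable
    have h2 : Measurable fun z : ℍ => NNReal.mk z.im z.im_pos.le := this.subtype_mk
    fun_prop
  change ∫⁻ z : ℍ, (f ∘ UpperHalfPlane.coe) z = _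
  rw [volume_def, lintegral_withDensity_eq_lintegral_mul _ hm (hf.comp measurable_coe)]
  have h1 : ∀ z : ℍ, ((fun z : ℍ => (((1 / NNReal.mk z.im z.im_pos.le : NNReal) ^ 2 : NNReal) : ℝ≥0∞)) *
      (f ∘ UpperHalfPlane.coe)) z = (fun w : ℂ => f w * ENNReal.ofReal (1 / w.im ^ 2)) z := by
    intro z
    simp only [Pi.mul_apply, Function.comp]
    rw [mul_comm]
    congr 1
    rw [← ENNReal.ofReal_coe_nnreal]
    congr 1
    simp
  have hmp : MeasurePreserving UpperHalfPlane.coe (volume.comap UpperHalfPlane.coe)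
      (volume.restrict (.range UpperHalfPlane.coe)) :=
    ⟨measurable_coe, by rw [measurableEmbedding_coe.map_comap]⟩
  change ∫⁻ z : ℍ, ((fun z : ℍ => (((1 / NNReal.mk z.im z.im_pos.le : NNReal) ^ 2 : NNReal) : ℝ≥0∞)) *
      (f ∘ UpperHalfPlane.coe)) z ∂_ = _
  rw [lintegral_congr h1, hmp.lintegral_comp_emb measurableEmbedding_coe
    (fun w : ℂ => f w * ENNReal.ofReal (1 / w.im ^ 2)), UpperHalfPlane.range_coe]
  have hmeas : MeasurableSet {z : ℂ | 0 < z.im} := measurableSet_lt measurable_const Complex.measurable_im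
  rw [← lintegral_indicator hmeas,
    ← (Complex.volume_preserving_equiv_real_prod.symm).lintegral_comp_emb
    Complex.measurableEquivRealProd.symm.measurableEmbedding, Measure.volume_eq_prod,
    lintegral_prod_symm]
  · rw [← lintegral_indicator measurableSet_Ioi]
    refine lintegral_congr fun y => ?_
    by_cases hy : 0 < y
    · rw [Set.indicator_of_mem (by exact hy)]
      refine lintegral_congr fun x => ?_
      rw [Set.indicator_of_mem]
      · rfl
      · exact hy
    · rw [Set.indicator_of_notMem (by exact hy)]
      refine (lintegral_congr fun x => ?_).trans lintegral_zero
      rw [Set.indicator_of_notMem]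
      exact hy
  · refine Measurable.aemeasurable ?_
    refine Measurable.comp (Measurable.indicator ?_ hmeas) (Complex.measurableEquivRealProd.symm.measurable)
    have := Complex.measurable_im
    fun_prop

/-- The change of variables `p = (1/y - (1+q²) y)/2`. -/
theorem lintegral_cosh_fiber (φ : ℝ → ℝ≥0∞) (q : ℝ) :
    ∫⁻ y in Set.Ioi (0 : ℝ), φ ((q ^ 2 * y ^ 2 + y ^ 2 + 1) / (2 * y)) * ENNReal.ofReal (1 / y) =
      ∫⁻ p : ℝ, φ (√(1 + (p ^ 2 + q ^ 2))) * ENNReal.ofReal (1 / √(1 + (p ^ 2 + q ^ 2))) := by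
  set f : ℝ → ℝ := fun y => (y⁻¹ - (1 + q ^ 2) * y) / 2 with hf
  have hd : ∀ y ∈ Set.Ioi (0 : ℝ), HasDerivWithinAt f ((-(y ^ 2)⁻¹ - (1 + q ^ 2)) / 2) (Set.Ioi 0) y := by
    intro y hy
    have h1 := (hasDerivAt_inv (ne_of_gt hy)).sub ((hasDerivAt_id y).const_mul (1 + q ^ 2))
    have := (h1.div_const 2).hasDerivWithinAt (s := Set.Ioi 0)
    simpa using this
  have hanti : StrictAntiOn f (Set.Ioi 0) := by
    intro a ha b hb hab
    simp only [hf]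
    have h1 : b⁻¹ < a⁻¹ := by
      rw [inv_lt_inv₀ hb ha]; exact hab
    have h2 : (1 + q ^ 2) * a < (1 + q ^ 2) * b := by
      have : 0 < 1 + q ^ 2 := by positivity
      exact mul_lt_mul_of_pos_left hab this
    linarith
  have hsq : ∀ y : ℝ, 0 < y → √(1 + (f y ^ 2 + q ^ 2)) = (q ^ 2 * y ^ 2 + y ^ 2 + 1) / (2 * y) := by
    intro y hy
    rw [Real.sqrt_eq_iff_mul_self_eq (by positivity) (by positivity)]
    simp only [hf]
    field_simp
    ring
  have himg : f '' Set.Ioi 0 = Set.univ := by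
    refine Set.eq_univ_of_forall fun p => ?_
    have ht : |p| < √(1 + (p ^ 2 + q ^ 2)) := by
      rw [← Real.sqrt_sq_eq_abs]
      exact Real.sqrt_lt_sqrt (by positivity) (by nlinarith [sq_nonneg q])
    have hp := neg_abs_le p
    -- The positive root of (1+q²)y² + 2py - 1 = 0, which is the equation f y = p cleared of
    -- denominators.
    refine ⟨(√(1 + (p ^ 2 + q ^ 2)) - p) / (1 + q ^ 2), ?_, ?_⟩
    · have := le_abs_self p
      have h1 : 0 < √(1 + (p ^ 2 + q ^ 2)) - p := by linarith
      exact div_pos h1 (by positivity)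
    · simp only [hf]
      have hpos : 0 < √(1 + (p ^ 2 + q ^ 2)) - p := by
        have := le_abs_self p
        linarith
      have hs := Real.sq_sqrt (show 0 ≤ 1 + (p ^ 2 + q ^ 2) by positivity)
      field_simp
      nlinarith
  symm
  rw [← setLIntegral_univ, ← himg,
    lintegral_image_eq_lintegral_abs_deriv_mul measurableSet_Ioi hd hanti.injOn]
  refine setLIntegral_congr_fun measurableSet_Ioi fun y hy => ?_
  have hy : 0 < y := hy
  rw [hsq y hy, mul_left_comm, ← ENNReal.ofReal_mul (abs_nonneg _)]
  congr 2
  rw [abs_of_neg]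
  · field_simp
    ring
  · have : 0 < (y ^ 2)⁻¹ := by positivity
    have : 0 ≤ q ^ 2 := by positivity
    linarith

/-- In the hyperboloid model t² = 1 + p² + q² the invariant measure is dp dq / t. In polar
coordinates r dr / √(1+r²) = dt, and the angle contributes 2π. -/
theorem lintegral_radial (φ : ℝ → ℝ≥0∞) (hφ : Measurable φ) :
    ∫⁻ p : ℝ × ℝ, φ (√(1 + (p.1 ^ 2 + p.2 ^ 2))) * ENNReal.ofReal (1 / √(1 + (p.1 ^ 2 + p.2 ^ 2))) =
      ENNReal.ofReal (2 * Real.pi) * ∫⁻ t in Set.Ioi (1 : ℝ), φ t := by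
  rw [← lintegral_comp_polarCoord_symm, polarCoord_target]
  set f : ℝ → ℝ := fun r => √(1 + r ^ 2) with hf
  have hd : ∀ r ∈ Set.Ioi (0 : ℝ), HasDerivWithinAt f (r / √(1 + r ^ 2)) (Set.Ioi 0) r := by
    intro r hr
    have h1 : HasDerivAt (fun r : ℝ => 1 + r ^ 2) (2 * r) r := by
      simpa using ((hasDerivAt_pow 2 r).const_add 1)
    have := (h1.sqrt (by positivity)).hasDerivWithinAt (s := Set.Ioi 0)
    rwa [mul_div_mul_left _ _ two_ne_zero] at this
  have hmono : StrictMonoOn f (Set.Ioi 0) := by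
    intro a ha b hb hab
    have ha : 0 < a := ha
    exact Real.sqrt_lt_sqrt (by positivity) (by nlinarith)
  have himg : f '' Set.Ioi 0 = Set.Ioi 1 := by
    ext t
    constructor
    · rintro ⟨r, hr, rfl⟩
      have hr : 0 < r := hr
      simp only [hf, Set.mem_Ioi]
      rw [Real.lt_sqrt (by norm_num)]
      nlinarith
    · intro ht
      have ht : 1 < t := ht
      refine ⟨√(t ^ 2 - 1), Real.sqrt_pos.mpr (by nlinarith), ?_⟩
      simp only [hf]
      rw [Real.sq_sqrt (by nlinarith), show 1 + (t ^ 2 - 1) = t ^ 2 by ring, Real.sqrt_sq (by linarith)]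
  have key : ∀ p : ℝ × ℝ, p ∈ Set.Ioi (0 : ℝ) ×ˢ Set.Ioo (-Real.pi) Real.pi →
      ENNReal.ofReal p.1 • (φ (√(1 + ((polarCoord.symm p).1 ^ 2 + (polarCoord.symm p).2 ^ 2))) *
        ENNReal.ofReal (1 / √(1 + ((polarCoord.symm p).1 ^ 2 + (polarCoord.symm p).2 ^ 2)))) =
      (ENNReal.ofReal (p.1 / √(1 + p.1 ^ 2)) * φ (√(1 + p.1 ^ 2))) * 1 := by
    rintro ⟨r, θ⟩ ⟨hr, -⟩
    have hr : 0 < r := hr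
    have : (polarCoord.symm (r, θ)).1 ^ 2 + (polarCoord.symm (r, θ)).2 ^ 2 = r ^ 2 := by
      simp only [polarCoord_symm_apply]
      nlinarith [Real.sin_sq_add_cos_sq θ]
    rw [this, smul_eq_mul, mul_one, mul_left_comm, ← ENNReal.ofReal_mul hr.le, mul_comm]
    congr 2
    simp only
    field_simp
  rw [setLIntegral_congr_fun (measurableSet_Ioi.prod measurableSet_Ioo) key,
    Measure.volume_eq_prod, ← Measure.prod_restrict, ← himg,
    lintegral_image_eq_lintegral_abs_deriv_mul measurableSet_Ioi hd hmono.injOn, lintegral_prod_mul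
      (f := fun r : ℝ => ENNReal.ofReal (r / √(1 + r ^ 2)) * φ (√(1 + r ^ 2)))
      (g := fun _ : ℝ => (1 : ℝ≥0∞)) (by fun_prop) (by fun_prop), mul_comm]
  congr 1
  · rw [lintegral_one, Measure.restrict_apply_univ, Real.volume_Ioo]
    congr 1
    ring
  · refine setLIntegral_congr_fun measurableSet_Ioi fun r hr => ?_
    have hr : 0 < r := hr
    rw [abs_of_nonneg (by positivity)]

theorem continuous_cosh_dist (w : ℍ) : Continuous fun z : ℍ => Real.cosh (dist z w) := by
  fun_prop

theorem lintegral_cosh_dist_I (φ : ℝ → ℝ≥0∞) (hφ : Measurable φ) :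
    ∫⁻ z : ℍ, φ (Real.cosh (dist z I)) =
      ENNReal.ofReal (2 * Real.pi) * ∫⁻ t in Set.Ioi (1 : ℝ), φ t := by
  have h1 : ∀ z : ℍ, φ (Real.cosh (dist z I)) =
      (fun w : ℂ => φ ((w.re ^ 2 + w.im ^ 2 + 1) / (2 * w.im))) z := by
    intro z
    rw [cosh_dist']
    simp
  have hmeas : Measurable fun w : ℂ => φ ((w.re ^ 2 + w.im ^ 2 + 1) / (2 * w.im)) := by
    have := Complex.measurable_im
    have := Complex.measurable_re
    fun_prop
  rw [lintegral_congr h1, lintegral_upperHalfPlane _ hmeas, ← lintegral_radial φ hφ,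
    Measure.volume_eq_prod, lintegral_prod_symm _ (by fun_prop)]
  -- Substituting x = qy prepares for the hyperboloid coordinates: after swapping the integrals, q
  -- is fixed and `lintegral_cosh_fiber` trades y for p.
  have h2 : ∀ y ∈ Set.Ioi (0 : ℝ),
      ∫⁻ x : ℝ, φ ((x ^ 2 + y ^ 2 + 1) / (2 * y)) * ENNReal.ofReal (1 / y ^ 2) =
      ∫⁻ q : ℝ, φ ((q ^ 2 * y ^ 2 + y ^ 2 + 1) / (2 * y)) * ENNReal.ofReal (1 / y) := by
    intro y hy
    have hy : 0 < y := hy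
    have himg : (fun q : ℝ => q * y) '' Set.univ = Set.univ := by
      rw [Set.image_univ]
      exact (mul_right_surjective₀ hy.ne').range_eq
    have hd : ∀ q ∈ (Set.univ : Set ℝ), HasDerivWithinAt (fun q : ℝ => q * y) y Set.univ q := by
      intro q _
      simpa using ((hasDerivAt_id' q).mul_const y)
    rw [← setLIntegral_univ (fun x : ℝ => _ * _)]
    nth_rw 1 [← himg]
    rw [lintegral_image_eq_lintegral_abs_deriv_mul MeasurableSet.univ hd
        (mul_left_injective₀ hy.ne').injOn, setLIntegral_univ]
    refine lintegral_congr fun q => ?_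
    rw [mul_left_comm, ← ENNReal.ofReal_mul (abs_nonneg _), mul_pow, abs_of_pos hy]
    congr 2
    field_simp
  rw [setLIntegral_congr_fun measurableSet_Ioi h2, lintegral_lintegral_swap]
  · exact lintegral_congr fun q => lintegral_cosh_fiber φ q
  · refine Measurable.aemeasurable ?_
    simp only [Function.uncurry_def]
    fun_prop

instance : SMulInvariantMeasure SL(2, ℝ) ℍ volume :=
  ⟨fun g _ hs => measure_preimage_smul_of_nullMeasurableSet hs.nullMeasurableSet
    (Matrix.SpecialLinearGroup.mapGL ℝ g)⟩

instance : ContinuousConstSMul SL(2, ℝ) ℍ :=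
  ⟨fun g => continuous_const_smul (T := ℍ) (Matrix.SpecialLinearGroup.mapGL ℝ g)⟩

/-- SL₂(ℝ) acts transitively by measure-preserving isometries, so the centre may be moved to i. -/
theorem lintegral_cosh_dist (φ : ℝ → ℝ≥0∞) (hφ : Measurable φ) (w : ℍ) :
    ∫⁻ z : ℍ, φ (Real.cosh (dist z w)) =
      ENNReal.ofReal (2 * Real.pi) * ∫⁻ t in Set.Ioi (1 : ℝ), φ t := by
  obtain ⟨g, rfl⟩ : ∃ g : SL(2, ℝ), g • I = w := MulAction.exists_smul_eq _ _ _
  rw [← lintegral_cosh_dist_I φ hφ, ← (measurePreserving_smul g (volume : Measure ℍ)).lintegral_comp]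
  · simp
  · have := (continuous_cosh_dist (g • I)).measurable
    fun_prop

/-! ### The Legendre function: decay, integrability and its integral over (1, ∞). -/

/-- The integrand of the Legendre function of the second kind. -/
def legendreKernel (s : ℂ) (p : ℝ × ℝ) : ℂ :=
  ((1 - p.2 ^ 2 : ℝ) : ℂ) ^ (s - 1) * ((p.1 - p.2 : ℝ) : ℂ) ^ (-s)

theorem measurable_legendreKernel (s : ℂ) : Measurable (legendreKernel s) := by
  unfold legendreKernel
  fun_prop

theorem legendreQ_eq (s : ℂ) (t : ℝ) :
    legendreQ s t = (2 : ℂ) ^ (-s) * ∫ v in Set.Ioo (-1 : ℝ) 1, legendreKernel s (t, v) := by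
  rw [legendreQ, intervalIntegral.integral_of_le (by norm_num), integral_Ioc_eq_integral_Ioo]
  rfl

theorem stronglyMeasurable_legendreQ (s : ℂ) : StronglyMeasurable (legendreQ s) := by
  have h : legendreQ s = fun t => (2 : ℂ) ^ (-s) * ∫ v in Set.Ioo (-1 : ℝ) 1, legendreKernel s (t, v) :=
    funext (legendreQ_eq s)
  rw [h]
  exact ((measurable_legendreKernel s).stronglyMeasurable.integral_prod_right').const_mul _

theorem norm_legendreKernel {s : ℂ} {t v : ℝ} (ht : v < t) (hv : v ∈ Set.Ioo (-1 : ℝ) 1) :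
    ‖legendreKernel s (t, v)‖ = (1 - v ^ 2) ^ (s.re - 1) * (t - v) ^ (-s.re) := by
  have h1 : 0 < 1 - v ^ 2 := by nlinarith [hv.1, hv.2]
  rw [legendreKernel, norm_mul, Complex.norm_cpow_eq_rpow_re_of_pos h1,
    Complex.norm_cpow_eq_rpow_re_of_pos (by simpa using ht)]
  simp

/-- For t ≥ 2 and |v| < 1 one has t - v ≥ t/2, while (1-v²)^(Re s - 1) ≤ 1; the factor 2 in the
constant is the length of (-1,1). -/
theorem norm_legendreQ_le {s : ℂ} (hs : 1 < s.re) :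
    ∃ C : ℝ, 0 ≤ C ∧ ∀ t : ℝ, 2 ≤ t → ‖legendreQ s t‖ ≤ C * t ^ (-s.re) := by
  refine ⟨‖(2 : ℂ) ^ (-s)‖ * ((1 / 2 : ℝ) ^ (-s.re) * 2), by positivity, fun t ht => ?_⟩
  rw [legendreQ_eq, norm_mul, mul_assoc]
  refine mul_le_mul_of_nonneg_left ?_ (norm_nonneg _)
  have hb : ∀ v ∈ Set.Ioo (-1 : ℝ) 1, ‖legendreKernel s (t, v)‖ ≤ (1 / 2 * t) ^ (-s.re) := by
    intro v hv
    have h1 : 0 < 1 - v ^ 2 := by nlinarith [hv.1, hv.2]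
    rw [norm_legendreKernel (by linarith [hv.2]) hv]
    have h2 : (1 - v ^ 2) ^ (s.re - 1) ≤ 1 :=
      Real.rpow_le_one h1.le (by nlinarith [sq_nonneg v]) (by linarith)
    have h3 : (t - v) ^ (-s.re) ≤ (1 / 2 * t) ^ (-s.re) :=
      Real.rpow_le_rpow_of_nonpos (by linarith) (by linarith [hv.2]) (by linarith)
    calc _ ≤ 1 * (1 / 2 * t) ^ (-s.re) := by
          refine mul_le_mul h2 h3 (Real.rpow_nonneg (by linarith [hv.2]) _) zero_le_one
      _ = _ := one_mul _
  refine (norm_setIntegral_le_of_norm_le_const (by simp) hb).trans (le_of_eq ?_)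
  rw [Real.mul_rpow (by norm_num) (by linarith)]
  simp [Measure.real]
  norm_num
  ring

theorem setIntegral_Ioi_comp_sub {E : Type*} [NormedAddCommGroup E] [NormedSpace ℝ E] (f : ℝ → E)
    (v : ℝ) : ∫ t in Set.Ioi (1 : ℝ), f (t - v) = ∫ t in Set.Ioi (1 - v), f t := by
  have h := (measurePreserving_sub_right volume v).setIntegral_preimage_emb
    (MeasurableEquiv.subRight v).measurableEmbedding f (Set.Ioi (1 - v))
  simpa using h

theorem integrableOn_Ioi_comp_sub {E : Type*} [NormedAddCommGroup E] {f : ℝ → E}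
    {v : ℝ} (h : IntegrableOn f (Set.Ioi (1 - v))) :
    IntegrableOn (fun t => f (t - v)) (Set.Ioi (1 : ℝ)) := by
  rw [← (measurePreserving_sub_right volume v).integrableOn_comp_preimage
    (MeasurableEquiv.subRight v).measurableEmbedding] at h
  simpa [Function.comp_def] using h

theorem integrableOn_one_add_cpow {s : ℂ} (hs : 1 < s.re) :
    IntegrableOn (fun v : ℝ => ((1 + v : ℝ) : ℂ) ^ (s - 1) / (s - 1)) (Set.Ioo (-1) 1) := by
  have hc : Continuous fun v : ℝ => ((1 + v : ℝ) : ℂ) ^ (s - 1) / (s - 1) := by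
    have := Complex.continuous_ofReal_cpow_const (y := s - 1) (by simpa using hs)
    exact (this.comp (by fun_prop : Continuous fun v : ℝ => 1 + v)).div_const _
  exact (hc.integrableOn_Icc (a := -1) (b := 1)).mono_set Set.Ioo_subset_Icc_self

/-- By Tonelli, with σ = Re s: the t-integral of the norm is (1-v²)^(σ-1)(1-v)^(1-σ)/(σ-1) =
(1+v)^(σ-1)/(σ-1), since the powers of 1-v cancel. This is bounded on (-1,1). -/
theorem integrable_legendreKernel {s : ℂ} (hs : 1 < s.re) :
    Integrable (legendreKernel s)
      ((volume.restrict (Set.Ioi 1)).prod (volume.restrict (Set.Ioo (-1) 1))) := by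
  rw [integrable_prod_iff' (measurable_legendreKernel s).aestronglyMeasurable]
  constructor
  · refine (ae_restrict_iff' measurableSet_Ioo).mpr (Filter.Eventually.of_forall fun v hv => ?_)
    simp only [legendreKernel]
    refine Integrable.const_mul (f := fun t : ℝ => ((t - v : ℝ) : ℂ) ^ (-s)) ?_ _
    refine integrableOn_Ioi_comp_sub (f := fun t : ℝ => (t : ℂ) ^ (-s)) ?_
    exact integrableOn_Ioi_cpow_of_lt (by simpa using hs) (by linarith [hv.2])
  · refine (integrableOn_congr_fun ?_ measurableSet_Ioo).mpr
      (integrableOn_one_add_cpow (s := (s.re : ℂ)) (by simpa using hs)).norm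
    intro v hv
    simp only
    have h1 : 0 < 1 - v := by linarith [hv.2]
    have h2 : 0 < 1 + v := by linarith [hv.1]
    rw [setIntegral_congr_fun measurableSet_Ioi
      (g := fun t => (1 - v ^ 2) ^ (s.re - 1) * (t - v) ^ (-s.re))
      (fun t ht => norm_legendreKernel (lt_trans hv.2 ht) hv), integral_const_mul,
      setIntegral_Ioi_comp_sub (fun t => t ^ (-s.re)),
      integral_Ioi_rpow_of_lt (by linarith) h1, norm_div,
      Complex.norm_cpow_eq_rpow_re_of_pos h2, show 1 - v ^ 2 = (1 + v) * (1 - v) by ring,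
      Real.mul_rpow h2.le h1.le]
    have h3 : ‖(s.re : ℂ) - 1‖ = s.re - 1 := by
      rw [← Complex.ofReal_one, ← Complex.ofReal_sub, Complex.norm_real, Real.norm_eq_abs,
        abs_of_pos (by linarith)]
    rw [h3, show -s.re + 1 = -(s.re - 1) by ring, Real.rpow_neg h1.le]
    have h4 : (1 - v) ^ (s.re - 1) ≠ 0 := (Real.rpow_pos_of_pos h1 _).ne'
    have h5 : s.re - 1 ≠ 0 := by linarith
    simp only [Complex.sub_re, Complex.ofReal_re, Complex.one_re]
    field_simp

theorem integrableOn_legendreQ {s : ℂ} (hs : 1 < s.re) : IntegrableOn (legendreQ s) (Set.Ioi 1) := by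
  rw [funext (legendreQ_eq s)]
  exact ((integrable_legendreKernel hs).integral_prod_left).const_mul _

/-- Integrating first over t leaves 2^(-s) ∫_{-1}^1 (1+v)^(s-1)/(s-1) dv, which is 2^(-s) · 2^s /
(s(s-1)). -/
theorem integral_legendreQ {s : ℂ} (hs : 1 < s.re) :
    ∫ t in Set.Ioi (1 : ℝ), legendreQ s t = 1 / (s * (s - 1)) := by
  have hs0 : s ≠ 0 := by
    rintro rfl
    norm_num at hs
  have hs1 : s - 1 ≠ 0 := by
    intro h
    rw [sub_eq_zero] at h
    rw [h] at hs
    norm_num at hs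
  rw [funext (legendreQ_eq s), integral_const_mul,
    integral_integral_swap (f := fun t v => legendreKernel s (t, v)) (integrable_legendreKernel hs)]
  have h1 : ∀ v ∈ Set.Ioo (-1 : ℝ) 1, ∫ t in Set.Ioi (1 : ℝ), legendreKernel s (t, v) =
      ((1 + v : ℝ) : ℂ) ^ (s - 1) / (s - 1) := by
    intro v hv
    have h1 : 0 < 1 - v := by linarith [hv.2]
    have h2 : 0 < 1 + v := by linarith [hv.1]
    simp only [legendreKernel]
    rw [integral_const_mul, setIntegral_Ioi_comp_sub (fun t : ℝ => (t : ℂ) ^ (-s)),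
      integral_Ioi_cpow_of_lt (by simpa using hs) h1]
    rw [show 1 - v ^ 2 = (1 + v) * (1 - v) by ring, Complex.ofReal_mul,
      Complex.mul_cpow_ofReal_nonneg h2.le h1.le, show -s + 1 = -(s - 1) by ring, Complex.cpow_neg]
    have h4 : ((1 - v : ℝ) : ℂ) ^ (s - 1) ≠ 0 := by
      rw [Complex.cpow_ne_zero_iff_of_exponent_ne_zero hs1]
      exact_mod_cast h1.ne'
    field_simp
  rw [setIntegral_congr_fun measurableSet_Ioo h1, integral_div, ← integral_Ioc_eq_integral_Ioo,
    ← intervalIntegral.integral_of_le (by norm_num),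
    intervalIntegral.integral_comp_add_left (fun v : ℝ => (v : ℂ) ^ (s - 1)),
    integral_cpow (Or.inl (by simp; linarith))]
  norm_num [Complex.zero_cpow hs0]
  rw [Complex.cpow_neg]
  have : (2 : ℂ) ^ s ≠ 0 := by simp
  field_simp

/-! ### Fundamental domains of countable groups, and unfolding. -/

section FundamentalDomain

open scoped Pointwise

variable {G X : Type*} [Group G] [MulAction G X]

/-- Only finitely many g bring V back to itself; for each of these the Hausdorff property separates
x from g • x, and the finitely many resulting neighbourhoods are intersected. -/
theorem exists_open_disjoint_smul [TopologicalSpace X] [T2Space X] [ContinuousConstSMul G X] (x : X)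
    (hV : ∃ V : Set X, IsOpen V ∧ x ∈ V ∧ {g : G | ((g • V) ∩ V).Nonempty}.Finite)
    (hx : ∀ g : G, g ≠ 1 → g • x ≠ x) :
    ∃ U : Set X, IsOpen U ∧ x ∈ U ∧ ∀ g : G, g ≠ 1 → Disjoint (g • U) U := by
  obtain ⟨V, hVo, hxV, hfin⟩ := hV
  have hex : ∀ g : G, ∃ U : Set X, IsOpen U ∧ x ∈ U ∧ (g ≠ 1 → Disjoint (g • U) U) := by
    intro g
    by_cases hg : g = 1
    · exact ⟨Set.univ, isOpen_univ, trivial, fun h => absurd hg h⟩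
    · obtain ⟨A, B, hA, hB, hxA, hxB, hAB⟩ := t2_separation (hx g hg)
      refine ⟨B ∩ (g • ·) ⁻¹' A, hB.inter (hA.preimage (continuous_const_smul g)), ⟨hxB, hxA⟩,
        fun _ => ?_⟩
      rw [Set.disjoint_left]
      rintro _ ⟨y, hy, rfl⟩ hz
      exact Set.disjoint_left.mp hAB hy.2 hz.1
  choose U hUo hxU hU using hex
  refine ⟨V ∩ ⋂ g ∈ {g : G | ((g • V) ∩ V).Nonempty}, U g,
    hVo.inter (hfin.isOpen_biInter fun g _ => hUo g), ⟨hxV, Set.mem_iInter₂.mpr fun g _ => hxU g⟩, ?_⟩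
  intro g hg
  rw [Set.disjoint_left]
  rintro _ ⟨y, hy, rfl⟩ hz
  have hmem : g ∈ {g : G | ((g • V) ∩ V).Nonempty} := ⟨g • y, ⟨y, hy.1, rfl⟩, hz.1⟩
  exact Set.disjoint_left.mp (hU g hg) ⟨y, Set.mem_iInter₂.mp hy.2 g hmem, rfl⟩
    (Set.mem_iInter₂.mp hz.2 g hmem)

/-- Countably many basic open sets with pairwise disjoint translates meet almost every orbit.
Enumerating them, each orbit is represented inside the first one that it meets. -/
theorem hasFundamentalDomain_of_ae_disjoint [Countable G] [TopologicalSpace X]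
    [SecondCountableTopology X] [MeasurableSpace X] [OpensMeasurableSpace X]
    [MeasurableConstSMul G X] (μ : Measure X)
    (h : ∀ᵐ x ∂μ, ∃ U : Set X, IsOpen U ∧ x ∈ U ∧ ∀ g : G, g ≠ 1 → Disjoint (g • U) U) :
    HasFundamentalDomain G X μ := by
  classical
  -- The empty set is added so that C is nonempty and can be enumerated by ℕ.
  let C : Set (Set X) := insert ∅ {U | U ∈ TopologicalSpace.countableBasis X ∧
    ∀ g : G, g ≠ 1 → Disjoint (g • U) U}
  have hC : C.Countable :=
    ((TopologicalSpace.countable_countableBasis X).mono fun U hU => hU.1).insert _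
  obtain ⟨f, hf⟩ := hC.exists_eq_range (Set.insert_nonempty _ _)
  have hfC : ∀ n, f n ∈ C := fun n => hf ▸ Set.mem_range_self n
  have hopen : ∀ n, IsOpen (f n) := by
    intro n
    rcases hfC n with h | h
    · rw [h]
      exact isOpen_empty
    · exact TopologicalSpace.isOpen_of_mem_countableBasis h.1
  have hdisj : ∀ n, ∀ g : G, g ≠ 1 → Disjoint (g • f n) (f n) := by
    intro n
    rcases hfC n with h | h
    · simp [h]
    · exact h.2
  let F : Set X := ⋃ n, (f n \ ⋃ k < n, ⋃ g : G, g • f k)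
  have hFd : ∀ g : G, g ≠ 1 → Disjoint (g • F) F := by
    intro g hg
    rw [Set.disjoint_left]
    rintro _ ⟨y, hy, rfl⟩ hz
    simp only [F, Set.mem_iUnion, Set.mem_sdiff, not_exists] at hy hz
    obtain ⟨n, hyn, hy⟩ := hy
    obtain ⟨m, hzm, hz⟩ := hz
    rcases lt_trichotomy n m with hnm | hnm | hnm
    · exact hz n hnm g ⟨y, hyn, rfl⟩
    · subst hnm
      exact Set.disjoint_left.mp (hdisj n g hg) ⟨y, hyn, rfl⟩ hzm
    · exact hy m hnm g⁻¹ ⟨g • y, hzm, inv_smul_smul g y⟩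
  refine ⟨⟨F, ?_, ?_, ?_⟩⟩
  · refine (MeasurableSet.iUnion fun n => (hopen n).measurableSet.diff
      (MeasurableSet.iUnion fun k => MeasurableSet.iUnion fun _ =>
        MeasurableSet.iUnion fun g => (hopen k).measurableSet.const_smul g)).nullMeasurableSet
  · filter_upwards [h] with x hx
    obtain ⟨U, hU, hxU, hdU⟩ := hx
    obtain ⟨W, hW, hxW, hWU⟩ :=
      (TopologicalSpace.isBasis_countableBasis X).exists_subset_of_mem_open hxU hU
    have hWC : W ∈ C := Or.inr ⟨hW, fun g hg => (hdU g hg).mono (Set.smul_set_mono hWU) hWU⟩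
    rw [hf] at hWC
    obtain ⟨n0, hn0⟩ := hWC
    have hex : ∃ n, ∃ g : G, g • x ∈ f n := ⟨n0, 1, by rwa [one_smul, hn0]⟩
    obtain ⟨g, hg⟩ := Nat.find_spec hex
    refine ⟨g, Set.mem_iUnion.mpr ⟨Nat.find hex, hg, ?_⟩⟩
    simp only [Set.mem_iUnion, not_exists]
    rintro k hk a ⟨y, hy, hay⟩
    refine Nat.find_min hex hk ⟨a⁻¹ * g, ?_⟩
    rw [mul_smul, ← hay]
    simpa using hy
  · intro a b hab
    have h1 : Disjoint (a • F) (b • F) := by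
      have h2 := hFd (b⁻¹ * a) (by
        intro h
        exact hab (inv_mul_eq_one.mp h).symm)
      rw [Set.disjoint_left] at h2 ⊢
      rintro _ ⟨y, hy, rfl⟩ ⟨z, hz, hzy⟩
      refine h2 ⟨y, hy, rfl⟩ ?_
      simp only at hzy ⊢
      rw [mul_smul, ← hzy, inv_smul_smul]
      exact hz
    exact h1.aedisjoint

variable [Countable G] [MeasurableSpace X] [MeasurableConstSMul G X] {μ : Measure X}
  [SMulInvariantMeasure G X μ]

/-- Folding S into F writes ∫_S φ as the sum of the integrals over the pieces g • S ∩ F, and these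
cover F because S meets every orbit. -/
theorem setLIntegral_le_of_covers {F S : Set X} (hF : IsFundamentalDomain G F μ)
    (hS : ∀ x, ∃ g : G, g • x ∈ S) (φ : X → ℝ≥0∞) (hφ : ∀ (g : G) (x : X), φ (g • x) = φ x) :
    ∫⁻ x in F, φ x ∂μ ≤ ∫⁻ x in S, φ x ∂μ := by
  rw [hF.setLIntegral_eq_tsum' φ S]
  simp only [hφ]
  refine le_trans (lintegral_mono_set ?_) (lintegral_iUnion_le _ _)
  intro x hx
  obtain ⟨g, hg⟩ := hS x
  exact Set.mem_iUnion.mpr ⟨g⁻¹, ⟨g • x, hg, inv_smul_smul g x⟩, hx⟩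

theorem setLIntegral_comp_smul (g : G) (φ : X → ℝ≥0∞) (F : Set X) :
    ∫⁻ x in F, φ (g • x) ∂μ = ∫⁻ x in g • F, φ x ∂μ := by
  exact (measurePreserving_smul g μ).setLIntegral_comp_emb (measurableEmbedding_const_smul g) φ F

/-- Unfolding: each element of `G` is written twice as `h * c i`. -/
theorem tsum_setLIntegral_smul_eq (H : Subgroup G) {F D : Set X} (hF : IsFundamentalDomain G F μ)
    (hD : IsFundamentalDomain H D μ) (φ : X → ℝ≥0∞) (hφ : ∀ (h : H) (x : X), φ (h • x) = φ x)
    {ι : Type*} (c : ι → G) (e : Bool × G ≃ ι × H)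
    (he : ∀ p, ((e p).2 : G) * c (e p).1 = p.2) :
    ∑' i, ∫⁻ x in F, φ (c i • x) ∂μ = 2 * ∫⁻ x in D, φ x ∂μ := by
  have h1 : ∀ i, ∫⁻ x in F, φ (c i • x) ∂μ = ∑' h : H, ∫⁻ x in D ∩ ((h : G) * c i) • F, φ x ∂μ := by
    intro i
    rw [setLIntegral_comp_smul, hD.setLIntegral_eq_tsum' φ]
    refine tsum_congr fun h => ?_
    simp only [hφ]
    rw [Set.inter_comm, mul_smul]
    rfl
  simp_rw [h1]
  -- Reindexing by e lets the product h * c i run through G once for each Boolean; the sum over G of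
  -- the integrals over D ∩ g • F is ∫_D φ.
  rw [← ENNReal.tsum_prod (f := fun i (h : H) => ∫⁻ x in D ∩ ((h : G) * c i) • F, φ x ∂μ),
    ← e.tsum_eq]
  simp_rw [he]
  rw [ENNReal.tsum_prod (f := fun (_ : Bool) (g : G) => ∫⁻ x in D ∩ g • F, φ x ∂μ)]
  rw [hF.setLIntegral_eq_tsum φ D, tsum_bool, two_mul]

end FundamentalDomain

/-! ### Möbius transformations -/

/-- Fixed points are roots of cz² + (d-a)z - b, which vanishes identically only for scalar matrices,
that is, for ±1. -/
theorem finite_fixedPoints {g : SL(2, ℝ)} (h1 : g ≠ 1) (h2 : g ≠ -1) :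
    {z : ℍ | g • z = z}.Finite := by
  let p : Polynomial ℂ := Polynomial.C (g 1 0 : ℂ) * Polynomial.X ^ 2 +
    Polynomial.C ((g 1 1 : ℂ) - g 0 0) * Polynomial.X + Polynomial.C (-(g 0 1 : ℂ))
  have hp : p ≠ 0 := by
    intro hp
    have hc0 := congrArg (fun q => q.coeff 0) hp
    have hc1 := congrArg (fun q => q.coeff 1) hp
    have hc2 := congrArg (fun q => q.coeff 2) hp
    simp [p, Polynomial.coeff_X, Polynomial.coeff_C] at hc0 hc1 hc2
    have had : g 1 1 = g 0 0 := by
      rw [sub_eq_zero] at hc1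
      exact_mod_cast hc1
    have hdet := g.det_coe
    rw [Matrix.det_fin_two] at hdet
    simp only [hc0, hc2, had] at hdet
    have h3 : (g 0 0 - 1) * (g 0 0 + 1) = 0 := by linarith
    rcases mul_eq_zero.mp h3 with h | h
    · refine h1 (Matrix.SpecialLinearGroup.ext _ _ fun i j => ?_)
      fin_cases i <;> fin_cases j <;> simp [hc0, hc2, had] <;> linarith
    · refine h2 (Matrix.SpecialLinearGroup.ext _ _ fun i j => ?_)
      fin_cases i <;> fin_cases j <;> simp [hc0, hc2, had] <;> linarith
  have hfin : {z : ℂ | p.IsRoot z}.Finite := Polynomial.finite_setOfPred_isRoot hp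
  refine (hfin.preimage (f := UpperHalfPlane.coe) coe_injective.injOn).subset ?_
  intro z hz
  have hz : g • z = z := hz
  have hd : (g 1 0 : ℂ) * z + g 1 1 ≠ 0 := denom_ne_zero (g : GL (Fin 2) ℝ) z
  have h := coe_specialLinearGroup_apply g z
  rw [hz] at h
  simp only [Algebra.algebraMap_self, RingHom.id_apply] at h
  rw [eq_div_iff hd] at h
  simp only [Set.mem_preimage, Set.mem_ofPred_eq, Polynomial.IsRoot, p, Polynomial.eval_add,
    Polynomial.eval_mul, Polynomial.eval_C, Polynomial.eval_pow, Polynomial.eval_X]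
  linear_combination h

instance : NullSingletonClass (volume : Measure ℍ) :=
  ⟨fun z => by rw [volume_eq_lintegral, Set.image_singleton]; simp⟩

instance : SigmaFinite eta := by
  exact inferInstanceAs (SigmaFinite (Real.toNNReal (1 / (4 * Real.pi)) • (volume : Measure ℍ)))

instance : NullSingletonClass eta := ⟨fun z => by
    rw [eta, Measure.smul_apply, measure_singleton, smul_zero]⟩

instance : SMulInvariantMeasure SL(2, ℝ) ℍ eta :=
  inferInstanceAs (SMulInvariantMeasure SL(2, ℝ) ℍ (ENNReal.ofReal (1 / (4 * Real.pi)) • volume))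

theorem isCompact_smul_inter (U : Set ℍ) (hU : IsCompact U) :
    IsCompact {g : SL(2, ℝ) | ((g • ·) '' U ∩ U).Nonempty} := 
  ProperSMul.isCompact_setOfPred_inter_nonempty hU hU

/-- The action of SL₂(ℝ) on ℍ is proper, so the matrices carrying some point of U into U form a
compact set, on which the entries are bounded. -/
theorem exists_entry_bound (U : Set ℍ) (hU : IsCompact U) :
    ∃ R : ℝ, ∀ g : SL(2, ℝ), ∀ z ∈ U, g • z ∈ U → ∀ i j, |g i j| ≤ R := by
  have hcont : ∀ i j, Continuous fun g : SL(2, ℝ) => |g i j| := by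
    intro i j
    have : Continuous fun g : SL(2, ℝ) => g.1 := continuous_subtype_val
    fun_prop
  have hb : ∀ i j, ∃ R : ℝ, ∀ g : SL(2, ℝ), ∀ z ∈ U, g • z ∈ U → |g i j| ≤ R := by
    intro i j
    obtain ⟨R, hR⟩ := ((isCompact_smul_inter U hU).image (hcont i j)).bddAbove
    exact ⟨R, fun g z hz hgz => hR ⟨g, ⟨g • z, ⟨z, hz, rfl⟩, hgz⟩, rfl⟩⟩
  choose R hR using hb
  refine ⟨∑ i, ∑ j, |R i j|, fun g z hz hgz i j => (hR i j g z hz hgz).trans ?_⟩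
  refine (le_abs_self _).trans ((Finset.single_le_sum (f := fun j => |R i j|)
    (fun j _ => abs_nonneg _) (Finset.mem_univ j)).trans
    (Finset.single_le_sum (f := fun i => ∑ j, |R i j|)
    (fun i _ => Finset.sum_nonneg fun j _ => abs_nonneg _) (Finset.mem_univ i)))

/-! ### The actions of `SL₂(K)` -/

section Action

variable {K : Type*} [Field K] [NumberField K] (ι : K →+* ℝ) (τ : K ≃ₐ[ℚ] K)

theorem moebius_apply (M : SL(2, K)) (z : ℍ) :
    moebius ι M z = Matrix.SpecialLinearGroup.map ι M • z := rfl

theorem map_coe (M : SL(2, K)) (i j : Fin 2) :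
    (Matrix.SpecialLinearGroup.map ι M : SL(2, ℝ)) i j = ι (M i j) := rfl

theorem hilbertAct_apply (M : SL(2, K)) (z : ℍ × ℍ) :
    hilbertAct ι τ M z = (moebius ι M z.1, moebius (conjEmb ι τ) M z.2) := rfl

theorem map_injective : Function.Injective (Matrix.SpecialLinearGroup.map ι : SL(2, K) →* SL(2, ℝ)) := by
  intro M N h
  refine Matrix.SpecialLinearGroup.ext _ _ fun i j => ι.injective ?_
  rw [← map_coe, ← map_coe, h]

theorem map_neg_one : (Matrix.SpecialLinearGroup.map ι (-1 : SL(2, K)) : SL(2, ℝ)) = -1 := by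
  refine Matrix.SpecialLinearGroup.ext _ _ fun i j => ?_
  rw [map_coe]
  fin_cases i <;> fin_cases j <;> simp

theorem finite_fixedPoints_moebius {M : SL(2, K)} (h1 : M ≠ 1) (h2 : M ≠ -1) :
    {z : ℍ | moebius ι M z = z}.Finite := by
  refine finite_fixedPoints (g := Matrix.SpecialLinearGroup.map ι M) ?_ ?_
  · rw [← map_one (Matrix.SpecialLinearGroup.map ι)]
    exact (map_injective ι).ne h1
  · rw [← map_neg_one ι]
    exact (map_injective ι).ne h2

theorem moebius_neg (M : SL(2, K)) : moebius ι (-M) = moebius ι M := by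
  ext1 z
  have : Matrix.SpecialLinearGroup.map ι (-M) = -(Matrix.SpecialLinearGroup.map ι M : SL(2, ℝ)) := by
    refine Matrix.SpecialLinearGroup.ext _ _ fun i j => ?_
    rw [map_coe]
    simp
  rw [moebius_apply, moebius_apply, this]
  change (Matrix.SpecialLinearGroup.mapGL ℝ (-Matrix.SpecialLinearGroup.map ι M) : GL (Fin 2) ℝ) • z =
    (Matrix.SpecialLinearGroup.mapGL ℝ (Matrix.SpecialLinearGroup.map ι M) : GL (Fin 2) ℝ) • z
  rw [← UpperHalfPlane.neg_smul]
  congr 1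
  ext i j
  simp

theorem moebius_eq_one_iff {M : SL(2, K)} : moebius ι M = 1 ↔ M = 1 ∨ M = -1 := by
  constructor
  · intro h
    by_contra! hM
    have := finite_fixedPoints_moebius ι hM.1 hM.2
    rw [h] at this
    simp only [Equiv.Perm.coe_one, id_eq] at this
    exact Set.infinite_univ (α := ℍ) (by simpa using this)
  · rintro (rfl | rfl)
    · exact map_one _
    · rw [moebius_neg, map_one]

theorem hilbertAct_eq_one_iff {M : SL(2, K)} : hilbertAct ι τ M = 1 ↔ M = 1 ∨ M = -1 := by
  rw [← moebius_eq_one_iff ι]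
  constructor
  · intro h
    ext1 z
    have := DFunLike.congr_fun h (z, z)
    exact congrArg Prod.fst this
  · intro h
    have h2 : moebius (conjEmb ι τ) M = 1 := by
      rw [moebius_eq_one_iff, ← moebius_eq_one_iff ι]
      exact h
    ext1 z
    rw [hilbertAct_apply, h, h2]
    rfl

theorem hilbertAct_eq_iff {M N : SL(2, K)} :
    hilbertAct ι τ M = hilbertAct ι τ N ↔ M = N ∨ M = -N := by
  rw [← mul_inv_eq_one, ← map_inv, ← map_mul, hilbertAct_eq_one_iff, mul_inv_eq_one,
    mul_inv_eq_iff_eq_mul, neg_one_mul]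

theorem continuous_moebius (M : SL(2, K)) : Continuous (moebius ι M) :=
  continuous_const_smul (Matrix.SpecialLinearGroup.map ι M : SL(2, ℝ))

theorem continuous_hilbertAct (M : SL(2, K)) : Continuous (hilbertAct ι τ M) := by
  have h1 := continuous_moebius ι M
  have h2 := continuous_moebius (conjEmb ι τ) M
  change Continuous fun z : ℍ × ℍ => (moebius ι M z.1, moebius (conjEmb ι τ) M z.2)
  fun_prop

theorem measurePreserving_moebius (M : SL(2, K)) : MeasurePreserving (moebius ι M) eta eta :=
  measurePreserving_smul (Matrix.SpecialLinearGroup.map ι M : SL(2, ℝ)) eta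

theorem measurePreserving_hilbertAct (M : SL(2, K)) :
    MeasurePreserving (hilbertAct ι τ M) omegaSq omegaSq := by
  have h := (measurePreserving_moebius ι M).prod (measurePreserving_moebius (conjEmb ι τ) M)
  exact h.smul_measure 2

theorem countable_numberField : Countable K := by
  have b := Module.finBasis ℚ K
  exact Countable.of_equiv _ b.equivFun.toEquiv.symm

instance : Countable SL(2, K) := by
  have := countable_numberField (K := K)
  have : Countable (Matrix (Fin 2) (Fin 2) K) := inferInstanceAs (Countable (Fin 2 → Fin 2 → K))
  exact Subtype.coe_injective.countable

variable (𝔞 : (FractionalIdeal (𝓞 K)⁰ K)ˣ)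

instance : Countable (transfGroup ι τ 𝔞) :=
  ((hilbertGroup 𝔞 : Set SL(2, K)).to_countable.image (hilbertAct ι τ)).to_subtype

instance (A : Matrix (Fin 2) (Fin 2) K) : Countable (stabTransfGroup ι τ 𝔞 A) :=
  ((stabPM τ 𝔞 A : Set SL(2, K)).to_countable.image (moebius (conjEmb ι τ))).to_subtype

instance : ContinuousConstSMul (transfGroup ι τ 𝔞) (ℍ × ℍ) := by
  refine ⟨?_⟩
  rintro ⟨_, M, -, rfl⟩
  exact continuous_hilbertAct ι τ M

instance : SMulInvariantMeasure (transfGroup ι τ 𝔞) (ℍ × ℍ) omegaSq := by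
  refine ⟨?_⟩
  rintro ⟨_, M, -, rfl⟩ s hs
  exact (measurePreserving_hilbertAct ι τ M).measure_preimage hs.nullMeasurableSet

instance (A : Matrix (Fin 2) (Fin 2) K) : ContinuousConstSMul (stabTransfGroup ι τ 𝔞 A) ℍ := by
  refine ⟨?_⟩
  rintro ⟨_, M, -, rfl⟩
  exact continuous_moebius _ M

instance (A : Matrix (Fin 2) (Fin 2) K) :
    SMulInvariantMeasure (stabTransfGroup ι τ 𝔞 A) ℍ eta := by
  refine ⟨?_⟩
  rintro ⟨_, M, -, rfl⟩ s hs
  exact (measurePreserving_moebius _ M).measure_preimage hs.nullMeasurableSet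

end Action

/-! ### The vectors as Möbius transformations -/

section VectorMoebius

variable {K : Type*} [Field K] [NumberField K] (ι : K →+* ℝ) (τ : K ≃ₐ[ℚ] K)

/-- The normalized matrix of the Möbius transformation whose graph is the curve `T_A`. -/
def vectorSL (A : Matrix (Fin 2) (Fin 2) K) (hA : 0 < ι A.det) : SL(2, ℝ) :=
  ⟨(√(ι A.det))⁻¹ • !![ι (A 0 1), -ι (A 0 0); ι (A 1 1), -ι (A 1 0)], by
    rw [Matrix.det_smul, Matrix.det_fin_two_of, Fintype.card_fin, inv_pow, Real.sq_sqrt hA.le,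
      inv_mul_eq_one₀ hA.ne', Matrix.det_fin_two, map_sub, map_mul, map_mul]
    ring⟩

/-- With w = γ_A z₂ = (λ'z₂ - a)/(bz₂ - λ), the numerator of g factors as bz₁z₂ - λz₁ - λ'z₂ + a =
(z₁ - w)(bz₂ - λ), and Im w = det A · y₂ / |bz₂ - λ|². Hence g = |z₁ - w|² / (4 y₁ Im w), and the
formula for cosh of the hyperbolic distance applies. -/
theorem one_add_two_mul_gForm (A : Matrix (Fin 2) (Fin 2) K) (hA : 0 < ι A.det) (z : ℍ × ℍ) :
    1 + 2 * gForm ι A z = Real.cosh (dist z.1 (vectorSL ι A hA • z.2)) := by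
  set r := √(ι A.det) with hr
  have hr0 : 0 < r := Real.sqrt_pos.mpr hA
  have hr2 : r ^ 2 = ι A.det := Real.sq_sqrt hA.le
  set d : ℂ := (ι (A 1 1) : ℂ) * z.2 - ι (A 1 0) with hd
  set n : ℂ := (ι (A 0 1) : ℂ) * z.2 - ι (A 0 0) with hn
  have hd0 : d ≠ 0 := by
    intro h
    have him : ι (A 1 1) * z.2.im = 0 := by
      have := congrArg Complex.im h
      simpa [hd] using this
    have h11 : ι (A 1 1) = 0 := (mul_eq_zero.mp him).resolve_right z.2.im_ne_zero
    have h10 : ι (A 1 0) = 0 := by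
      have := congrArg Complex.re h
      simpa [hd, h11] using this
    rw [Matrix.det_fin_two, map_sub, map_mul, map_mul, h11, h10] at hA
    simp at hA
  have hw : ((vectorSL ι A hA • z.2 : ℍ) : ℂ) = n / d := by
    have hrc : (r : ℂ) ≠ 0 := by exact_mod_cast hr0.ne'
    rw [coe_specialLinearGroup_apply]
    simp only [vectorSL, Algebra.algebraMap_self, RingHom.id_apply]
    simp only [← hr, Matrix.smul_apply, Matrix.of_apply, Matrix.cons_val', Matrix.cons_val_zero,
      Matrix.cons_val_one, Matrix.cons_val_fin_one, smul_eq_mul, Complex.ofReal_mul,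
      Complex.ofReal_inv, Complex.ofReal_neg, hn, hd]
    rw [mul_assoc, mul_assoc, ← mul_add, ← mul_add, mul_div_mul_left _ _ (inv_ne_zero hrc)]
    simp only [sub_eq_add_neg]
  have hnd : (n / d).im = ι A.det * z.2.im / ‖d‖ ^ 2 := by
    rw [Complex.div_im, ← Complex.normSq_eq_norm_sq, ← sub_div]
    congr 1
    simp only [hn, hd, Complex.sub_im, Complex.sub_re, Complex.mul_im, Complex.mul_re,
      Complex.ofReal_re, Complex.ofReal_im, Matrix.det_fin_two, map_sub, map_mul, coe_re, coe_im]
    ring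
  have hwim : (vectorSL ι A hA • z.2 : ℍ).im = ι A.det * z.2.im / ‖d‖ ^ 2 := by
    rw [← hnd, ← hw]
    rfl
  rw [cosh_dist, hwim, hw, Complex.dist_eq, gForm, hForm]
  congr 1
  have hP : (ι (A 1 1) : ℂ) * z.1 * z.2 - (ι (A 1 0) : ℂ) * z.1 - (ι (A 0 1) : ℂ) * z.2 +
      (ι (A 0 0) : ℂ) = (z.1 - n / d) * d := by
    field_simp
    simp only [hn, hd]
    ring
  rw [hP, norm_mul]
  have h1 := z.1.im_pos
  have h2 := z.2.im_pos
  have h3 : 0 < ‖d‖ := norm_pos_iff.mpr hd0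
  field_simp
  ring

theorem det_matAct (M : SL(2, K)) (A : Matrix (Fin 2) (Fin 2) K) : (matAct τ M A).det = A.det := by
  have h1 : (M.1.map τ).det = 1 := by
    have := (RingHom.map_det (τ : K →+* K) M.1).symm
    rw [M.2, map_one] at this
    exact this
  rw [matAct, Matrix.det_mul, Matrix.det_mul, Matrix.det_transpose, h1, M.2, one_mul, mul_one]

/-- γ_A is a multiple of AJ with J = (0, -1; 1, 0), and M'ᵀ J M' = J because det M' = 1. Thus (M A
M'ᵀ) J M' = M A J: the assignment A ↦ γ_A intertwines the action on vectors with γ ↦ M γ M'⁻¹. -/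
theorem vectorSL_matAct (M : SL(2, K)) (A : Matrix (Fin 2) (Fin 2) K) (hA : 0 < ι A.det)
    (hMA : 0 < ι (matAct τ M A).det) :
    vectorSL ι (matAct τ M A) hMA * Matrix.SpecialLinearGroup.map (conjEmb ι τ) M =
      Matrix.SpecialLinearGroup.map ι M * vectorSL ι A hA := by
  have hdet : (conjEmb ι τ) (M 0 0) * (conjEmb ι τ) (M 1 1) -
      (conjEmb ι τ) (M 0 1) * (conjEmb ι τ) (M 1 0) = 1 := by
    rw [← map_mul, ← map_mul, ← map_sub, ← Matrix.det_fin_two, M.2, map_one]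
  refine Subtype.ext ?_
  rw [Matrix.SpecialLinearGroup.coe_mul, Matrix.SpecialLinearGroup.coe_mul]
  simp only [vectorSL, det_matAct]
  rw [Matrix.smul_mul, Matrix.mul_smul]
  congr 1
  have hc : ∀ x, (conjEmb ι τ) x = ι (τ x) := fun _ => rfl
  simp only [hc] at hdet
  ext i j
  fin_cases i <;> fin_cases j <;> simp [matAct, Matrix.mul_apply, Fin.sum_univ_two, hc]
  · linear_combination (ι (M 0 0) * ι (A 0 1) + ι (M 0 1) * ι (A 1 1)) * hdet
  · linear_combination -(ι (M 0 0) * ι (A 0 0) + ι (M 0 1) * ι (A 1 0)) * hdet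
  · linear_combination (ι (M 1 0) * ι (A 0 1) + ι (M 1 1) * ι (A 1 1)) * hdet
  · linear_combination -(ι (M 1 0) * ι (A 0 0) + ι (M 1 1) * ι (A 1 0)) * hdet

theorem gForm_matAct (M : SL(2, K)) (A : Matrix (Fin 2) (Fin 2) K) (hA : 0 < ι A.det)
    (z : ℍ × ℍ) : gForm ι (matAct τ M A) (hilbertAct ι τ M z) = gForm ι A z := by
  have hMA : 0 < ι (matAct τ M A).det := by rwa [det_matAct]
  have h := one_add_two_mul_gForm ι (matAct τ M A) hMA (hilbertAct ι τ M z)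
  rw [hilbertAct_apply, moebius_apply, moebius_apply, ← mul_smul, vectorSL_matAct ι τ M A hA hMA,
    mul_smul, dist_smul, ← one_add_two_mul_gForm, ← moebius_apply, ← moebius_apply,
    ← hilbertAct_apply] at h
  linarith

theorem gForm_neg (A : Matrix (Fin 2) (Fin 2) K) (z : ℍ × ℍ) : gForm ι (-A) z = gForm ι A z := by
  rw [gForm, gForm, Matrix.det_neg, hForm, hForm, ← norm_neg]
  simp only [Matrix.neg_apply, map_neg, Complex.ofReal_neg, Fintype.card_fin]
  congr 5
  · ring
  · ring

end VectorMoebius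

/-! ### Finiteness in number fields -/

section Arithmetic

variable {K : Type*} [Field K] [NumberField K] (hK : Module.finrank ℚ K = 2) (ι : K →+* ℝ)
  (τ : K ≃ₐ[ℚ] K) (hτ : τ ≠ 1)

include hK hτ in
-- A quadratic field has exactly two complex embeddings, and ι and ι ∘ τ are distinct because τ ≠ 1.
theorem embedding_eq (φ : K →+* ℂ) :
    φ = Complex.ofRealHom.comp ι ∨ φ = Complex.ofRealHom.comp (conjEmb ι τ) := by
  classical
  have hne : Complex.ofRealHom.comp ι ≠ Complex.ofRealHom.comp (conjEmb ι τ) := by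
    intro h
    refine hτ (AlgEquiv.ext fun x => ?_)
    have := DFunLike.congr_fun h x
    exact (ι.injective (Complex.ofReal_injective this)).symm
  have hcard : Fintype.card (K →+* ℂ) = 2 := by rw [NumberField.Embeddings.card, hK]
  have huniv : ({Complex.ofRealHom.comp ι, Complex.ofRealHom.comp (conjEmb ι τ)} :
      Finset (K →+* ℂ)) = Finset.univ := by
    rw [← Finset.card_eq_iff_eq_univ, hcard, Finset.card_pair hne]
  have := Finset.mem_univ φ
  rw [← huniv] at this
  simpa using this

include hK hτ in
theorem finite_integral_bounded (R : ℝ) :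
    {x : K | IsIntegral ℤ x ∧ |ι x| ≤ R ∧ |conjEmb ι τ x| ≤ R}.Finite := by
  refine (NumberField.Embeddings.finite_of_norm_le K ℂ R).subset ?_
  rintro x ⟨hx, h1, h2⟩
  refine ⟨hx, fun φ => ?_⟩
  rcases embedding_eq hK ι τ hτ φ with rfl | rfl
  · simpa using h1
  · simpa using h2

theorem exists_den (I : FractionalIdeal (𝓞 K)⁰ K) :
    ∃ a : 𝓞 K, a ≠ 0 ∧ ∀ x ∈ I, IsIntegral ℤ ((a : K) * x) := by
  obtain ⟨a, ha, h⟩ := I.isFractional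
  refine ⟨a, nonZeroDivisors.ne_zero ha, fun x hx => ?_⟩
  obtain ⟨y, hy⟩ := h x hx
  rw [Algebra.smul_def] at hy
  rw [← hy]
  exact y.isIntegral_coe

include hK hτ in
theorem finite_fractionalIdeal_bounded (I : FractionalIdeal (𝓞 K)⁰ K) (R : ℝ) :
    {x : K | x ∈ I ∧ |ι x| ≤ R ∧ |conjEmb ι τ x| ≤ R}.Finite := by
  obtain ⟨a, ha, h⟩ := exists_den I
  have ha' : (a : K) ≠ 0 := by simpa using ha
  refine ((finite_integral_bounded hK ι τ hτ
    (max (|ι a| * R) (|conjEmb ι τ a| * R))).preimage (mul_right_injective₀ ha').injOn).subset ?_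
  rintro x ⟨hx, h1, h2⟩
  refine ⟨h x hx, ?_, ?_⟩
  · rw [map_mul, abs_mul]
    exact (mul_le_mul_of_nonneg_left h1 (abs_nonneg _)).trans (le_max_left _ _)
  · rw [map_mul, abs_mul]
    exact (mul_le_mul_of_nonneg_left h2 (abs_nonneg _)).trans (le_max_right _ _)

include hK hτ in
theorem finite_hilbertGroup_bounded (𝔞 : (FractionalIdeal (𝓞 K)⁰ K)ˣ) (R : ℝ) :
    {M : SL(2, K) | M ∈ hilbertGroup 𝔞 ∧ ∀ i j, |ι (M i j)| ≤ R ∧ |conjEmb ι τ (M i j)| ≤ R}.Finite := by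
  have hfin := fun I => finite_fractionalIdeal_bounded hK ι τ hτ I R
  let f : SL(2, K) → K × K × K × K := fun M => (M 0 0, M 0 1, M 1 0, M 1 1)
  have hf : Function.Injective f := by
    intro M N h
    simp only [f, Prod.mk.injEq] at h
    refine Matrix.SpecialLinearGroup.ext _ _ fun i j => ?_
    fin_cases i <;> fin_cases j
    exacts [h.1, h.2.1, h.2.2.1, h.2.2.2]
  refine (((hfin 1).prod ((hfin ((𝔞⁻¹ : (FractionalIdeal (𝓞 K)⁰ K)ˣ) :
    FractionalIdeal (𝓞 K)⁰ K)).prod ((hfin (𝔞 : FractionalIdeal (𝓞 K)⁰ K)).prod (hfin 1)))).preimage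
    hf.injOn).subset ?_
  rintro M ⟨⟨h1, h2, h3, h4⟩, hb⟩
  exact ⟨⟨h1, hb 0 0⟩, ⟨h2, hb 0 1⟩, ⟨h3, hb 1 0⟩, ⟨h4, hb 1 1⟩⟩

include hK hτ in
/-- `Γ(𝔞)` acts properly discontinuously. -/
theorem finite_hilbertGroup_meets (𝔞 : (FractionalIdeal (𝓞 K)⁰ K)ˣ) (U : Set (ℍ × ℍ))
    (hU : IsCompact U) :
    {M : SL(2, K) | M ∈ hilbertGroup 𝔞 ∧ ∃ z ∈ U, hilbertAct ι τ M z ∈ U}.Finite := by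
  obtain ⟨R1, h1⟩ := exists_entry_bound _ (hU.image continuous_fst)
  obtain ⟨R2, h2⟩ := exists_entry_bound _ (hU.image continuous_snd)
  refine (finite_hilbertGroup_bounded hK ι τ hτ 𝔞 (max R1 R2)).subset ?_
  rintro M ⟨hM, z, hz, hMz⟩
  refine ⟨hM, fun i j => ⟨?_, ?_⟩⟩
  · exact (h1 (Matrix.SpecialLinearGroup.map ι M) z.1 ⟨z, hz, rfl⟩ ⟨_, hMz, rfl⟩ i j).trans
      (le_max_left _ _)
  · exact (h2 (Matrix.SpecialLinearGroup.map (conjEmb ι τ) M) z.2 ⟨z, hz, rfl⟩ ⟨_, hMz, rfl⟩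
      i j).trans (le_max_right _ _)

instance : SigmaFinite omegaSq :=
  inferInstanceAs (SigmaFinite ((2 : NNReal) • eta.prod eta))

open scoped Pointwise in
include hK hτ in
-- A nontrivial transformation has only finitely many fixed points in the first factor, so outside a
-- null set no point is fixed by one. There proper discontinuity gives open sets with disjoint
-- translates.
theorem hasFundamentalDomain_transfGroup (𝔞 : (FractionalIdeal (𝓞 K)⁰ K)ˣ) :
    HasFundamentalDomain (transfGroup ι τ 𝔞) (ℍ × ℍ) omegaSq := by
  refine hasFundamentalDomain_of_ae_disjoint omegaSq ?_
  have hae : ∀ᵐ z ∂omegaSq, ∀ g : transfGroup ι τ 𝔞, g ≠ 1 → g • z ≠ z := by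
    rw [ae_all_iff]
    rintro ⟨_, M, hM, rfl⟩
    by_cases h1 : M = 1 ∨ M = -1
    · refine Filter.Eventually.of_forall fun z hne => absurd (Subtype.ext ?_) hne
      exact (hilbertAct_eq_one_iff ι τ).mpr h1
    · push Not at h1
      have hfin := finite_fixedPoints_moebius ι h1.1 h1.2
      have hnull : omegaSq ({z : ℍ | moebius ι M z = z} ×ˢ Set.univ) = 0 := by
        rw [omegaSq, Measure.smul_apply, Measure.prod_prod, hfin.measure_zero, zero_mul, smul_zero]
      filter_upwards [measure_eq_zero_iff_ae_notMem.mp hnull] with z hz _ h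
      exact hz ⟨congrArg Prod.fst h, trivial⟩
  filter_upwards [hae] with z hz
  refine exists_open_disjoint_smul z ?_ hz
  refine ⟨Metric.ball z 1, Metric.isOpen_ball, Metric.mem_ball_self one_pos, ?_⟩
  refine Set.Finite.of_finite_image (f := Subtype.val) ?_ Subtype.val_injective.injOn
  refine ((finite_hilbertGroup_meets hK ι τ hτ 𝔞 (Metric.closedBall z 1)
    (isCompact_closedBall z 1)).image (hilbertAct ι τ)).subset ?_
  rintro _ ⟨⟨_, M, hM, rfl⟩, ⟨_, ⟨y, hy, rfl⟩, hMy⟩, rfl⟩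
  exact ⟨M, ⟨hM, y, Metric.ball_subset_closedBall hy, Metric.ball_subset_closedBall hMy⟩, rfl⟩

/-- The stabilizer of ±A preserves g(A, ·), hence the curve T_A, which is the graph of γ_A. -/
theorem vectorSL_smul_moebius {𝔞 : (FractionalIdeal (𝓞 K)⁰ K)ˣ} {A : Matrix (Fin 2) (Fin 2) K}
    (hA : 0 < ι A.det) {M : SL(2, K)} (hM : M ∈ stabPM τ 𝔞 A) (z : ℍ) :
    moebius ι M (vectorSL ι A hA • z) = vectorSL ι A hA • moebius (conjEmb ι τ) M z := by
  have h0 : gForm ι A (hilbertAct ι τ M (vectorSL ι A hA • z, z)) = 0 := by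
    have h2 : gForm ι A (vectorSL ι A hA • z, z) = 0 := by
      have := one_add_two_mul_gForm ι A hA (vectorSL ι A hA • z, z)
      rw [dist_self, Real.cosh_zero] at this
      linarith
    rw [← h2, ← gForm_matAct ι τ M A hA (vectorSL ι A hA • z, z)]
    rcases hM.2 with h | h
    · rw [h]
    · rw [h, gForm_neg]
  have h1 := one_add_two_mul_gForm ι A hA (hilbertAct ι τ M (vectorSL ι A hA • z, z))
  rw [h0, mul_zero, add_zero] at h1
  by_contra hne
  exact (Real.one_lt_cosh.mpr (dist_ne_zero.mpr hne)).ne h1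

open scoped Pointwise in
include hK hτ in
-- The map z ↦ (γ_A z, z) is equivariant for the stabilizer, so proper discontinuity on ℍ is
-- inherited from that of Γ(𝔞) on ℍ².
theorem hasFundamentalDomain_stabTransfGroup (𝔞 : (FractionalIdeal (𝓞 K)⁰ K)ˣ)
    (A : Matrix (Fin 2) (Fin 2) K) (hA : 0 < ι A.det) :
    HasFundamentalDomain (stabTransfGroup ι τ 𝔞 A) ℍ eta := by
  refine hasFundamentalDomain_of_ae_disjoint eta ?_
  have hae : ∀ᵐ z ∂eta, ∀ g : stabTransfGroup ι τ 𝔞 A, g ≠ 1 → g • z ≠ z := by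
    rw [ae_all_iff]
    rintro ⟨_, M, hM, rfl⟩
    by_cases h1 : M = 1 ∨ M = -1
    · refine Filter.Eventually.of_forall fun z hne => absurd (Subtype.ext ?_) hne
      exact (moebius_eq_one_iff _).mpr h1
    · push Not at h1
      have hfin := finite_fixedPoints_moebius (conjEmb ι τ) h1.1 h1.2
      filter_upwards [measure_eq_zero_iff_ae_notMem.mp (hfin.measure_zero eta)] with z hz _ h
      exact hz h
  filter_upwards [hae] with z hz
  refine exists_open_disjoint_smul z ?_ hz
  refine ⟨Metric.ball z 1, Metric.isOpen_ball, Metric.mem_ball_self one_pos, ?_⟩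
  refine Set.Finite.of_finite_image (f := Subtype.val) ?_ Subtype.val_injective.injOn
  have hcont : Continuous fun z : ℍ => (vectorSL ι A hA • z, z) :=
    (continuous_const_smul _).prodMk continuous_id
  refine ((finite_hilbertGroup_meets hK ι τ hτ 𝔞 _ ((isCompact_closedBall z 1).image hcont)).image
    (moebius (conjEmb ι τ))).subset ?_
  rintro _ ⟨⟨_, M, hM, rfl⟩, ⟨_, ⟨y, hy, rfl⟩, hMy⟩, rfl⟩
  refine ⟨M, ⟨hM.1, _, ⟨y, Metric.ball_subset_closedBall hy, rfl⟩, _,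
    Metric.ball_subset_closedBall hMy, ?_⟩, rfl⟩
  exact Prod.ext (vectorSL_smul_moebius ι τ hA hM y).symm rfl

include hK hτ ι in
theorem discr_pos : 0 < NumberField.discr K := by
  have hreal : NumberField.IsTotallyReal K := by
    refine ⟨fun v => ?_⟩
    rw [← InfinitePlace.mk_embedding v, InfinitePlace.isReal_mk_iff]
    have hr : ∀ ψ : K →+* ℝ, ComplexEmbedding.IsReal (Complex.ofRealHom.comp ψ) := by
      intro ψ
      ext x
      simp
    rcases embedding_eq hK ι τ hτ v.embedding with h | h <;> rw [h] <;> exact hr _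
  have h := NumberField.sign_discr K
  rw [IsTotallyReal.nrComplexPlaces_eq_zero, pow_zero] at h
  exact Int.sign_eq_one_iff_pos.mp h

include hK hτ in
theorem det_pos_of_mem_vectors {𝔞 : (FractionalIdeal (𝓞 K)⁰ K)ˣ} {m : ℕ} (hm : 0 < m)
    {A : Matrix (Fin 2) (Fin 2) K} (hA : A ∈ vectors τ 𝔞 m) : 0 < ι A.det := by
  have h1 : 0 < FractionalIdeal.absNorm (𝔞 : FractionalIdeal (𝓞 K)⁰ K) :=
    lt_of_le_of_ne (FractionalIdeal.absNorm_nonneg _)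
      (Ne.symm (mt FractionalIdeal.absNorm_eq_zero_iff.mp 𝔞.ne_zero))
  have h2 : (0 : ℚ) < NumberField.discr K := by exact_mod_cast discr_pos hK ι τ hτ
  rw [hA.2, map_ratCast]
  have : (0 : ℚ) < m := by exact_mod_cast hm
  exact_mod_cast div_pos this (mul_pos h1 h2)

end Arithmetic

/-! ### Invariance of the lattices under `Γ(𝔞)` -/

section LatticeInvariance

variable {K : Type*} [Field K] [NumberField K] (hK : Module.finrank ℚ K = 2) (ι : K →+* ℝ)
  (τ : K ≃ₐ[ℚ] K) (hτ : τ ≠ 1)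

theorem ofReal_comp_ne (hτ : τ ≠ 1) :
    Complex.ofRealHom.comp ι ≠ Complex.ofRealHom.comp (conjEmb ι τ) := by
  intro h
  refine hτ (AlgEquiv.ext fun x => ?_)
  have := DFunLike.congr_fun h x
  exact (ι.injective (Complex.ofReal_injective this)).symm

include hK hτ ι in
-- The embedding ι ∘ τ² is one of ι and ι ∘ τ; the second case would force τ = 1.
theorem conj_conj (x : K) : τ (τ x) = x := by
  rcases embedding_eq hK ι τ hτ (Complex.ofRealHom.comp (conjEmb (conjEmb ι τ) τ)) with h | h
  · have := DFunLike.congr_fun h x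
    exact ι.injective (Complex.ofReal_injective this)
  · refine absurd (AlgEquiv.ext fun y => ?_) hτ
    have h2 := DFunLike.congr_fun h y
    have h3 : τ (τ y) = τ y := ι.injective (Complex.ofReal_injective h2)
    exact τ.injective h3

include hK hτ in
theorem univ_embeddings [DecidableEq (K →+* ℂ)] :
    (Finset.univ : Finset (K →+* ℂ)) =
      {Complex.ofRealHom.comp ι, Complex.ofRealHom.comp (conjEmb ι τ)} := by
  ext φ
  simpa using embedding_eq hK ι τ hτ φ

theorem sum_algHom_eq (f : (K →+* ℂ) → ℂ) :
    ∑ σ : K →ₐ[ℚ] ℂ, f σ = ∑ φ : K →+* ℂ, f φ :=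
  Fintype.sum_equiv (RingHom.equivRatAlgHom K ℂ).symm _ _ fun _ => rfl

theorem prod_algHom_eq (f : (K →+* ℂ) → ℂ) :
    ∏ σ : K →ₐ[ℚ] ℂ, f σ = ∏ φ : K →+* ℂ, f φ :=
  Fintype.prod_equiv (RingHom.equivRatAlgHom K ℂ).symm _ _ fun _ => rfl

include hK hτ ι in
theorem trace_eq_add_conj (x : K) : ((Algebra.trace ℚ K x : ℚ) : K) = x + τ x := by
  classical
  have h := trace_eq_sum_embeddings ℂ (K := ℚ) (x := x)
  rw [show ∑ σ : K →ₐ[ℚ] ℂ, σ x = ∑ φ : K →+* ℂ, φ x from sum_algHom_eq (fun φ => φ x), univ_embeddings hK ι τ hτ,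
    Finset.sum_pair (ofReal_comp_ne ι τ hτ)] at h
  refine ι.injective (Complex.ofReal_injective ?_)
  rw [map_ratCast, map_add, Complex.ofReal_add]
  simpa [conjEmb] using h

include hK hτ ι in
theorem norm_eq_mul_conj (x : K) : ((Algebra.norm ℚ x : ℚ) : K) = x * τ x := by
  classical
  have h := Algebra.norm_eq_prod_embeddings ℚ ℂ x
  rw [show ∏ σ : K →ₐ[ℚ] ℂ, σ x = ∏ φ : K →+* ℂ, φ x from prod_algHom_eq (fun φ => φ x), univ_embeddings hK ι τ hτ,
    Finset.prod_pair (ofReal_comp_ne ι τ hτ)] at h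
  refine ι.injective (Complex.ofReal_injective ?_)
  rw [map_ratCast, map_mul, Complex.ofReal_mul]
  simpa [conjEmb] using h

include hK hτ ι in
theorem exists_rat_of_conj_eq {x : K} (hx : τ x = x) : ∃ q : ℚ, x = q := by
  refine ⟨Algebra.trace ℚ K x / 2, ?_⟩
  rw [Rat.cast_div, trace_eq_add_conj hK ι τ hτ, hx]
  push_cast
  ring

theorem mem_one_iff {x : K} : x ∈ (1 : FractionalIdeal (𝓞 K)⁰ K) ↔ IsIntegral ℤ x := by
  rw [FractionalIdeal.mem_one_iff]
  constructor
  · rintro ⟨y, rfl⟩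
    exact y.isIntegral_coe
  · intro h
    exact ⟨⟨x, h⟩, rfl⟩

include hK hτ ι in
theorem exists_int_of_conj_eq {x : K} (hx : τ x = x) (h1 : x ∈ (1 : FractionalIdeal (𝓞 K)⁰ K)) :
    ∃ n : ℤ, x = n := by
  obtain ⟨q, hq⟩ := exists_rat_of_conj_eq hK ι τ hτ hx
  rw [mem_one_iff, hq] at h1
  have h2 : IsIntegral ℤ q := by
    rw [← isIntegral_algebraMap_iff (algebraMap ℚ K).injective]
    simpa using h1
  obtain ⟨n, hn⟩ := IsIntegrallyClosed.isIntegral_iff.mp h2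
  refine ⟨n, ?_⟩
  rw [hq, ← hn]
  simp

theorem conj_mem_one {x : K} (h : x ∈ (1 : FractionalIdeal (𝓞 K)⁰ K)) :
    τ x ∈ (1 : FractionalIdeal (𝓞 K)⁰ K) := by
  rw [mem_one_iff] at h ⊢
  exact h.map ((τ : K ≃+* K).toIntAlgEquiv)

section Membership

variable {I J : FractionalIdeal (𝓞 K)⁰ K} {x y : K}

theorem add_mem_ideal (hx : x ∈ I) (hy : y ∈ I) : x + y ∈ I :=
  Submodule.add_mem (I : Submodule (𝓞 K) K) hx hy

theorem one_mul_mem (hx : x ∈ (1 : FractionalIdeal (𝓞 K)⁰ K)) (hy : y ∈ I) : x * y ∈ I := by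
  simpa using FractionalIdeal.mul_mem_mul hx hy

theorem mul_one_mem (hx : x ∈ I) (hy : y ∈ (1 : FractionalIdeal (𝓞 K)⁰ K)) : x * y ∈ I := by
  simpa using FractionalIdeal.mul_mem_mul hx hy

theorem int_mul_mem (n : ℤ) (hx : x ∈ I) : (n : K) * x ∈ I :=
  one_mul_mem (mem_one_iff.mpr (isIntegral_intCast n)) hx

theorem mul_inv_mem {𝔟 : (FractionalIdeal (𝓞 K)⁰ K)ˣ} (hx : x ∈ (𝔟 : FractionalIdeal (𝓞 K)⁰ K))
    (hy : y ∈ ((𝔟⁻¹ : (FractionalIdeal (𝓞 K)⁰ K)ˣ) : FractionalIdeal (𝓞 K)⁰ K)) :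
    x * y ∈ (1 : FractionalIdeal (𝓞 K)⁰ K) := by
  have := FractionalIdeal.mul_mem_mul hx hy
  rwa [Units.mul_inv] at this

end Membership

include hK hτ ι in
-- The ideal x𝔟 is integral, so it contains its own norm |xx'| N(𝔟). Dividing by x gives N(𝔟)x' ∈ 𝔟
-- up to sign. This replaces the identity 𝔟𝔟' = N(𝔟)𝓞.
theorem absNorm_mul_conj_mem (𝔟 : (FractionalIdeal (𝓞 K)⁰ K)ˣ) {x : K}
    (hx : x ∈ ((𝔟⁻¹ : (FractionalIdeal (𝓞 K)⁰ K)ˣ) : FractionalIdeal (𝓞 K)⁰ K)) :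
    ((FractionalIdeal.absNorm (𝔟 : FractionalIdeal (𝓞 K)⁰ K) : ℚ) : K) * τ x ∈
      (𝔟 : FractionalIdeal (𝓞 K)⁰ K) := by
  rcases eq_or_ne x 0 with rfl | hx0
  · rw [map_zero, mul_zero]
    exact Submodule.zero_mem ((𝔟 : FractionalIdeal (𝓞 K)⁰ K) : Submodule (𝓞 K) K)
  have hle : FractionalIdeal.spanSingleton (𝓞 K)⁰ x * (𝔟 : FractionalIdeal (𝓞 K)⁰ K) ≤ 1 := by
    rw [FractionalIdeal.mul_le]
    intro i hi j hj
    obtain ⟨r, rfl⟩ := FractionalIdeal.mem_spanSingleton (𝓞 K)⁰ |>.mp hi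
    rw [Algebra.smul_def, mul_assoc, mul_comm x]
    exact one_mul_mem (mem_one_iff.mpr r.isIntegral_coe) (mul_inv_mem hj hx)
  obtain ⟨J, hJ⟩ := FractionalIdeal.le_one_iff_exists_coeIdeal.mp hle
  have h1 : (Ideal.absNorm J : ℚ) =
      |Algebra.norm ℚ x| * FractionalIdeal.absNorm (𝔟 : FractionalIdeal (𝓞 K)⁰ K) := by
    rw [← FractionalIdeal.coeIdeal_absNorm (K := K), hJ, map_mul,
      FractionalIdeal.absNorm_span_singleton]
  have h2 : (Ideal.absNorm J : K) ∈
      FractionalIdeal.spanSingleton (𝓞 K)⁰ x * (𝔟 : FractionalIdeal (𝓞 K)⁰ K) := by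
    rw [← hJ, FractionalIdeal.mem_coeIdeal]
    exact ⟨_, Ideal.absNorm_mem J, by simp⟩
  obtain ⟨y, hy, hxy⟩ := FractionalIdeal.mem_singleton_mul.mp h2
  have h3 : (Ideal.absNorm J : K) = ((Ideal.absNorm J : ℚ) : K) := by simp
  rw [h3, h1, Rat.cast_mul] at hxy
  rcases abs_choice (Algebra.norm ℚ x) with h | h
  · rw [h, norm_eq_mul_conj hK ι τ hτ, mul_assoc, mul_right_inj' hx0] at hxy
    rw [mul_comm, hxy]
    exact hy
  · rw [h, Rat.cast_neg, norm_eq_mul_conj hK ι τ hτ, ← mul_neg, mul_assoc, mul_right_inj' hx0] at hxy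
    have : ((FractionalIdeal.absNorm (𝔟 : FractionalIdeal (𝓞 K)⁰ K) : ℚ) : K) * τ x = -y := by
      rw [← hxy]
      ring
    rw [this]
    exact Submodule.neg_mem ((𝔟 : FractionalIdeal (𝓞 K)⁰ K) : Submodule (𝓞 K) K) hy

theorem absNorm_ne_zero (𝔟 : (FractionalIdeal (𝓞 K)⁰ K)ˣ) :
    ((FractionalIdeal.absNorm (𝔟 : FractionalIdeal (𝓞 K)⁰ K) : ℚ) : K) ≠ 0 := by
  rw [Rat.cast_ne_zero]
  exact mt FractionalIdeal.absNorm_eq_zero_iff.mp 𝔟.ne_zero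

include hK hτ ι in
theorem matAct_mem_quadSpace (M : SL(2, K)) {A : Matrix (Fin 2) (Fin 2) K} (hA : A ∈ quadSpace τ) :
    matAct τ M A ∈ quadSpace τ := by
  have hA' : A.transpose = A.map τ := hA
  have hmm : ∀ X Y : Matrix (Fin 2) (Fin 2) K, (X * Y).map τ = X.map τ * Y.map τ :=
    fun X Y => Matrix.map_mul
  have hcc : (M.1.map τ).map τ = M.1 := by
    ext i j
    simp [conj_conj hK ι τ hτ]
  change (matAct τ M A).transpose = (matAct τ M A).map τ
  rw [matAct, Matrix.transpose_mul, Matrix.transpose_mul, Matrix.transpose_transpose, hmm, hmm,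
    hA', Matrix.transpose_map, hcc, Matrix.mul_assoc]

theorem matAct_apply (M : SL(2, K)) (A : Matrix (Fin 2) (Fin 2) K) (i j : Fin 2) :
    matAct τ M A i j = M i 0 * A 0 0 * τ (M j 0) + M i 1 * A 1 0 * τ (M j 0) +
      (M i 0 * A 0 1 * τ (M j 1) + M i 1 * A 1 1 * τ (M j 1)) := by
  simp [matAct, Matrix.mul_apply, Fin.sum_univ_two]
  ring

theorem quadSpace_apply {A : Matrix (Fin 2) (Fin 2) K} (hA : A ∈ quadSpace τ) (i j : Fin 2) :
    A j i = τ (A i j) := congrFun (congrFun hA i) j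

include hK hτ ι in
-- The entries are expanded and each product is placed in its ideal. The diagonal entries are
-- moreover fixed by conjugation, hence rational, so integrality makes the first, and the second
-- divided by N(𝔞), an integer.
theorem matAct_mem_lattice {𝔞 : (FractionalIdeal (𝓞 K)⁰ K)ˣ} {M : SL(2, K)}
    (hM : M ∈ hilbertGroup 𝔞) {A : Matrix (Fin 2) (Fin 2) K} (hA : A ∈ lattice τ 𝔞) :
    matAct τ M A ∈ lattice τ 𝔞 := by
  obtain ⟨h00, h01, h10, h11⟩ := hM
  obtain ⟨hq, ⟨a, ha⟩, ⟨b, hb⟩, hl⟩ := hA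
  have hq' := matAct_mem_quadSpace hK ι τ hτ M hq
  have hl' : A 0 1 = τ (A 1 0) := quadSpace_apply τ hq 1 0
  set N : K := ((FractionalIdeal.absNorm (𝔞 : FractionalIdeal (𝓞 K)⁰ K) : ℚ) : K) with hN
  have hN0 : N ≠ 0 := absNorm_ne_zero 𝔞
  -- This is `absNorm_mul_conj_mem` for 𝔞⁻¹, whose norm is N⁻¹.
  have hinv : ∀ x ∈ (𝔞 : FractionalIdeal (𝓞 K)⁰ K), N⁻¹ * τ x ∈
      ((𝔞⁻¹ : (FractionalIdeal (𝓞 K)⁰ K)ˣ) : FractionalIdeal (𝓞 K)⁰ K) := by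
    intro x hx
    have := absNorm_mul_conj_mem hK ι τ hτ 𝔞⁻¹ (x := x) (by rwa [inv_inv])
    rw [Units.val_inv_eq_inv_val, map_inv₀, Rat.cast_inv] at this
    rwa [Units.val_inv_eq_inv_val]
  have hτN : τ N = N := by rw [hN, map_ratCast]
  have h01' := absNorm_mul_conj_mem hK ι τ hτ 𝔞 h01
  have hlb : A 1 0 * M 0 1 ∈ (1 : FractionalIdeal (𝓞 K)⁰ K) := mul_inv_mem hl h01
  refine ⟨hq', exists_int_of_conj_eq hK ι τ hτ (quadSpace_apply τ hq' 0 0).symm ?_, ?_, ?_⟩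
  · rw [matAct_apply, ha, hb, hl']
    refine add_mem_ideal (add_mem_ideal ?_ ?_) (add_mem_ideal ?_ ?_)
    · rw [mul_comm (M 0 0), mul_assoc]
      exact int_mul_mem a (one_mul_mem h00 (conj_mem_one τ h00))
    · rw [mul_comm (M 0 1)]
      exact one_mul_mem hlb (conj_mem_one τ h00)
    · rw [mul_assoc, ← map_mul]
      exact one_mul_mem h00 (conj_mem_one τ hlb)
    · have : M 0 1 * (N * b) * τ (M 0 1) = b * (N * τ (M 0 1) * M 0 1) := by ring
      rw [this]
      exact int_mul_mem b (mul_inv_mem h01' h01)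
  · obtain ⟨n, hn⟩ := exists_int_of_conj_eq hK ι τ hτ (x := N⁻¹ * matAct τ M A 1 1) (by
      rw [map_mul, map_inv₀, hτN, ← quadSpace_apply τ hq' 1 1]) (by
      rw [matAct_apply, ha, hb, hl']
      have h1 : N⁻¹ * (M 1 0 * a * τ (M 1 0) + M 1 1 * A 1 0 * τ (M 1 0) +
          (M 1 0 * τ (A 1 0) * τ (M 1 1) + M 1 1 * (N * b) * τ (M 1 1))) =
          a * (M 1 0 * (N⁻¹ * τ (M 1 0))) + M 1 1 * (A 1 0 * (N⁻¹ * τ (M 1 0))) +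
          ((M 1 0 * (N⁻¹ * τ (A 1 0))) * τ (M 1 1) + b * (M 1 1 * τ (M 1 1))) := by
        field_simp
      rw [h1]
      refine add_mem_ideal (add_mem_ideal ?_ ?_) (add_mem_ideal ?_ ?_)
      · exact int_mul_mem a (mul_inv_mem h10 (hinv _ h10))
      · exact one_mul_mem h11 (mul_inv_mem hl (hinv _ h10))
      · exact one_mul_mem (mul_inv_mem h10 (hinv _ hl)) (conj_mem_one τ h11)
      · exact int_mul_mem b (one_mul_mem h11 (conj_mem_one τ h11)))
    exact ⟨n, by rw [← hn, mul_inv_cancel_left₀ hN0]⟩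
  · rw [matAct_apply, ha, hb, hl']
    refine add_mem_ideal (add_mem_ideal ?_ ?_) (add_mem_ideal ?_ ?_)
    · rw [mul_comm (M 1 0), mul_assoc]
      exact int_mul_mem a (mul_one_mem h10 (conj_mem_one τ h00))
    · exact mul_one_mem (one_mul_mem h11 hl) (conj_mem_one τ h00)
    · rw [mul_assoc, ← map_mul]
      exact mul_one_mem h10 (conj_mem_one τ hlb)
    · have : M 1 1 * (N * b) * τ (M 0 1) = b * (M 1 1 * (N * τ (M 0 1))) := by ring
      rw [this]
      exact int_mul_mem b (one_mul_mem h11 h01')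

theorem matAct_add (M : SL(2, K)) (A B : Matrix (Fin 2) (Fin 2) K) :
    matAct τ M (A + B) = matAct τ M A + matAct τ M B := by
  simp [matAct, Matrix.mul_add, Matrix.add_mul]

theorem det_neg_fin_two (A : Matrix (Fin 2) (Fin 2) K) : (-A).det = A.det := by
  simp [Matrix.det_neg]

include hK hτ ι in
-- M preserves the determinant, so pairing A with M.B is pairing M⁻¹.A with B, and M⁻¹ preserves the
-- lattice.
theorem matAct_mem_vectors {𝔞 : (FractionalIdeal (𝓞 K)⁰ K)ˣ} {m : ℕ} {M : SL(2, K)}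
    (hM : M ∈ hilbertGroup 𝔞) {B : Matrix (Fin 2) (Fin 2) K} (hB : B ∈ vectors τ 𝔞 m) :
    matAct τ M B ∈ vectors τ 𝔞 m := by
  refine ⟨⟨matAct_mem_quadSpace hK ι τ hτ M hB.1.1, fun A hA => ?_⟩, by rw [det_matAct, hB.2]⟩
  obtain ⟨n, hn⟩ := hB.1.2 _ (matAct_mem_lattice hK ι τ hτ (inv_mem hM) hA)
  refine ⟨n, ?_⟩
  rw [← hn, det_matAct, det_matAct, ← det_matAct τ M (matAct τ M⁻¹ A + B), matAct_add,
    ← matAct_mul, mul_inv_cancel, matAct_one]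

theorem neg_mem_vectors {𝔞 : (FractionalIdeal (𝓞 K)⁰ K)ˣ} {m : ℕ}
    {B : Matrix (Fin 2) (Fin 2) K} (hB : B ∈ vectors τ 𝔞 m) : -B ∈ vectors τ 𝔞 m := by
  have hneg : ∀ X ∈ quadSpace τ, -X ∈ quadSpace τ := by
    intro X hX
    have hX : X.transpose = X.map τ := hX
    change (-X).transpose = (-X).map τ
    ext i j
    have := congrFun (congrFun hX i) j
    simpa using this
  refine ⟨⟨hneg B hB.1.1, fun A hA => ?_⟩, by rw [det_neg_fin_two, hB.2]⟩
  obtain ⟨hq, ⟨a, ha⟩, ⟨b, hb⟩, hl⟩ := hA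
  obtain ⟨n, hn⟩ := hB.1.2 (-A) ⟨hneg A hq, ⟨-a, by simp [ha]⟩, ⟨-b, by simp [hb]⟩,
    Submodule.neg_mem ((𝔞 : FractionalIdeal (𝓞 K)⁰ K) : Submodule (𝓞 K) K) hl⟩
  refine ⟨n, ?_⟩
  rw [← hn, det_neg_fin_two, det_neg_fin_two, ← det_neg_fin_two (-A + B)]
  congr 3
  abel

end LatticeInvariance

/-! ### Unfolding over the orbits of `Γ(𝔞)` on the vectors -/

section Unfolding

variable {K : Type*} [Field K] [NumberField K] (hK : Module.finrank ℚ K = 2) (ι : K →+* ℝ)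
  (τ : K ≃ₐ[ℚ] K) (hτ : τ ≠ 1) (𝔞 : (FractionalIdeal (𝓞 K)⁰ K)ˣ)

theorem measurable_gForm (A : Matrix (Fin 2) (Fin 2) K) : Measurable (gForm ι A) := by
  unfold gForm hForm
  have h1 : Measurable fun z : ℍ × ℍ => (z.1 : ℂ) := measurable_coe.comp measurable_fst
  have h2 : Measurable fun z : ℍ × ℍ => (z.2 : ℂ) := measurable_coe.comp measurable_snd
  have h3 : Measurable fun z : ℍ × ℍ => z.1.im :=
    UpperHalfPlane.continuous_im.measurable.comp measurable_fst
  have h4 : Measurable fun z : ℍ × ℍ => z.2.im :=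
    UpperHalfPlane.continuous_im.measurable.comp measurable_snd
  fun_prop

instance countable_matrix : Countable (Matrix (Fin 2) (Fin 2) K) := by
  have := countable_numberField (K := K)
  exact inferInstanceAs (Countable (Fin 2 → Fin 2 → K))

/-- The stabilizer `Γ(𝔞)_{±A}` as a group of transformations of `ℍ × ℍ`. -/
def stabHilbert (A : Matrix (Fin 2) (Fin 2) K) : Subgroup (transfGroup ι τ 𝔞) :=
  ((stabPM τ 𝔞 A).map (hilbertAct ι τ)).subgroupOf (transfGroup ι τ 𝔞)

theorem exists_stab_lift {A : Matrix (Fin 2) (Fin 2) K} (h : stabHilbert ι τ 𝔞 A) :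
    ∃ N ∈ stabPM τ 𝔞 A, hilbertAct ι τ N = h.1.1 := by
  obtain ⟨N, hN, h'⟩ := h.2
  exact ⟨N, hN, h'⟩

open scoped Pointwise in
-- The kernel ±1 is the same for the action on ℍ² and for the action on the second factor, so a
-- transformation in the stabilizer is determined by its second component and only that factor has
-- to be cut down.
theorem isFundamentalDomain_univ_prod {A : Matrix (Fin 2) (Fin 2) K} {S : Set ℍ}
    (hS : IsFundamentalDomain (stabTransfGroup ι τ 𝔞 A) S eta) :
    IsFundamentalDomain (stabHilbert ι τ 𝔞 A) (Set.univ ×ˢ S) omegaSq := by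
  have hqs : Measure.QuasiMeasurePreserving Prod.snd omegaSq eta := by
    refine (Measure.quasiMeasurePreserving_snd (μ := eta) (ν := eta)).mono_left ?_
    exact Measure.smul_absolutelyContinuous
  refine ⟨?_, ?_, ?_⟩
  · rw [Set.univ_prod]
    exact hS.nullMeasurableSet.preimage hqs
  · filter_upwards [hqs.ae hS.ae_covers] with z hz
    obtain ⟨⟨_, N, hN, rfl⟩, hg⟩ := hz
    exact ⟨⟨⟨hilbertAct ι τ N, N, hN.1, rfl⟩, N, hN, rfl⟩, trivial, hg⟩
  · intro a b hab
    obtain ⟨M, hM, ha⟩ := exists_stab_lift ι τ 𝔞 a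
    obtain ⟨N, hN, hb⟩ := exists_stab_lift ι τ 𝔞 b
    have hne : (⟨moebius (conjEmb ι τ) M, M, hM, rfl⟩ : stabTransfGroup ι τ 𝔞 A) ≠
        ⟨moebius (conjEmb ι τ) N, N, hN, rfl⟩ := by
      intro h
      have h := congrArg Subtype.val h
      simp only at h
      rw [← mul_inv_eq_one, ← map_inv, ← map_mul, moebius_eq_one_iff,
        ← hilbertAct_eq_one_iff ι τ, map_mul, map_inv, mul_inv_eq_one, ha, hb] at h
      exact hab (Subtype.ext (Subtype.ext h))
    have h2 := hqs.preimage_null (hS.aedisjoint hne)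
    refine measure_mono_null ?_ h2
    rintro _ ⟨⟨x, hx, rfl⟩, ⟨y, hy, hxy⟩⟩
    have hxy : b.1.1 y = a.1.1 x := hxy
    refine ⟨⟨x.2, hx.2, ?_⟩, ⟨y.2, hy.2, ?_⟩⟩
    · change moebius (conjEmb ι τ) M x.2 = (a.1.1 x).2
      rw [← ha]
      rfl
    · change moebius (conjEmb ι τ) N y.2 = (a.1.1 x).2
      rw [← hxy, ← hb]
      rfl

theorem lintegral_eta_cosh_dist (φ : ℝ → ℝ≥0∞) (hφ : Measurable φ) (w : ℍ) :
    ∫⁻ z, φ (Real.cosh (dist z w)) ∂eta = 2⁻¹ * ∫⁻ t in Set.Ioi (1 : ℝ), φ t := by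
  rw [eta, lintegral_smul_measure, lintegral_cosh_dist φ hφ, smul_eq_mul, ← mul_assoc,
    ← ENNReal.ofReal_mul (by positivity)]
  congr 1
  rw [show 1 / (4 * Real.pi) * (2 * Real.pi) = (2 : ℝ)⁻¹ by
    have := Real.pi_ne_zero
    field_simp
    norm_num, ENNReal.ofReal_inv_of_pos two_pos]
  norm_num

/-- For fixed z₂ the integrand is radial in z₁ around γ_A z₂, so the inner integral is ½∫φ for every
z₂; the ½ cancels the 2 in ω² = 2η₁η₂. -/
theorem setLIntegral_univ_prod {A : Matrix (Fin 2) (Fin 2) K} (hA : 0 < ι A.det) (S : Set ℍ)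
    (φ : ℝ → ℝ≥0∞) (hφ : Measurable φ) :
    ∫⁻ z in Set.univ ×ˢ S, φ (1 + 2 * gForm ι A z) ∂omegaSq =
      eta S * ∫⁻ t in Set.Ioi (1 : ℝ), φ t := by
  have hm : Measurable fun z => φ (1 + 2 * gForm ι A z) := by
    have := measurable_gForm ι A
    fun_prop
  rw [omegaSq, Measure.restrict_smul, lintegral_smul_measure, ← Measure.prod_restrict,
    lintegral_prod_symm _ hm.aemeasurable]
  simp only [one_add_two_mul_gForm ι A hA, Measure.restrict_univ, lintegral_eta_cosh_dist φ hφ]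
  rw [lintegral_const, Measure.restrict_apply_univ, smul_eq_mul, mul_right_comm, ← mul_assoc,
    ← mul_assoc, ENNReal.mul_inv_cancel two_ne_zero ENNReal.ofNat_ne_top, one_mul, mul_comm]
  

/-- A lift of a transformation to `Γ(𝔞)`. -/
def liftHilbert (g : transfGroup ι τ 𝔞) : SL(2, K) := g.2.choose

theorem liftHilbert_mem (g : transfGroup ι τ 𝔞) : liftHilbert ι τ 𝔞 g ∈ hilbertGroup 𝔞 :=
  g.2.choose_spec.1

theorem hilbertAct_liftHilbert (g : transfGroup ι τ 𝔞) :
    hilbertAct ι τ (liftHilbert ι τ 𝔞 g) = g.1 := g.2.choose_spec.2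

theorem matAct_neg_left (M : SL(2, K)) (A : Matrix (Fin 2) (Fin 2) K) :
    matAct τ (-M) A = matAct τ M A := by
  ext i j
  rw [matAct_apply, matAct_apply]
  simp

variable {m : ℕ}

include hK hτ in
/-- Unfolding over one orbit. -/
theorem tsum_fiber_setLIntegral (hm : 0 < m) {F : Set (ℍ × ℍ)}
    (hF : IsFundamentalDomain (transfGroup ι τ 𝔞) F omegaSq) (φ : ℝ → ℝ≥0∞) (hφ : Measurable φ)
    (q : Quotient (orbitSetoid τ 𝔞 m)) :
    ∑' A : {A : vectors τ 𝔞 m // Quotient.mk (orbitSetoid τ 𝔞 m) A = q},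
      ∫⁻ z in F, φ (1 + 2 * gForm ι A.1.1 z) ∂omegaSq =
    2 * covolume (stabTransfGroup ι τ 𝔞 q.out.1) ℍ eta * ∫⁻ t in Set.Ioi (1 : ℝ), φ t := by
  set A0 := q.out with hA0
  have hpos : 0 < ι A0.1.det := det_pos_of_mem_vectors hK ι τ hτ hm A0.2
  have hrel : ∀ A : {A : vectors τ 𝔞 m // Quotient.mk (orbitSetoid τ 𝔞 m) A = q},
      ∃ M ∈ hilbertGroup 𝔞, matAct τ M A.1.1 = A0.1 ∨ matAct τ M A.1.1 = -A0.1 := by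
    intro A
    exact Quotient.exact (s := orbitSetoid τ 𝔞 m) (A.2.trans (Quotient.out_eq q).symm)
  choose R hR1 hR2 using hrel
  let c : {A : vectors τ 𝔞 m // Quotient.mk (orbitSetoid τ 𝔞 m) A = q} → transfGroup ι τ 𝔞 :=
    fun A => ⟨hilbertAct ι τ (R A), R A, hR1 A, rfl⟩
  let L := liftHilbert ι τ 𝔞
  have hL : ∀ g, L g ∈ hilbertGroup 𝔞 := liftHilbert_mem ι τ 𝔞
  -- Both signs yield different vectors, which is what makes the map f below injective in its
  -- Boolean.
  have hne : ∀ A : vectors τ 𝔞 m, A.1 ≠ -A.1 := by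
    intro A h
    have h0 : A.1 = 0 := by
      ext i j
      have := congrFun (congrFun h i) j
      exact self_eq_neg.mp this
    have := det_pos_of_mem_vectors hK ι τ hτ hm A.2
    rw [h0] at this
    simp at this
  -- The pair (sign, g) is sent to the vector ±g⁻¹.A₀. The chosen lift of g matters only up to sign,
  -- and -1 acts trivially on vectors.
  let vec : Bool → transfGroup ι τ 𝔞 → Matrix (Fin 2) (Fin 2) K :=
    fun b g => bif b then matAct τ (L g)⁻¹ A0.1 else -matAct τ (L g)⁻¹ A0.1
  have hvec : ∀ b g, vec b g ∈ vectors τ 𝔞 m := by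
    intro b g
    have h := matAct_mem_vectors hK ι τ hτ (inv_mem (hL g)) A0.2
    cases b
    · exact neg_mem_vectors τ h
    · exact h
  have hvec2 : ∀ b g, matAct τ (L g) (vec b g) = A0.1 ∨ matAct τ (L g) (vec b g) = -A0.1 := by
    intro b g
    cases b
    · right
      simp only [vec, cond_false]
      rw [matAct_neg, ← matAct_mul, mul_inv_cancel, matAct_one]
    · left
      simp only [vec, cond_true]
      rw [← matAct_mul, mul_inv_cancel, matAct_one]
  let B : Bool → transfGroup ι τ 𝔞 → {A : vectors τ 𝔞 m // Quotient.mk (orbitSetoid τ 𝔞 m) A = q} :=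
    fun b g => ⟨⟨vec b g, hvec b g⟩, by
      rw [← Quotient.out_eq q]
      exact Quotient.sound (s := orbitSetoid τ 𝔞 m) ⟨L g, hL g, hvec2 b g⟩⟩
  have hstab : ∀ b g, g * (c (B b g))⁻¹ ∈ stabHilbert ι τ 𝔞 A0.1 := by
    intro b g
    refine ⟨L g * (R (B b g))⁻¹, ⟨mul_mem (hL g) (inv_mem (hR1 _)), ?_⟩, ?_⟩
    · have h1 : matAct τ (R (B b g))⁻¹ A0.1 = vec b g ∨ matAct τ (R (B b g))⁻¹ A0.1 = -vec b g := by
        rcases hR2 (B b g) with h | h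
        · exact Or.inl (matAct_inv_eq h)
        · refine Or.inr ?_
          have h3 := matAct_inv_eq h
          rw [matAct_neg] at h3
          rw [← neg_eq_iff_eq_neg]
          exact h3
      rw [matAct_mul]
      rcases h1 with h1 | h1 <;> rcases hvec2 b g with h2 | h2 <;>
        simp only [h1, h2, matAct_neg, neg_neg, true_or, or_true]
    · change hilbertAct ι τ (L g * (R (B b g))⁻¹) = g.1 * (hilbertAct ι τ (R (B b g)))⁻¹
      rw [map_mul, map_inv, hilbertAct_liftHilbert]
  -- Each vector X of the orbit has a fixed transformation c X carrying it to ±A₀. If X = ±g⁻¹.A₀,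
  -- then g = h · c X with h in the stabilizer of ±A₀; conversely X and h determine g, and then the
  -- sign. This is the reindexing that produces the factor 2.
  let f : Bool × transfGroup ι τ 𝔞 →
      {A : vectors τ 𝔞 m // Quotient.mk (orbitSetoid τ 𝔞 m) A = q} × stabHilbert ι τ 𝔞 A0.1 :=
    fun p => (B p.1 p.2, ⟨p.2 * (c (B p.1 p.2))⁻¹, hstab p.1 p.2⟩)
  have hf : Function.Bijective f := by
    constructor
    · rintro ⟨b, g⟩ ⟨b', g'⟩ h
      have h1 : B b g = B b' g' := congrArg Prod.fst h
      have h2 : g * (c (B b g))⁻¹ = g' * (c (B b' g'))⁻¹ :=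
        congrArg Subtype.val (congrArg Prod.snd h)
      rw [h1, mul_left_inj] at h2
      subst h2
      have h3 : vec b g = vec b' g := congrArg (fun x => x.1.1) h1
      have h4 := hne ⟨_, matAct_mem_vectors hK ι τ hτ (inv_mem (hL g)) A0.2⟩
      cases b <;> cases b'
      · rfl
      · exact absurd h3.symm h4
      · exact absurd h3 h4
      · rfl
    · rintro ⟨X, h⟩
      obtain ⟨N, hN, hNh⟩ := exists_stab_lift ι τ 𝔞 h
      let g : transfGroup ι τ 𝔞 := h.1 * c X
      have hlift : L g = N * R X ∨ L g = -(N * R X) := by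
        rw [← hilbertAct_eq_iff ι τ, hilbertAct_liftHilbert, map_mul, hNh]
        rfl
      have hact : ∀ Y, matAct τ (L g) Y = matAct τ (N * R X) Y := by
        intro Y
        rcases hlift with hl | hl <;> rw [hl]
        exact matAct_neg_left τ _ _
      have hX : matAct τ (L g) X.1.1 = A0.1 ∨ matAct τ (L g) X.1.1 = -A0.1 := by
        rw [hact, matAct_mul]
        rcases hR2 X with h1 | h1 <;> rcases hN.2 with h2 | h2 <;>
          simp only [h1, h2, matAct_neg, neg_neg, true_or, or_true]
      obtain ⟨b, hb⟩ : ∃ b, vec b g = X.1.1 := by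
        rcases hX with h1 | h1
        · exact ⟨true, matAct_inv_eq h1⟩
        · refine ⟨false, ?_⟩
          have h3 := matAct_inv_eq h1
          rw [matAct_neg] at h3
          exact h3
      have hBX : B b g = X := Subtype.ext (Subtype.ext hb)
      refine ⟨(b, g), Prod.ext hBX (Subtype.ext ?_)⟩
      change g * (c (B b g))⁻¹ = h.1
      rw [hBX]
      exact mul_inv_cancel_right _ _
  have hfd := hasFundamentalDomain_stabTransfGroup hK ι τ hτ 𝔞 A0.1 hpos
  obtain ⟨S, hS⟩ := hfd.ExistsIsFundamentalDomain
  rw [hS.covolume_eq_volume]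
  have hterm : ∀ A : {A : vectors τ 𝔞 m // Quotient.mk (orbitSetoid τ 𝔞 m) A = q}, ∀ z : ℍ × ℍ,
      φ (1 + 2 * gForm ι A.1.1 z) = φ (1 + 2 * gForm ι A0.1 (c A • z)) := by
    intro A z
    rw [← gForm_matAct ι τ (R A) A.1.1 (det_pos_of_mem_vectors hK ι τ hτ hm A.1.2) z]
    rcases hR2 A with h | h
    · rw [h]
      rfl
    · rw [h, gForm_neg]
      rfl
  simp only [hterm]
  rw [tsum_setLIntegral_smul_eq (stabHilbert ι τ 𝔞 A0.1) hF (isFundamentalDomain_univ_prod ι τ 𝔞 hS)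
    (fun z => φ (1 + 2 * gForm ι A0.1 z)) ?_ c (Equiv.ofBijective f hf) ?_,
    setLIntegral_univ_prod ι hpos S φ hφ, mul_assoc]
  · intro h z
    obtain ⟨N, hN, hNh⟩ := exists_stab_lift ι τ 𝔞 h
    have h1 : h • z = hilbertAct ι τ N z := by
      rw [hNh]
      rfl
    have h2 : gForm ι A0.1 (h • z) = gForm ι A0.1 z := by
      rw [h1, ← gForm_matAct ι τ N A0.1 hpos z]
      rcases hN.2 with h | h
      · rw [h]
      · rw [h, gForm_neg]
    simp only [h2]
  · rintro ⟨b, g⟩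
    exact inv_mul_cancel_right _ _

include hK hτ in
/-- The unfolding identity for the sum of `φ (1 + 2 g(A, z))` over the vectors `A`. -/
theorem setLIntegral_tsum_vectors (hm : 0 < m) {F : Set (ℍ × ℍ)}
    (hF : IsFundamentalDomain (transfGroup ι τ 𝔞) F omegaSq) (φ : ℝ → ℝ≥0∞) (hφ : Measurable φ) :
    ∫⁻ z in F, ∑' A : vectors τ 𝔞 m, φ (1 + 2 * gForm ι A.1 z) ∂omegaSq =
      2 * volT ι τ 𝔞 m * ∫⁻ t in Set.Ioi (1 : ℝ), φ t := by
  have hm' : ∀ A : vectors τ 𝔞 m, AEMeasurable (fun z => φ (1 + 2 * gForm ι A.1 z))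
      (omegaSq.restrict F) := by
    intro A
    have := measurable_gForm ι A.1
    fun_prop
  rw [lintegral_tsum hm', ← (Equiv.sigmaFiberEquiv (Quotient.mk (orbitSetoid τ 𝔞 m))).tsum_eq,
    ENNReal.tsum_sigma']
  simp only [Equiv.sigmaFiberEquiv_apply]
  rw [tsum_congr fun q => tsum_fiber_setLIntegral hK ι τ hτ 𝔞 hm hF φ hφ q, ENNReal.tsum_mul_right,
    ENNReal.tsum_mul_left]
  rfl

end Unfolding

/-! ### Cuspidal boxes -/

/-- A vertical strip `|x| ≤ R`, `y ≥ e`. -/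
def strip (R e : ℝ) : Set ℍ := {z | |z.re| ≤ R ∧ e ≤ z.im}

theorem measurableSet_strip (R e : ℝ) : MeasurableSet (strip R e) :=
  (measurableSet_le UpperHalfPlane.continuous_re.abs.measurable measurable_const).inter
    (measurableSet_le measurable_const UpperHalfPlane.continuous_im.measurable)

/-- The hyperbolic area of the strip is 2R ∫_e^∞ dy/y² = 2R/e, and 1/(4π) ≤ 1. -/
theorem eta_strip_le {R e : ℝ} (hR : 0 ≤ R) (he : 0 < e) :
    eta (strip R e) ≤ ENNReal.ofReal (2 * R / e) := by
  have h1 : volume (strip R e) ≤ ENNReal.ofReal (2 * R / e) := by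
    have hs : MeasurableSet {w : ℂ | |w.re| ≤ R ∧ e ≤ w.im} :=
      (measurableSet_le Complex.continuous_re.abs.measurable measurable_const).inter
        (measurableSet_le measurable_const Complex.continuous_im.measurable)
    have h2 : volume (strip R e) =
        ∫⁻ z : ℍ, ({w : ℂ | |w.re| ≤ R ∧ e ≤ w.im}.indicator (fun _ => (1 : ℝ≥0∞))) z := by
      rw [← lintegral_indicator_one (measurableSet_strip R e)]
      rfl
    rw [h2, lintegral_upperHalfPlane _ (measurable_const.indicator hs)]
    have h3 : ∀ y : ℝ, ∫⁻ x : ℝ, ({w : ℂ | |w.re| ≤ R ∧ e ≤ w.im}.indicator (fun _ => (1 : ℝ≥0∞)))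
        ⟨x, y⟩ * ENNReal.ofReal (1 / y ^ 2) ≤ (Set.Ici e).indicator
          (fun y => ENNReal.ofReal (2 * R) * ENNReal.ofReal (y ^ (-2 : ℝ))) y := by
      intro y
      by_cases hy : e ≤ y
      · have hy0 : 0 < y := he.trans_le hy
        rw [Set.indicator_of_mem (by exact hy), lintegral_mul_const' _ _ ENNReal.ofReal_ne_top]
        refine mul_le_mul' ?_ (le_of_eq ?_)
        · refine (lintegral_mono (g := (Set.Icc (-R) R).indicator 1) ?_).trans ?_
          · intro x
            by_cases hx : |x| ≤ R
            · have : x ∈ Set.Icc (-R) R := abs_le.mp hx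
              simp [Set.indicator_of_mem this, hx, hy]
            · simp [hx]
          · rw [lintegral_indicator_one measurableSet_Icc, Real.volume_Icc]
            exact ENNReal.ofReal_le_ofReal (by linarith)
        · rw [Real.rpow_neg hy0.le, one_div]
          norm_cast
      · simp [hy]
    refine (lintegral_mono h3).trans ((lintegral_mono' Measure.restrict_le_self le_rfl).trans ?_)
    rw [lintegral_indicator measurableSet_Ici, lintegral_const_mul' _ _ ENNReal.ofReal_ne_top,
      setLIntegral_congr Ioi_ae_eq_Ici.symm, ← ofReal_integral_eq_lintegral_ofReal
      (integrableOn_Ioi_rpow_of_lt (by norm_num) he), integral_Ioi_rpow_of_lt (by norm_num) he,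
      ← ENNReal.ofReal_mul (by positivity)]
    · refine ENNReal.ofReal_le_ofReal (le_of_eq ?_)
      norm_num [Real.rpow_neg_one]
      rfl
    · refine (ae_restrict_iff' measurableSet_Ioi).mpr (Filter.Eventually.of_forall fun y hy => ?_)
      exact Real.rpow_nonneg (he.le.trans (le_of_lt hy)) _
  rw [eta, Measure.smul_apply, smul_eq_mul]
  refine (mul_le_mul' (ENNReal.ofReal_le_one.mpr ?_) h1).trans (one_mul _).le
  rw [div_le_one (by positivity)]
  linarith [Real.pi_gt_three]

/-- A fundamental box for a cusp at infinity. -/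
def cuspBox (c R r : ℝ) : Set (ℍ × ℍ) :=
  {z | |z.1.re| ≤ R ∧ |z.2.re| ≤ R ∧ c ≤ z.1.im * z.2.im ∧ z.1.im ≤ r * z.2.im ∧
    z.2.im ≤ r * z.1.im}

theorem sqrt_le_im_of_mem_cuspBox {c R r : ℝ} (hr : 0 < r) {z : ℍ × ℍ}
    (hz : z ∈ cuspBox c R r) : √(c / r) ≤ z.1.im := by
  obtain ⟨-, -, h3, -, h5⟩ := hz
  have h1 := z.1.im_pos
  rw [Real.sqrt_le_iff]
  refine ⟨h1.le, ?_⟩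
  rw [div_le_iff₀ hr]
  nlinarith

/-- For fixed z₁ the point z₂ lies in a strip y₂ ≥ y₁/r of measure at most 2Rr/y₁, which cancels the
weight y₁. A constant remains, over the strip y₁ ≥ √(c/r) of finite measure. -/
theorem setLIntegral_cuspBox_lt_top {c R r : ℝ} (hc : 0 < c) (hR : 0 ≤ R) (hr : 0 < r) {C : ℝ}
    (hC : 0 ≤ C) : ∫⁻ z in cuspBox c R r, ENNReal.ofReal (C * z.1.im) ∂omegaSq < ⊤ := by
  set e := √(c / r) with he
  have he0 : 0 < e := Real.sqrt_pos.mpr (by positivity)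
  have him : Measurable fun z : ℍ => z.im := UpperHalfPlane.continuous_im.measurable
  have hre : Measurable fun z : ℍ => z.re := UpperHalfPlane.continuous_re.measurable
  let W : Set (ℍ × ℍ) := {z | z.1 ∈ strip R e ∧ z.2 ∈ strip R (z.1.im / r)}
  have hW : MeasurableSet W := by
    refine (measurable_fst (measurableSet_strip R e)).inter
      ((measurable_snd (measurableSet_le hre.abs measurable_const)).inter
      (measurableSet_le (f := fun z : ℍ × ℍ => z.1.im / r) (g := fun z : ℍ × ℍ => z.2.im)
        (by fun_prop) (by fun_prop)))
  have hsub : cuspBox c R r ⊆ W := by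
    intro z hz
    refine ⟨⟨hz.1, sqrt_le_im_of_mem_cuspBox hr hz⟩, hz.2.1, ?_⟩
    rw [div_le_iff₀ hr, mul_comm]
    exact hz.2.2.2.1
  refine (lintegral_mono_set hsub).trans_lt ?_
  rw [omegaSq, Measure.restrict_smul, lintegral_smul_measure, ← lintegral_indicator hW,
    lintegral_prod _ ((by fun_prop : Measurable fun z : ℍ × ℍ =>
      ENNReal.ofReal (C * z.1.im)).indicator hW).aemeasurable]
  refine ENNReal.mul_lt_top ENNReal.ofNat_lt_top ?_
  have hle : ∀ x : ℍ, ∫⁻ y, W.indicator (fun z => ENNReal.ofReal (C * z.1.im)) (x, y) ∂eta ≤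
      (strip R e).indicator (fun _ => ENNReal.ofReal (C * (2 * R * r))) x := by
    intro x
    by_cases hx : x ∈ strip R e
    · rw [Set.indicator_of_mem hx]
      have h1 : ∀ y, W.indicator (fun z => ENNReal.ofReal (C * z.1.im)) (x, y) =
          (strip R (x.im / r)).indicator (fun _ => ENNReal.ofReal (C * x.im)) y := by
        intro y
        by_cases hy : y ∈ strip R (x.im / r)
        · rw [Set.indicator_of_mem hy, Set.indicator_of_mem (show (x, y) ∈ W from ⟨hx, hy⟩)]
        · rw [Set.indicator_of_notMem hy, Set.indicator_of_notMem fun h => hy h.2]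
      have hxi := x.im_pos
      rw [lintegral_congr h1, lintegral_indicator_const (measurableSet_strip _ _)]
      refine (mul_le_mul' le_rfl (eta_strip_le hR (div_pos hxi hr))).trans ?_
      rw [← ENNReal.ofReal_mul (by positivity)]
      refine ENNReal.ofReal_le_ofReal (le_of_eq ?_)
      field_simp
    · rw [Set.indicator_of_notMem hx]
      refine (le_of_eq ?_)
      rw [← lintegral_zero (μ := eta)]
      refine lintegral_congr fun y => ?_
      rw [Set.indicator_of_notMem fun h => hx h.1]
  refine (lintegral_mono hle).trans_lt ?_
  rw [lintegral_indicator_const (measurableSet_strip _ _)]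
  exact ENNReal.mul_lt_top ENNReal.ofReal_lt_top
    ((eta_strip_le hR he0).trans_lt ENNReal.ofReal_lt_top)

/-! ### Bounds for the vectors in a box -/

theorem abs_le_of_add_sub_bounds {s t p q X : ℝ} (hp : |p| ≤ X) (hq : |q| ≤ X) (h : 2 * t = p + s * q)
    (hs : |s| = 1) : |t| ≤ X := by
  have h1 : |2 * t| ≤ X + X := by
    rw [h]
    refine (abs_add_le _ _).trans (add_le_add hp ?_)
    rwa [abs_mul, hs, one_mul]
  rw [abs_mul, abs_two] at h1
  linarith

/-- Bounds for `a, b, l, l'` in terms of the real and imaginary parts of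
`b z₁ z₂ - l z₁ - l' z₂ + a`. -/
theorem entry_bounds_aux {r D M x1 x2 y1 y2 a b l l' p q : ℝ} (hD : 0 < D) (hM0 : 0 < M)
    (hM2 : M ^ 2 = 8 * D * r) (hdet : a * b - l * l' = D) (hy1 : 0 < y1) (hy2 : 0 < y2)
    (hy12 : y1 ≤ r * y2) (hy21 : y2 ≤ r * y1)
    (hp : p = b * (x1 * x2 - y1 * y2) - l * x1 - l' * x2 + a)
    (hq : q = y2 * (b * x1 - l') + y1 * (b * x2 - l))
    (hP : p ^ 2 + q ^ 2 ≤ 4 * y1 * y2 * D) :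
    |b * x2 - l| ≤ M ∧ |b * x1 - l'| ≤ M ∧ |b| * y1 ≤ M ∧ |b * (y1 * y2)| ≤ M * y1 ∧
      |p| ≤ M * y1 := by
  -- p' and q' are the real and imaginary parts of the same form with z₂ replaced by its complex
  -- conjugate; its squared absolute value exceeds p² + q² by 4y₁y₂ det A. Sums and differences of
  -- the two values isolate b, bx₂ - l and bx₁ - l'.
  obtain ⟨p', hp'⟩ : ∃ p', p' = p + 2 * b * (y1 * y2) := ⟨_, rfl⟩
  obtain ⟨q', hq'⟩ : ∃ q', q' = y1 * (b * x2 - l) - y2 * (b * x1 - l') := ⟨_, rfl⟩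
  have hQ : p' ^ 2 + q' ^ 2 ≤ 8 * D * (y1 * y2) := by
    have : p' ^ 2 + q' ^ 2 = p ^ 2 + q ^ 2 + 4 * y1 * y2 * D := by
      rw [← hdet, hp', hq', hp, hq]
      ring
    rw [this]
    linarith
  have hyy : 0 < y1 * y2 := mul_pos hy1 hy2
  -- As y₁ and y₂ are comparable with ratio r, both values of the form are bounded by M y₁ and also
  -- by M y₂.
  have hS1 : 8 * D * (y1 * y2) ≤ (M * y1) ^ 2 := by
    rw [mul_pow, hM2]
    have : (8 * D * y1) * y2 ≤ (8 * D * y1) * (r * y1) := mul_le_mul_of_nonneg_left hy21 (by positivity)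
    linarith
  have hS2 : 8 * D * (y1 * y2) ≤ (M * y2) ^ 2 := by
    rw [mul_pow, hM2]
    have : (8 * D * y2) * y1 ≤ (8 * D * y2) * (r * y2) := mul_le_mul_of_nonneg_left hy12 (by positivity)
    linarith
  have hP2 : p ^ 2 + q ^ 2 ≤ 8 * D * (y1 * y2) := by
    have : 0 < D * (y1 * y2) := mul_pos hD hyy
    linarith
  have hbd : ∀ s t Y : ℝ, 0 < Y → s ^ 2 + t ^ 2 ≤ (M * Y) ^ 2 → |s| ≤ M * Y ∧ |t| ≤ M * Y := by
    intro s t Y hY h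
    have h1 := sq_nonneg s
    have h2 := sq_nonneg t
    exact ⟨abs_le_of_sq_le_sq (by linarith) (mul_pos hM0 hY).le,
      abs_le_of_sq_le_sq (by linarith) (mul_pos hM0 hY).le⟩
  obtain ⟨hp1, hq1⟩ := hbd _ _ y1 hy1 (hP2.trans hS1)
  obtain ⟨hp2, hq2⟩ := hbd _ _ y2 hy2 (hP2.trans hS2)
  obtain ⟨hp1', hq1'⟩ := hbd _ _ y1 hy1 (hQ.trans hS1)
  obtain ⟨hp2', hq2'⟩ := hbd _ _ y2 hy2 (hQ.trans hS2)
  have hone : |(1 : ℝ)| = 1 := abs_one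
  have hmone : |(-1 : ℝ)| = 1 := by rw [abs_neg, abs_one]
  refine ⟨?_, ?_, ?_, ?_, hp1⟩
  · have h1 : |y1 * (b * x2 - l)| ≤ M * y1 :=
      abs_le_of_add_sub_bounds hq1 hq1' (by rw [hq, hq']; ring) hone
    rw [abs_mul, abs_of_pos hy1, mul_comm] at h1
    exact le_of_mul_le_mul_right h1 hy1
  · have h1 : |y2 * (b * x1 - l')| ≤ M * y2 :=
      abs_le_of_add_sub_bounds hq2 hq2' (by rw [hq, hq']; ring) hmone
    rw [abs_mul, abs_of_pos hy2, mul_comm] at h1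
    exact le_of_mul_le_mul_right h1 hy2
  · have h1 : |b * (y1 * y2)| ≤ M * y2 :=
      abs_le_of_add_sub_bounds hp2' hp2 (by rw [hp']; ring) hmone
    rw [abs_mul, abs_of_pos hyy, ← mul_assoc] at h1
    exact le_of_mul_le_mul_right h1 hy2
  · exact abs_le_of_add_sub_bounds hp1' hp1 (by rw [hp']; ring) hmone

/-- In a box the height is bounded below by √(c/r), so `entry_bounds_aux` bounds b, l and l'
uniformly. Only a can grow, linearly in y₁; this is the source of the O(y₁) count. -/
theorem entry_bounds {c R r D : ℝ} (hc : 0 < c) (hR : 0 ≤ R) (hr : 0 < r) (hD : 0 < D) :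
    ∃ C : ℝ, 0 < C ∧ ∀ (a b l l' : ℝ) (z : ℍ × ℍ), z ∈ cuspBox c R r → a * b - l * l' = D →
      ‖(b : ℂ) * z.1 * z.2 - (l : ℂ) * z.1 - (l' : ℂ) * z.2 + (a : ℂ)‖ ^ 2 ≤
        4 * z.1.im * z.2.im * D →
      |b| ≤ C ∧ |l| ≤ C ∧ |l'| ≤ C ∧ |a| ≤ C * z.1.im := by
  obtain ⟨e, he⟩ : ∃ e, e = √(c / r) := ⟨_, rfl⟩
  have he0 : 0 < e := he ▸ Real.sqrt_pos.mpr (by positivity)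
  obtain ⟨M, hM⟩ : ∃ M, M = √(8 * D * r) := ⟨_, rfl⟩
  have hM0 : 0 < M := hM ▸ Real.sqrt_pos.mpr (by positivity)
  have hM2 : M ^ 2 = 8 * D * r := hM ▸ Real.sq_sqrt (by positivity)
  obtain ⟨C0, hC0⟩ : ∃ C0, C0 = M / e * R + M := ⟨_, rfl⟩
  have hC00 : 0 < C0 := by
    rw [hC0]
    positivity
  refine ⟨M / e + C0 + (2 * M + (M / e * R ^ 2 + 2 * R * C0) / e), by positivity, ?_⟩
  intro a b l l' z hz hdet hP
  have hey : e ≤ z.1.im := he ▸ sqrt_le_im_of_mem_cuspBox hr hz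
  obtain ⟨hx1, hx2, -, hy12, hy21⟩ := hz
  have hy1 := z.1.im_pos
  rw [← Complex.normSq_eq_norm_sq, Complex.normSq_apply] at hP
  simp only [Complex.add_re, Complex.sub_re, Complex.mul_re, Complex.ofReal_re, Complex.ofReal_im,
    Complex.add_im, Complex.sub_im, Complex.mul_im, coe_re, coe_im, zero_mul, sub_zero,
    add_zero] at hP
  obtain ⟨hv, hu, hby, hbyy, hp⟩ := entry_bounds_aux hD hM0 hM2 hdet hy1 z.2.im_pos hy12 hy21
    (x1 := z.1.re) (x2 := z.2.re) rfl rfl (by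
      refine le_of_eq_of_le ?_ hP
      ring)
  have hb : |b| ≤ M / e := by
    rw [le_div_iff₀ he0]
    exact (mul_le_mul_of_nonneg_left hey (abs_nonneg _)).trans hby
  have hl : |l| ≤ C0 := by
    have : l = b * z.2.re - (b * z.2.re - l) := by ring
    rw [this, hC0]
    refine (abs_sub _ _).trans (add_le_add ?_ hv)
    rw [abs_mul]
    exact mul_le_mul hb hx2 (abs_nonneg _) (by positivity)
  have hl' : |l'| ≤ C0 := by
    have : l' = b * z.1.re - (b * z.1.re - l') := by ring
    rw [this, hC0]
    refine (abs_sub _ _).trans (add_le_add ?_ hu)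
    rw [abs_mul]
    exact mul_le_mul hb hx1 (abs_nonneg _) (by positivity)
  have hrest : 0 ≤ 2 * M + (M / e * R ^ 2 + 2 * R * C0) / e := by positivity
  have hMe : 0 < M / e := by positivity
  refine ⟨by linarith, by linarith, by linarith, ?_⟩
  have h1 : |b * (z.1.re * z.2.re)| ≤ M / e * R ^ 2 := by
    rw [abs_mul, abs_mul, sq]
    exact mul_le_mul hb (mul_le_mul hx1 hx2 (abs_nonneg _) hR) (by positivity) hMe.le
  have h2 : |l * z.1.re| ≤ C0 * R := by
    rw [abs_mul]
    exact mul_le_mul hl hx1 (abs_nonneg _) hC00.le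
  have h3 : |l' * z.2.re| ≤ C0 * R := by
    rw [abs_mul]
    exact mul_le_mul hl' hx2 (abs_nonneg _) hC00.le
  obtain ⟨p, hpe⟩ : ∃ p, p = b * (z.1.re * z.2.re - z.1.im * z.2.im) - l * z.1.re - l' * z.2.re + a :=
    ⟨_, rfl⟩
  rw [← hpe] at hp
  have ha : a = p - b * (z.1.re * z.2.re) + b * (z.1.im * z.2.im) + l * z.1.re + l' * z.2.re := by
    rw [hpe]
    ring
  have h4 : |a| ≤ 2 * M * z.1.im + (M / e * R ^ 2 + 2 * R * C0) := by
    rw [ha]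
    refine (abs_add_le _ _).trans ?_
    have i1 := (abs_add_le (p - b * (z.1.re * z.2.re) + b * (z.1.im * z.2.im)) (l * z.1.re))
    have i2 := (abs_add_le (p - b * (z.1.re * z.2.re)) (b * (z.1.im * z.2.im)))
    have i3 := (abs_sub p (b * (z.1.re * z.2.re)))
    linarith
  have h5 : M / e * R ^ 2 + 2 * R * C0 ≤ (M / e * R ^ 2 + 2 * R * C0) / e * z.1.im := by
    obtain ⟨X, hX⟩ : ∃ X, X = M / e * R ^ 2 + 2 * R * C0 := ⟨_, rfl⟩
    have hX0 : 0 ≤ X := by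
      rw [hX]
      positivity
    rw [← hX, div_mul_eq_mul_div, le_div_iff₀ he0]
    exact mul_le_mul_of_nonneg_left hey hX0
  have h6 : 0 ≤ (M / e + C0) * z.1.im := by positivity
  rw [add_mul, add_mul (2 * M)]
  linarith

/-! ### Counting vectors in a cuspidal box -/

section Counting

variable {K : Type*} [Field K] [NumberField K] (hK : Module.finrank ℚ K = 2) (ι : K →+* ℝ)
  (τ : K ≃ₐ[ℚ] K) (hτ : τ ≠ 1) (𝔞 : (FractionalIdeal (𝓞 K)⁰ K)ˣ)

theorem exists_int_mul_isIntegral (x : K) : ∃ n : ℤ, n ≠ 0 ∧ IsIntegral ℤ ((n : K) * x) := by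
  have h : IsAlgebraic ℤ x := (IsFractionRing.isAlgebraic_iff ℤ ℚ K).mpr (Algebra.IsAlgebraic.isAlgebraic x)
  obtain ⟨n, hn, h⟩ := h.exists_integral_multiple
  exact ⟨n, hn, by rwa [zsmul_eq_mul] at h⟩

theorem exists_int_mul_isIntegral_finset (s : Finset K) :
    ∃ n : ℤ, n ≠ 0 ∧ ∀ x ∈ s, IsIntegral ℤ ((n : K) * x) := by
  classical
  choose f hf0 hf using exists_int_mul_isIntegral (K := K)
  refine ⟨∏ x ∈ s, f x, Finset.prod_ne_zero_iff.mpr fun x _ => hf0 x, fun x hx => ?_⟩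
  rw [← Finset.prod_erase_mul _ _ hx, Int.cast_mul, mul_assoc]
  exact (isIntegral_intCast _).mul (hf x)

theorem isIntegral_conj {x : K} (hx : IsIntegral ℤ x) : IsIntegral ℤ (τ x) :=
  mem_one_iff.mp (conj_mem_one τ (mem_one_iff.mpr hx))

theorem exists_mem_ne_zero : ∃ a ∈ (𝔞 : FractionalIdeal (𝓞 K)⁰ K), a ≠ 0 := by
  by_contra! h
  exact 𝔞.ne_zero (FractionalIdeal.eq_zero_iff.mpr h)

include hτ in
theorem exists_integral_conj_ne : ∃ θ : K, IsIntegral ℤ θ ∧ τ θ ≠ θ := by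
  by_contra! h
  refine hτ (AlgEquiv.ext fun x => ?_)
  obtain ⟨n, hn, hx⟩ := exists_int_mul_isIntegral x
  have := h _ hx
  rw [map_mul, map_intCast] at this
  exact mul_left_cancel₀ (by exact_mod_cast hn) this

include hK hτ ι in
/-- The entries of the vectors of the dual lattice have a common denominator. -/
theorem exists_den_dualLattice : ∃ n : ℤ, n ≠ 0 ∧ ∀ B ∈ dualLattice τ 𝔞, ∀ i j,
    IsIntegral ℤ ((n : K) * B i j) := by
  classical
  obtain ⟨a0, ha0, hne⟩ := exists_mem_ne_zero 𝔞
  obtain ⟨θ, hθ, hθne⟩ := exists_integral_conj_ne τ hτ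
  obtain ⟨N, hN⟩ : ∃ N : K, N = ((FractionalIdeal.absNorm (𝔞 : FractionalIdeal (𝓞 K)⁰ K) : ℚ) : K) :=
    ⟨_, rfl⟩
  have hN0 : N ≠ 0 := hN ▸ absNorm_ne_zero 𝔞
  have hτN : τ N = N := by rw [hN, map_ratCast]
  have hδ : θ - τ θ ≠ 0 := sub_ne_zero.mpr (Ne.symm hθne)
  obtain ⟨n, hn, hint⟩ := exists_int_mul_isIntegral_finset ({N⁻¹, ((θ - τ θ) * a0)⁻¹} : Finset K)
  have h1 := hint N⁻¹ (by simp)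
  have h2 := hint ((θ - τ θ) * a0)⁻¹ (by simp)
  have zero_mem : (0 : K) ∈ (𝔞 : FractionalIdeal (𝓞 K)⁰ K) :=
    Submodule.zero_mem ((𝔞 : FractionalIdeal (𝓞 K)⁰ K) : Submodule (𝓞 K) K)
  refine ⟨n, hn, fun B hB => ?_⟩
  obtain ⟨hV, hdual⟩ := hB
  have hcc := conj_conj hK ι τ hτ
  have hB01 : B 0 1 = τ (B 1 0) := quadSpace_apply τ hV 1 0
  -- Pairing B with (1,0;0,0) and (0,0;0,N) reads off its diagonal; pairing with (0,λ';λ,0) gives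
  -- -Tr(λ B₀₁).
  have h11 : IsIntegral ℤ (B 1 1) := by
    obtain ⟨k, hk⟩ := hdual !![1, 0; 0, 0] ⟨by ext i j; fin_cases i <;> fin_cases j <;> simp,
      ⟨1, by simp⟩, ⟨0, by simp⟩, by simpa using zero_mem⟩
    simp only [Matrix.det_fin_two, Matrix.add_apply, Matrix.of_apply, Matrix.cons_val', Matrix.cons_val_zero,
      Matrix.cons_val_one, Matrix.cons_val_fin_one] at hk
    have : B 1 1 = k := by
      rw [← hk]
      ring
    rw [this]
    exact isIntegral_intCast _
  have h00 : IsIntegral ℤ (N * B 0 0) := by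
    obtain ⟨k, hk⟩ := hdual !![0, 0; 0, N] ⟨by
      ext i j
      fin_cases i <;> fin_cases j <;> simp [hτN],
      ⟨0, by simp⟩, ⟨1, by simp [hN]⟩, by simpa using zero_mem⟩
    simp only [Matrix.det_fin_two, Matrix.add_apply, Matrix.of_apply, Matrix.cons_val', Matrix.cons_val_zero,
      Matrix.cons_val_one, Matrix.cons_val_fin_one] at hk
    have : N * B 0 0 = k := by
      rw [← hk]
      ring
    rw [this]
    exact isIntegral_intCast _
  have htr : ∀ l ∈ (𝔞 : FractionalIdeal (𝓞 K)⁰ K), IsIntegral ℤ (l * B 0 1 + τ (l * B 0 1)) := by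
    intro l hl
    obtain ⟨k, hk⟩ := hdual !![0, τ l; l, 0] ⟨by
      ext i j
      fin_cases i <;> fin_cases j <;> simp [hcc],
      ⟨0, by simp⟩, ⟨0, by simp⟩, by simpa using hl⟩
    simp only [Matrix.det_fin_two, Matrix.add_apply, Matrix.of_apply, Matrix.cons_val', Matrix.cons_val_zero,
      Matrix.cons_val_one, Matrix.cons_val_fin_one] at hk
    have : l * B 0 1 + τ (l * B 0 1) = (-k : ℤ) := by
      rw [map_mul, hB01, hcc]
      push_cast
      rw [← hk, hB01]
      ring
    rw [this]
    exact isIntegral_intCast _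
  have h01 : IsIntegral ℤ ((n : K) * B 0 1) := by
    have e1 := htr a0 ha0
    have e2 := htr (θ * a0) (one_mul_mem (mem_one_iff.mpr hθ) ha0)
    -- The traces for λ = a₀ and λ = θa₀ together eliminate the conjugate term and isolate B₀₁.
    have e3 : IsIntegral ℤ ((θ - τ θ) * a0 * B 0 1) := by
      have : (θ - τ θ) * a0 * B 0 1 =
          (θ * a0 * B 0 1 + τ (θ * a0 * B 0 1)) - τ θ * (a0 * B 0 1 + τ (a0 * B 0 1)) := by
        simp only [map_mul]
        ring
      rw [this]
      exact e2.sub ((isIntegral_conj τ hθ).mul e1)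
    have : (n : K) * B 0 1 = (n * ((θ - τ θ) * a0)⁻¹) * ((θ - τ θ) * a0 * B 0 1) := by
      field_simp
    rw [this]
    exact h2.mul e3
  intro i j
  fin_cases i <;> fin_cases j
  · change IsIntegral ℤ ((n : K) * B 0 0)
    have : (n : K) * B 0 0 = (n * N⁻¹) * (N * B 0 0) := by
      field_simp
    rw [this]
    exact h1.mul h00
  · exact h01
  · change IsIntegral ℤ ((n : K) * B 1 0)
    have := isIntegral_conj τ h01
    rwa [map_mul, map_intCast, hB01, hcc] at this
  · exact (isIntegral_intCast _).mul h11

include hK hτ ι in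
theorem exists_den_matAct (σ : SL(2, K)) : ∃ n : ℤ, n ≠ 0 ∧ ∀ B ∈ dualLattice τ 𝔞, ∀ i j,
    IsIntegral ℤ ((n : K) * matAct τ σ B i j) := by
  classical
  obtain ⟨n, hn, hB⟩ := exists_den_dualLattice hK ι τ hτ 𝔞
  obtain ⟨d, hd, hσ⟩ := exists_int_mul_isIntegral_finset
    (Finset.univ.image fun p : Fin 2 × Fin 2 => σ.1 p.1 p.2)
  have hσ' : ∀ i j, IsIntegral ℤ ((d : K) * σ.1 i j) := fun i j =>
    hσ _ (Finset.mem_image_of_mem (fun p : Fin 2 × Fin 2 => σ.1 p.1 p.2) (Finset.mem_univ (i, j)))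
  have hσ2 : ∀ i j, IsIntegral ℤ ((d : K) * τ (σ.1 i j)) := fun i j => by
    have := isIntegral_conj τ (hσ' i j)
    rwa [map_mul, map_intCast] at this
  refine ⟨d * n * d, mul_ne_zero (mul_ne_zero hd hn) hd, fun B hBm i j => ?_⟩
  have : ((d * n * d : ℤ) : K) * matAct τ σ B i j =
      ∑ l, (∑ k, (d * σ.1 i k) * (n * B k l)) * (d * τ (σ.1 j l)) := by
    simp only [matAct, Matrix.mul_apply, Matrix.transpose_apply, Matrix.map_apply, Fin.sum_univ_two]
    push_cast
    ring
  rw [this]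
  exact IsIntegral.sum _ fun l _ => (IsIntegral.sum _ fun k _ => (hσ' i k).mul (hB B hBm k l)).mul (hσ2 j l)

theorem measurableSet_cuspBox (c R r : ℝ) : MeasurableSet (cuspBox c R r) := by
  have him : Measurable fun z : ℍ => z.im := UpperHalfPlane.continuous_im.measurable
  have hre : Measurable fun z : ℍ => z.re := UpperHalfPlane.continuous_re.measurable
  have h1 : Measurable fun z : ℍ × ℍ => z.1.im := by fun_prop
  have h2 : Measurable fun z : ℍ × ℍ => z.2.im := by fun_prop
  have h3 : Measurable fun z : ℍ × ℍ => |z.1.re| := (by fun_prop : Measurable fun z : ℍ × ℍ => z.1.re).abs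
  have h4 : Measurable fun z : ℍ × ℍ => |z.2.re| := (by fun_prop : Measurable fun z : ℍ × ℍ => z.2.re).abs
  exact (measurableSet_le h3 measurable_const).inter ((measurableSet_le h4 measurable_const).inter
    ((measurableSet_le measurable_const (h1.mul h2)).inter ((measurableSet_le h1 (h2.const_mul r)).inter
    (measurableSet_le h2 (h1.const_mul r)))))

include hK hτ in
-- The bound 1 + 2g ≤ 3 means g ≤ 1. After multiplication by a common denominator n, the entries b
-- and l of σ.A are integral with both conjugates bounded, so they lie in a finite set T, while na
-- is a rational integer of size O(y₁).
theorem exists_tsum_indicator_le {m : ℕ} (hm : 0 < m) (σ : SL(2, K)) {c R r : ℝ} (hc : 0 < c) (hR : 0 ≤ R)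
    (hr : 0 < r) : ∃ C : ℝ, 0 ≤ C ∧ ∀ w ∈ cuspBox c R r,
      ∑' A : vectors τ 𝔞 m, (Set.Iic (3 : ℝ)).indicator (fun _ => (1 : ℝ≥0∞))
        (1 + 2 * gForm ι (matAct τ σ A.1) w) ≤ ENNReal.ofReal (C * w.1.im) := by
  classical
  obtain ⟨q, hq⟩ : ∃ q : K, q = (((m : ℚ) / (FractionalIdeal.absNorm (𝔞 : FractionalIdeal (𝓞 K)⁰ K) *
      (NumberField.discr K : ℚ)) : ℚ) : K) := ⟨_, rfl⟩
  by_cases hD : 0 < ι q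
  swap
  · have : IsEmpty (vectors τ 𝔞 m) := ⟨fun A => hD (by
      have := det_pos_of_mem_vectors hK ι τ hτ hm A.2
      rwa [A.2.2, ← hq] at this)⟩
    exact ⟨0, le_rfl, fun w _ => by simp⟩
  obtain ⟨C0, hC0, hC⟩ := entry_bounds hc hR hr hD
  obtain ⟨n, hn, hint⟩ := exists_den_matAct hK ι τ hτ 𝔞 σ
  have hn0 : (n : K) ≠ 0 := by exact_mod_cast hn
  have hT := finite_integral_bounded hK ι τ hτ (|(n : ℝ)| * C0)
  obtain ⟨T, hTe⟩ : ∃ T, T = hT.toFinset := ⟨_, rfl⟩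
  have he : 0 < √(c / r) := Real.sqrt_pos.mpr (by positivity)
  -- There are at most 2X + 1 integers na with |na| ≤ X = |n| C₀ y₁, and the lower bound y₁ ≥ √(c/r)
  -- absorbs the 1 into a multiple of y₁.
  refine ⟨T.card * T.card * (2 * (|(n : ℝ)| * C0) + 1 / √(c / r)), by positivity, fun w hw => ?_⟩
  have hy : √(c / r) ≤ w.1.im := sqrt_le_im_of_mem_cuspBox hr hw
  have hy0 : 0 < w.1.im := w.1.im_pos
  obtain ⟨X, hX⟩ : ∃ X, X = |(n : ℝ)| * C0 * w.1.im := ⟨_, rfl⟩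
  have hX0 : 0 ≤ X := by
    rw [hX]
    positivity
  -- The floor only converts the entry na, which is already a rational integer, to type ℤ, so
  -- nothing is lost.
  let f : vectors τ 𝔞 m → K × K × ℤ := fun A =>
    (n * matAct τ σ A.1 1 1, n * matAct τ σ A.1 1 0, ⌊ι (n * matAct τ σ A.1 0 0)⌋)
  let S : Set (vectors τ 𝔞 m) := {A | 1 + 2 * gForm ι (matAct τ σ A.1) w ≤ 3}
  let U : Finset (K × K × ℤ) := T ×ˢ T ×ˢ Finset.Icc (-⌊X⌋) ⌊X⌋
  have hV : ∀ A : vectors τ 𝔞 m, matAct τ σ A.1 ∈ quadSpace τ := fun A =>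
    matAct_mem_quadSpace hK ι τ hτ σ A.2.1.1
  have hint00 : ∀ A : vectors τ 𝔞 m, ∃ k : ℤ, (n : K) * matAct τ σ A.1 0 0 = k := fun A => by
    refine exists_int_of_conj_eq hK ι τ hτ ?_ (mem_one_iff.mpr (hint _ A.2.1 0 0))
    rw [map_mul, map_intCast, ← quadSpace_apply τ (hV A)]
  have hf : Function.Injective f := by
    intro A B h
    simp only [f, Prod.mk.injEq] at h
    obtain ⟨h1, h2, h3⟩ := h
    have e1 := mul_left_cancel₀ hn0 h1
    have e2 := mul_left_cancel₀ hn0 h2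
    have e3 : matAct τ σ A.1 0 0 = matAct τ σ B.1 0 0 := by
      obtain ⟨k, hk⟩ := hint00 A
      obtain ⟨k', hk'⟩ := hint00 B
      refine mul_left_cancel₀ hn0 ?_
      rw [hk, hk', map_intCast, map_intCast, Int.floor_intCast, Int.floor_intCast] at h3
      rw [hk, hk', h3]
    have e4 : matAct τ σ A.1 = matAct τ σ B.1 := by
      ext i j
      fin_cases i <;> fin_cases j
      · exact e3
      · change matAct τ σ A.1 0 1 = matAct τ σ B.1 0 1
        rw [quadSpace_apply τ (hV A) 1 0, quadSpace_apply τ (hV B) 1 0, e2]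
      · exact e2
      · exact e1
    refine Subtype.ext ?_
    exact (matAct_inv_eq e4).symm.trans (matAct_inv_eq rfl)
  have hmem : ∀ A ∈ S, f A ∈ U := by
    intro A hA
    have hdet : ι (matAct τ σ A.1).det = ι q := by rw [det_matAct, A.2.2, ← hq]
    have hg : gForm ι (matAct τ σ A.1) w ≤ 1 := by
      have : 1 + 2 * gForm ι (matAct τ σ A.1) w ≤ 3 := hA
      linarith
    have hb := hC (ι (matAct τ σ A.1 0 0)) (ι (matAct τ σ A.1 1 1)) (ι (matAct τ σ A.1 1 0))
      (ι (matAct τ σ A.1 0 1)) w hw (by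
        rw [← hdet, Matrix.det_fin_two, map_sub, map_mul, map_mul]
        ring) (by
        rw [gForm, hForm, hdet, div_le_one hD, div_le_iff₀ (by have := w.2.im_pos; positivity)] at hg
        linarith)
    obtain ⟨b1, b2, b3, b4⟩ := hb
    have hconj : ∀ i j, conjEmb ι τ (matAct τ σ A.1 i j) = ι (matAct τ σ A.1 j i) := fun i j => by
      rw [quadSpace_apply τ (hV A) i j]
      rfl
    have habs : ∀ (ψ : K →+* ℝ) (x : K), |ψ (n * x)| = |(n : ℝ)| * |ψ x| := fun ψ x => by
      rw [map_mul, map_intCast, abs_mul]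
    have hn' : 0 ≤ |(n : ℝ)| := abs_nonneg _
    simp only [U, f, Finset.mem_product, hTe, Set.Finite.mem_toFinset, Set.mem_ofPred_eq, Finset.mem_Icc]
    refine ⟨⟨hint _ A.2.1 _ _, ?_, ?_⟩, ⟨hint _ A.2.1 _ _, ?_, ?_⟩, ?_⟩
    · rw [habs]
      gcongr
    · rw [habs, hconj]
      gcongr
    · rw [habs]
      gcongr
    · rw [habs, hconj]
      gcongr
    · obtain ⟨k, hk⟩ := hint00 A
      have h5 : |(k : ℝ)| ≤ X := by
        have h6 := habs ι (matAct τ σ A.1 0 0)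
        rw [hk, map_intCast] at h6
        rw [h6, hX, mul_assoc]
        gcongr
      rw [hk, map_intCast, Int.floor_intCast, ← abs_le, Int.le_floor]
      exact_mod_cast h5
  have hS : S.Finite := (U.finite_toSet.preimage hf.injOn).subset hmem
  have hcard : hS.toFinset.card ≤ U.card :=
    Finset.card_le_card_of_injOn f (fun A hA => hmem A (hS.mem_toFinset.mp hA)) hf.injOn
  have hsum : ∑' A : vectors τ 𝔞 m, (Set.Iic (3 : ℝ)).indicator (fun _ => (1 : ℝ≥0∞))
      (1 + 2 * gForm ι (matAct τ σ A.1) w) = hS.toFinset.card := by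
    rw [tsum_eq_sum (s := hS.toFinset)]
    · rw [Finset.sum_congr rfl fun A hA => Set.indicator_of_mem (show _ ∈ Set.Iic (3 : ℝ) from
        hS.mem_toFinset.mp hA) _]
      simp
    · intro A hA
      exact Set.indicator_of_notMem (s := Set.Iic (3 : ℝ)) (fun h => hA (hS.mem_toFinset.mpr h)) _
  rw [hsum, ← ENNReal.ofReal_natCast]
  refine ENNReal.ofReal_le_ofReal ?_
  have hUc : (U.card : ℝ) ≤ T.card * T.card * (2 * X + 1) := by
    simp only [U, Finset.card_product, Int.card_Icc]
    push_cast
    rw [mul_assoc]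
    gcongr
    have h7 : 0 ≤ ⌊X⌋ := Int.floor_nonneg.mpr hX0
    have h8 : ((⌊X⌋ + 1 - -⌊X⌋).toNat : ℤ) = ⌊X⌋ + 1 - -⌊X⌋ := Int.toNat_of_nonneg (by omega)
    have h9 : ((⌊X⌋ + 1 - -⌊X⌋).toNat : ℝ) = ⌊X⌋ + 1 - -⌊X⌋ := by exact_mod_cast h8
    rw [h9]
    linarith [Int.floor_le X]
  have hone : 1 ≤ 1 / √(c / r) * w.1.im := by
    rw [div_mul_eq_mul_div, one_mul, le_div_iff₀ he, one_mul]
    exact hy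
  calc (hS.toFinset.card : ℝ) ≤ U.card := by exact_mod_cast hcard
    _ ≤ T.card * T.card * (2 * X + 1) := hUc
    _ ≤ T.card * T.card * ((2 * (|(n : ℝ)| * C0) + 1 / √(c / r)) * w.1.im) := by
      gcongr
      rw [hX]
      linarith
    _ = _ := by ring

include hK hτ in
theorem setLIntegral_preimage_cuspBox_lt_top {m : ℕ} (hm : 0 < m) (σ : SL(2, K)) {c R r : ℝ} (hc : 0 < c)
    (hR : 0 ≤ R) (hr : 0 < r) :
    ∫⁻ z in hilbertAct ι τ σ ⁻¹' cuspBox c R r, ∑' A : vectors τ 𝔞 m,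
      (Set.Iic (3 : ℝ)).indicator (fun _ => (1 : ℝ≥0∞)) (1 + 2 * gForm ι A.1 z) ∂omegaSq < ⊤ := by
  obtain ⟨C, hC, hle⟩ := exists_tsum_indicator_le hK ι τ hτ 𝔞 hm σ hc hR hr
  have h1 : ∀ z, ∑' A : vectors τ 𝔞 m,
      (Set.Iic (3 : ℝ)).indicator (fun _ => (1 : ℝ≥0∞)) (1 + 2 * gForm ι A.1 z) =
      (fun w => ∑' A : vectors τ 𝔞 m, (Set.Iic (3 : ℝ)).indicator (fun _ => (1 : ℝ≥0∞))
        (1 + 2 * gForm ι (matAct τ σ A.1) w)) (hilbertAct ι τ σ z) := fun z => by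
    refine tsum_congr fun A => ?_
    rw [gForm_matAct ι τ σ A.1 (det_pos_of_mem_vectors hK ι τ hτ hm A.2)]
  have hmeas : Measurable fun w => ∑' A : vectors τ 𝔞 m,
      (Set.Iic (3 : ℝ)).indicator (fun _ => (1 : ℝ≥0∞)) (1 + 2 * gForm ι (matAct τ σ A.1) w) :=
    Measurable.tsum fun A => (measurable_const.indicator measurableSet_Iic).comp
      (((measurable_gForm ι _).const_mul 2).const_add 1)
  rw [lintegral_congr h1, (measurePreserving_hilbertAct ι τ σ).setLIntegral_comp_preimage
    (measurableSet_cuspBox c R r) hmeas]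
  exact (setLIntegral_mono' (measurableSet_cuspBox c R r) hle).trans_lt
    (setLIntegral_cuspBox_lt_top hc hR hr hC)

end Counting

/-! ### Minkowski's theorem on linear forms -/

/-- The preimage under M of the open sup-norm ball of radius t is convex and symmetric with volume
(2t)^n / |det M| > 2^n, so Minkowski's convex body theorem applies to ℤ^n. -/
theorem exists_int_mulVec_lt {n : ℕ} (M : Matrix (Fin n) (Fin n) ℝ) (hM : M.det ≠ 0) {t : ℝ} (ht : 0 < t)
    (h : |M.det| < t ^ n) :
    ∃ v : Fin n → ℤ, v ≠ 0 ∧ ∀ i, |M.mulVec (fun j => (v j : ℝ)) i| < t := by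
  let b := Pi.basisFun ℝ (Fin n)
  have hdet : LinearMap.det (Matrix.toLin' M) ≠ 0 := by rwa [LinearMap.det_toLin']
  have : Countable (Submodule.span ℤ (Set.range b)).toAddSubgroup :=
    inferInstanceAs (Countable (Submodule.span ℤ (Set.range b)))
  obtain ⟨x, hx0, hx⟩ := exists_ne_zero_mem_lattice_of_measure_mul_two_pow_lt_measure
    (μ := (volume : Measure (Fin n → ℝ))) (s := Matrix.toLin' M ⁻¹' Metric.ball 0 t)
    (L := (Submodule.span ℤ (Set.range b)).toAddSubgroup)
    (F := ZSpan.fundamentalDomain b) (ZSpan.isAddFundamentalDomain b volume)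
    (by
      intro x hx
      simpa [Matrix.mulVec_neg] using hx)
    ((convex_ball _ _).linear_preimage _) (by
      rw [Measure.addHaar_preimage_linearMap _ hdet, ZSpan.fundamentalDomain_pi_basisFun,
        Real.volume_pi_ball _ ht, LinearMap.det_toLin', volume_pi_pi, Module.finrank_fin_fun]
      simp only [Real.volume_Ico, sub_zero, ENNReal.ofReal_one, Finset.prod_const_one, one_mul,
        Fintype.card_fin]
      rw [← ENNReal.ofReal_mul (abs_nonneg _), mul_pow, abs_inv,
        show (2 : ℝ≥0∞) ^ n = ENNReal.ofReal (2 ^ n) by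
          rw [ENNReal.ofReal_pow (by norm_num)]
          norm_num]
      refine (ENNReal.ofReal_lt_ofReal_iff (by positivity)).mpr ?_
      have hp : 0 < |M.det| := abs_pos.mpr hM
      rw [inv_mul_eq_div, lt_div_iff₀ hp]
      gcongr)
  have hxm : (x : Fin n → ℝ) ∈ Submodule.span ℤ (Set.range b) := x.2
  choose v hv using fun i => (b.mem_span_iff_repr_mem ℤ (x : Fin n → ℝ)).mp hxm i
  have hvx : (fun j => (v j : ℝ)) = x := by
    ext j
    simpa [b] using hv j
  refine ⟨v, fun h0 => hx0 (Subtype.ext ?_), fun i => ?_⟩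
  · rw [← hvx, h0]
    ext j
    simp
  · rw [hvx]
    have h1 : ‖M.mulVec (x : Fin n → ℝ)‖ < t := by simpa using hx
    exact (norm_le_pi_norm _ i).trans_lt h1

section Reduction

variable {K : Type*} [Field K] [NumberField K] (hK : Module.finrank ℚ K = 2) (ι : K →+* ℝ)
  (τ : K ≃ₐ[ℚ] K) (hτ : τ ≠ 1) (𝔞 : (FractionalIdeal (𝓞 K)⁰ K)ˣ)

/-- `|c z + d| ^ 2`. -/
theorem normSq_denom (c d : ℝ) (z : ℍ) :
    Complex.normSq ((c : ℂ) * z + d) = (c * z.re + d) ^ 2 + (c * z.im) ^ 2 := by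
  rw [Complex.normSq_apply]
  simp
  ring

include hτ in
-- For c = (v₀ + v₁θ)a₀ and d = v₂ + v₃θ, the real and imaginary parts of cz₁ + d and c'z₂ + d' are
-- four real linear forms in v with determinant ∓E y₁y₂. Minkowski's theorem makes all four small at
-- once; finite-index sublattices of 𝔞 and 𝓞 suffice.
theorem exists_small_denom : ∃ C : ℝ, 0 < C ∧ ∀ z : ℍ × ℍ,
    ∃ c ∈ (𝔞 : FractionalIdeal (𝓞 K)⁰ K), ∃ d ∈ (1 : FractionalIdeal (𝓞 K)⁰ K), (c ≠ 0 ∨ d ≠ 0) ∧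
      Complex.normSq ((ι c : ℂ) * z.1 + ι d) *
        Complex.normSq ((conjEmb ι τ c : ℂ) * z.2 + conjEmb ι τ d) ≤ C * (z.1.im * z.2.im) := by
  obtain ⟨a0, ha0, hne⟩ := exists_mem_ne_zero 𝔞
  obtain ⟨θ, hθ, hθne⟩ := exists_integral_conj_ne τ hτ
  obtain ⟨a1, ha1⟩ : ∃ x, x = ι a0 := ⟨_, rfl⟩
  obtain ⟨a2, ha2⟩ : ∃ x, x = conjEmb ι τ a0 := ⟨_, rfl⟩
  obtain ⟨t1, ht1⟩ : ∃ x, x = ι θ := ⟨_, rfl⟩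
  obtain ⟨t2, ht2⟩ : ∃ x, x = conjEmb ι τ θ := ⟨_, rfl⟩
  have ha10 : a1 ≠ 0 := by rw [ha1]; exact (map_ne_zero ι).mpr hne
  have ha20 : a2 ≠ 0 := by rw [ha2]; exact (map_ne_zero _).mpr hne
  have ht : t1 - t2 ≠ 0 := by
    rw [ht1, ht2, sub_ne_zero]
    exact fun h => hθne (ι.injective h.symm)
  obtain ⟨E, hE⟩ : ∃ E, E = |a1 * a2 * (t1 - t2) ^ 2| := ⟨_, rfl⟩
  have hE0 : 0 < E := by
    rw [hE]
    positivity
  -- With T = 2E y₁y₂ each form is at most T^(1/4), so each squared denominator is at most 2√T and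
  -- their product at most 4T = 8E y₁y₂.
  refine ⟨8 * E, by positivity, fun z => ?_⟩
  have hy1 := z.1.im_pos
  have hy2 := z.2.im_pos
  let M : Matrix (Fin 4) (Fin 4) ℝ := !![a1 * z.1.re, a1 * t1 * z.1.re, 1, t1;
    a1 * z.1.im, a1 * t1 * z.1.im, 0, 0; a2 * z.2.re, a2 * t2 * z.2.re, 1, t2;
    a2 * z.2.im, a2 * t2 * z.2.im, 0, 0]
  have hdet : |M.det| = E * (z.1.im * z.2.im) := by
    have : M.det = -(a1 * a2 * (t1 - t2) ^ 2) * (z.1.im * z.2.im) := by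
      simp [M, Matrix.det_succ_row_zero, Fin.sum_univ_succ, Fin.succAbove]
      ring
    rw [this, abs_mul, abs_neg, ← hE, abs_of_pos (mul_pos hy1 hy2)]
  have hpos : 0 < E * (z.1.im * z.2.im) := by positivity
  obtain ⟨T, hT⟩ : ∃ T, T = 2 * (E * (z.1.im * z.2.im)) := ⟨_, rfl⟩
  have hT0 : 0 < T := by linarith
  have hT4 : (√(√T)) ^ 4 = T := by
    rw [show (√(√T)) ^ 4 = ((√(√T)) ^ 2) ^ 2 by ring, Real.sq_sqrt (Real.sqrt_nonneg _), Real.sq_sqrt hT0.le]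
  have ht0 : 0 < √(√T) := Real.sqrt_pos.mpr (Real.sqrt_pos.mpr hT0)
  obtain ⟨v, hv0, hv⟩ := exists_int_mulVec_lt M (by
    rw [← abs_pos, hdet]
    exact hpos) ht0 (by
    rw [hdet, hT4, hT]
    linarith)
  have hint : ∀ k : ℤ, IsIntegral ℤ (k : K) := fun k => isIntegral_intCast k
  have hcoef : ∀ p q : ℤ, (p : K) + q * θ = 0 → p = 0 ∧ q = 0 := by
    intro p q h
    have h' := congrArg τ h
    simp only [map_add, map_mul, map_intCast, map_zero] at h'
    have h2 : (q : K) * (τ θ - θ) = 0 := by linear_combination h' - h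
    have hq : (q : K) = 0 := (mul_eq_zero.mp h2).resolve_right (sub_ne_zero.mpr hθne)
    have hp : (p : K) = 0 := by simpa [hq] using h
    exact ⟨by exact_mod_cast hp, by exact_mod_cast hq⟩
  refine ⟨(v 0 + v 1 * θ) * a0, one_mul_mem (mem_one_iff.mpr ((hint _).add ((hint _).mul hθ))) ha0,
    v 2 + v 3 * θ, mem_one_iff.mpr ((hint _).add ((hint _).mul hθ)), ?_, ?_⟩
  · by_contra! h
    obtain ⟨h1, h2⟩ := h
    obtain ⟨e0, e1⟩ := hcoef _ _ ((mul_eq_zero.mp h1).resolve_right hne)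
    obtain ⟨e2, e3⟩ := hcoef _ _ h2
    refine hv0 (funext fun i => ?_)
    fin_cases i
    exacts [e0, e1, e2, e3]
  · have hsq : ∀ i, (M.mulVec (fun j => (v j : ℝ)) i) ^ 2 ≤ √T := by
      intro i
      have := sq_le_sq' (abs_lt.mp (hv i)).1.le (abs_lt.mp (hv i)).2.le
      rwa [Real.sq_sqrt (Real.sqrt_nonneg _)] at this
    have s0 := hsq 0
    have s1 := hsq 1
    have s2 := hsq 2
    have s3 := hsq 3
    simp only [M, Matrix.mulVec, dotProduct, Fin.sum_univ_four, Matrix.of_apply, Matrix.cons_val', Matrix.cons_val] at s0 s1 s2 s3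
    rw [normSq_denom, normSq_denom]
    simp only [map_add, map_mul, map_intCast, ← ha1, ← ha2, ← ht1, ← ht2]
    have r1 : ((v 0 + v 1 * t1) * a1 * z.1.re + (v 2 + v 3 * t1)) ^ 2 +
        ((v 0 + v 1 * t1) * a1 * z.1.im) ^ 2 ≤ 2 * √T := by
      refine le_of_eq_of_le ?_ ((add_le_add s0 s1).trans (by linarith))
      ring
    have r2 : ((v 0 + v 1 * t2) * a2 * z.2.re + (v 2 + v 3 * t2)) ^ 2 +
        ((v 0 + v 1 * t2) * a2 * z.2.im) ^ 2 ≤ 2 * √T := by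
      refine le_of_eq_of_le ?_ ((add_le_add s2 s3).trans (by linarith))
      ring
    refine (mul_le_mul r1 r2 (by positivity) (by positivity)).trans (le_of_eq ?_)
    rw [show 2 * √T * (2 * √T) = 4 * (√T) ^ 2 by ring, Real.sq_sqrt hT0.le, hT]
    ring

end Reduction

/-! ### The cusps of `Γ(𝔞)` -/

section Cusps

variable {K : Type*} [Field K] [NumberField K] (hK : Module.finrank ℚ K = 2) (ι : K →+* ℝ)
  (τ : K ≃ₐ[ℚ] K) (hτ : τ ≠ 1) (𝔞 : (FractionalIdeal (𝓞 K)⁰ K)ˣ)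

theorem mul_mem_of_mul_eq {u v w : (FractionalIdeal (𝓞 K)⁰ K)ˣ} (h : u * v = w) {x y : K}
    (hx : x ∈ (u : FractionalIdeal (𝓞 K)⁰ K)) (hy : y ∈ (v : FractionalIdeal (𝓞 K)⁰ K)) :
    x * y ∈ (w : FractionalIdeal (𝓞 K)⁰ K) := by
  rw [← h, Units.val_mul]
  exact FractionalIdeal.mul_mem_mul hx hy

theorem sub_mem_ideal {I : FractionalIdeal (𝓞 K)⁰ K} {x y : K} (hx : x ∈ I) (hy : y ∈ I) :
    x - y ∈ I :=
  Submodule.sub_mem (I : Submodule (𝓞 K) K) hx hy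

/-- The matrices of `SL₂(K)` that map the cusp attached to the ideal `𝔟` to infinity. -/
def IsAdapted (𝔟 : (FractionalIdeal (𝓞 K)⁰ K)ˣ) (σ : SL(2, K)) : Prop :=
  σ.1 0 0 ∈ ((𝔟⁻¹ : (FractionalIdeal (𝓞 K)⁰ K)ˣ) : FractionalIdeal (𝓞 K)⁰ K) ∧
  σ.1 0 1 ∈ (((𝔞 * 𝔟)⁻¹ : (FractionalIdeal (𝓞 K)⁰ K)ˣ) : FractionalIdeal (𝓞 K)⁰ K) ∧
  σ.1 1 0 ∈ ((𝔞 * 𝔟 : (FractionalIdeal (𝓞 K)⁰ K)ˣ) : FractionalIdeal (𝓞 K)⁰ K) ∧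
  σ.1 1 1 ∈ (𝔟 : FractionalIdeal (𝓞 K)⁰ K)

variable {𝔞} in
-- The ideals prescribed for the entries multiply to 𝓞, 𝔞⁻¹, 𝔞 and 𝓞. Thus 𝔟 alone determines an
-- adapted matrix up to right multiplication by Γ(𝔞).
theorem IsAdapted.inv_mul_mem {𝔟 : (FractionalIdeal (𝓞 K)⁰ K)ˣ} {σ₀ σ : SL(2, K)}
    (h₀ : IsAdapted 𝔞 𝔟 σ₀) (h : IsAdapted 𝔞 𝔟 σ) : σ₀⁻¹ * σ ∈ hilbertGroup 𝔞 := by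
  obtain ⟨a0, b0, c0, d0⟩ := h₀
  obtain ⟨a1, b1, c1, d1⟩ := h
  have e1 : 𝔟 * 𝔟⁻¹ = 1 := mul_inv_cancel _
  have e2 : (𝔞 * 𝔟)⁻¹ * (𝔞 * 𝔟) = 1 := inv_mul_cancel _
  have e3 : 𝔟 * (𝔞 * 𝔟)⁻¹ = 𝔞⁻¹ := by
    rw [mul_inv, mul_comm 𝔞⁻¹, mul_inv_cancel_left]
  have e4 : 𝔟⁻¹ * (𝔞 * 𝔟) = 𝔞 := by
    rw [mul_comm 𝔞, inv_mul_cancel_left]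
  have key : (σ₀⁻¹ * σ).1 = !![σ₀.1 1 1 * σ.1 0 0 - σ₀.1 0 1 * σ.1 1 0,
      σ₀.1 1 1 * σ.1 0 1 - σ₀.1 0 1 * σ.1 1 1; σ₀.1 0 0 * σ.1 1 0 - σ.1 0 0 * σ₀.1 1 0,
      σ₀.1 0 0 * σ.1 1 1 - σ₀.1 1 0 * σ.1 0 1] := by
    rw [Matrix.SpecialLinearGroup.coe_mul, Matrix.SpecialLinearGroup.coe_inv, Matrix.adjugate_fin_two]
    ext i j
    fin_cases i <;> fin_cases j <;> simp [Matrix.mul_apply, Fin.sum_univ_two] <;> ring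
  change (σ₀⁻¹ * σ).1 0 0 ∈ _ ∧ (σ₀⁻¹ * σ).1 0 1 ∈ _ ∧ (σ₀⁻¹ * σ).1 1 0 ∈ _ ∧ (σ₀⁻¹ * σ).1 1 1 ∈ _
  rw [key]
  have one : ∀ {x : K}, x ∈ ((1 : (FractionalIdeal (𝓞 K)⁰ K)ˣ) : FractionalIdeal (𝓞 K)⁰ K) →
      x ∈ (1 : FractionalIdeal (𝓞 K)⁰ K) := fun h => by simpa using h
  refine ⟨sub_mem_ideal (one (mul_mem_of_mul_eq e1 d0 a1)) (one (mul_mem_of_mul_eq e2 b0 c1)),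
    sub_mem_ideal (mul_mem_of_mul_eq e3 d0 b1) (mul_mem_of_mul_eq ((mul_comm _ _).trans e3) b0 d1),
    sub_mem_ideal (mul_mem_of_mul_eq e4 a0 c1) (mul_mem_of_mul_eq e4 a1 c0),
    sub_mem_ideal (one (mul_mem_of_mul_eq ((mul_comm _ _).trans e1) a0 d1))
      (one (mul_mem_of_mul_eq ((mul_comm _ _).trans e2) c0 b1))⟩

/-- Take 𝔟 = c𝔞⁻¹ + d𝓞. Then 1 ∈ 𝔟𝔟⁻¹ = c(𝔞𝔟)⁻¹ + d𝔟⁻¹, and the two coefficients in such a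
representation of 1 form an upper row of determinant 1. -/
theorem exists_isAdapted {c d : K} (hc : c ∈ (𝔞 : FractionalIdeal (𝓞 K)⁰ K))
    (hd : d ∈ (1 : FractionalIdeal (𝓞 K)⁰ K)) (hcd : c ≠ 0 ∨ d ≠ 0) :
    ∃ (𝔟 : (FractionalIdeal (𝓞 K)⁰ K)ˣ) (σ : SL(2, K)), (𝔟 : FractionalIdeal (𝓞 K)⁰ K) ≤ 1 ∧
      IsAdapted 𝔞 𝔟 σ ∧ σ.1 1 0 = c ∧ σ.1 1 1 = d := by
  obtain ⟨J, hJ⟩ : ∃ J, J = FractionalIdeal.spanSingleton (𝓞 K)⁰ c *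
    ((𝔞⁻¹ : (FractionalIdeal (𝓞 K)⁰ K)ˣ) : FractionalIdeal (𝓞 K)⁰ K) +
    FractionalIdeal.spanSingleton (𝓞 K)⁰ d := ⟨_, rfl⟩
  have hdJ : d ∈ J := by
    rw [hJ]
    exact (FractionalIdeal.mem_add _ _ _).mpr ⟨0, Submodule.zero_mem _, d,
      FractionalIdeal.mem_spanSingleton_self _ _, zero_add d⟩
  have hcJ : c ∈ J * (𝔞 : FractionalIdeal (𝓞 K)⁰ K) := by
    have h1 : c ∈ FractionalIdeal.spanSingleton (𝓞 K)⁰ c *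
        ((𝔞⁻¹ : (FractionalIdeal (𝓞 K)⁰ K)ˣ) : FractionalIdeal (𝓞 K)⁰ K) * (𝔞 : FractionalIdeal (𝓞 K)⁰ K) := by
      rw [mul_assoc, Units.inv_mul, mul_one]
      exact FractionalIdeal.mem_spanSingleton_self _ _
    rw [hJ, add_mul]
    exact (FractionalIdeal.mem_add _ _ _).mpr ⟨c, h1, 0, Submodule.zero_mem _, add_zero c⟩
  have hJ0 : J ≠ 0 := by
    rintro h0
    rw [h0] at hdJ hcJ
    rw [zero_mul] at hcJ
    rcases hcd with h | h
    · exact h ((FractionalIdeal.mem_zero_iff _).mp hcJ)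
    · exact h ((FractionalIdeal.mem_zero_iff _).mp hdJ)
  have hJ1 : J ≤ 1 := by
    rw [hJ, ← FractionalIdeal.sup_eq_add]
    refine sup_le ?_ ?_
    · rw [FractionalIdeal.mul_le]
      intro i hi j hj
      obtain ⟨r, rfl⟩ := (FractionalIdeal.mem_spanSingleton (𝓞 K)⁰).mp hi
      rw [Algebra.smul_def, mul_assoc]
      exact one_mul_mem (mem_one_iff.mpr r.isIntegral_coe) (mul_inv_mem hc hj)
    · rwa [FractionalIdeal.spanSingleton_le_iff_mem]
  obtain ⟨𝔟, h𝔟⟩ : ∃ 𝔟 : (FractionalIdeal (𝓞 K)⁰ K)ˣ, (𝔟 : FractionalIdeal (𝓞 K)⁰ K) = J :=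
    ⟨Units.mk0 J hJ0, rfl⟩
  have h1 : (1 : K) ∈ (𝔟 : FractionalIdeal (𝓞 K)⁰ K) *
      ((𝔟⁻¹ : (FractionalIdeal (𝓞 K)⁰ K)ˣ) : FractionalIdeal (𝓞 K)⁰ K) := by
    rw [Units.mul_inv]
    exact FractionalIdeal.one_mem_one _
  rw [h𝔟, hJ, add_mul, mul_assoc, ← Units.val_mul, FractionalIdeal.mem_add] at h1
  obtain ⟨i, hi, j, hj, hij⟩ := h1
  obtain ⟨β, hβ, rfl⟩ := FractionalIdeal.mem_singleton_mul.mp hi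
  obtain ⟨α, hα, rfl⟩ := FractionalIdeal.mem_singleton_mul.mp hj
  rw [← mul_inv] at hβ
  refine ⟨𝔟, ⟨!![α, -β; c, d], ?_⟩, h𝔟 ▸ hJ1, ⟨hα, Submodule.neg_mem _ hβ, ?_, ?_⟩, rfl, rfl⟩
  · rw [Matrix.det_fin_two_of, ← hij]
    ring
  · change c ∈ _
    rw [Units.val_mul, mul_comm, h𝔟]
    exact hcJ
  · change d ∈ _
    rwa [h𝔟]

/-- The diagonal matrix with entries `μ, μ⁻¹`. -/
def diagSL (μ : Kˣ) : SL(2, K) := ⟨!![(μ : K), 0; 0, ((μ⁻¹ : Kˣ) : K)], by simp⟩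

theorem moebius_im (M : SL(2, K)) (z : ℍ) :
    (moebius ι M z).im = z.im / Complex.normSq ((ι (M.1 1 0) : ℂ) * z + ι (M.1 1 1)) := by
  have h := UpperHalfPlane.im_smul_eq_div_normSq
    ((Matrix.SpecialLinearGroup.map ι M : SL(2, ℝ)) : GL (Fin 2) ℝ) z
  rw [show ((Matrix.GeneralLinearGroup.det ((Matrix.SpecialLinearGroup.map ι M : SL(2, ℝ)) :
    GL (Fin 2) ℝ) : ℝˣ) : ℝ) = 1 from (Matrix.SpecialLinearGroup.map ι M).2, abs_one, one_mul] at h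
  exact h

theorem diagSL_im (μ : Kˣ) (z : ℍ) : (moebius ι (diagSL μ) z).im = ι μ ^ 2 * z.im := by
  have h0 : ι μ ≠ 0 := (map_ne_zero ι).mpr μ.ne_zero
  rw [moebius_im]
  simp [diagSL]
  field_simp

include hK hτ in
theorem one_le_norm_sq {x : K} (hx : IsIntegral ℤ x) (h0 : x ≠ 0) :
    1 ≤ (ι x * conjEmb ι τ x) ^ 2 := by
  obtain ⟨n, hn⟩ := exists_int_of_conj_eq hK ι τ hτ (x := x * τ x)
    (by rw [map_mul, conj_conj hK ι τ hτ, mul_comm])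
    (mem_one_iff.mpr (hx.mul (isIntegral_conj τ hx)))
  have h1 : ι x * conjEmb ι τ x = n := by
    rw [← map_intCast ι, ← hn, map_mul]
    rfl
  have hn0 : n ≠ 0 := by
    rintro rfl
    rw [Int.cast_zero] at hn
    exact (mul_ne_zero h0 ((map_ne_zero τ).mpr h0)) hn
  rw [h1]
  have : (1 : ℤ) ≤ n ^ 2 := by
    have := sq_pos_of_ne_zero hn0
    omega
  exact_mod_cast this

variable {𝔞} in
theorem IsAdapted.diagSL_mul {𝔟 𝔟₀ : (FractionalIdeal (𝓞 K)⁰ K)ˣ} {σ : SL(2, K)}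
    (h : IsAdapted 𝔞 𝔟 σ) {μ : Kˣ} (hμ : toPrincipalIdeal (𝓞 K) K μ = 𝔟₀⁻¹ * 𝔟) :
    IsAdapted 𝔞 𝔟₀ (diagSL μ * σ) := by
  obtain ⟨a1, b1, c1, d1⟩ := h
  have key : (diagSL μ * σ).1 = !![μ * σ.1 0 0, μ * σ.1 0 1; ((μ⁻¹ : Kˣ) : K) * σ.1 1 0,
      ((μ⁻¹ : Kˣ) : K) * σ.1 1 1] := by
    rw [Matrix.SpecialLinearGroup.coe_mul]
    ext i j
    fin_cases i <;> fin_cases j <;> simp [diagSL, Matrix.mul_apply, Fin.sum_univ_two]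
  have hmem : ∀ ν : Kˣ, (ν : K) ∈ (toPrincipalIdeal (𝓞 K) K ν : FractionalIdeal (𝓞 K)⁰ K) := fun ν => by
    rw [coe_toPrincipalIdeal]
    exact FractionalIdeal.mem_spanSingleton_self _ _
  have m1 := hmem μ
  have m2 := hmem μ⁻¹
  rw [map_inv, hμ] at m2
  rw [hμ] at m1
  unfold IsAdapted
  rw [key]
  refine ⟨mul_mem_of_mul_eq ?_ m1 a1, mul_mem_of_mul_eq ?_ m1 b1, mul_mem_of_mul_eq ?_ m2 c1,
    mul_mem_of_mul_eq ?_ m2 d1⟩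
  · rw [mul_inv_cancel_right]
  · rw [mul_inv, mul_inv, mul_comm 𝔞⁻¹, mul_comm 𝔞⁻¹, ← mul_assoc, mul_inv_cancel_right]
  · rw [mul_inv, inv_inv, mul_comm 𝔞, mul_comm 𝔞, ← mul_assoc, inv_mul_cancel_right]
  · rw [mul_inv, inv_inv, inv_mul_cancel_right]

include hK hτ in
-- One adapted matrix σ₀, for an ideal 𝔟₀, is fixed in the class. For σ adapted to an integral 𝔟 in
-- the class, pick μ with (μ) = 𝔟₀⁻¹𝔟; then diag(μ, μ⁻¹)σ is adapted to 𝔟₀ and differs from σ₀ by an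
-- element of Γ(𝔞). The product of heights is scaled by N(μ)², bounded below since μb is a nonzero
-- integer for a fixed nonzero b ∈ 𝔟₀.
theorem exists_cusp_of_class (κ : ClassGroup (𝓞 K)) : ∃ (σ₀ : SL(2, K)) (c : ℝ), 0 < c ∧
    ∀ (𝔟 : (FractionalIdeal (𝓞 K)⁰ K)ˣ) (σ : SL(2, K)), (𝔟 : FractionalIdeal (𝓞 K)⁰ K) ≤ 1 →
      IsAdapted 𝔞 𝔟 σ → (ClassGroup.equiv K).symm (𝔟 : _ ⧸ (toPrincipalIdeal (𝓞 K) K).range) = κ →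
      ∃ γ ∈ hilbertGroup 𝔞, ∀ z : ℍ × ℍ,
        c * ((hilbertAct ι τ σ z).1.im * (hilbertAct ι τ σ z).2.im) ≤
          (hilbertAct ι τ σ₀ (hilbertAct ι τ γ z)).1.im *
            (hilbertAct ι τ σ₀ (hilbertAct ι τ γ z)).2.im := by
  by_cases hex : ∃ (𝔟₀ : (FractionalIdeal (𝓞 K)⁰ K)ˣ) (σ₀ : SL(2, K)), IsAdapted 𝔞 𝔟₀ σ₀ ∧
      (ClassGroup.equiv K).symm (𝔟₀ : _ ⧸ (toPrincipalIdeal (𝓞 K) K).range) = κ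
  swap
  -- No adapted matrix belongs to this class, so arbitrary values serve.
  · exact ⟨1, 1, one_pos, fun 𝔟 σ _ h1 h2 => absurd ⟨𝔟, σ, h1, h2⟩ hex⟩
  obtain ⟨𝔟₀, σ₀, h₀, hκ₀⟩ := hex
  obtain ⟨b, hb, hb0⟩ := exists_mem_ne_zero 𝔟₀
  have hι0 : ∀ ψ : K →+* ℝ, ψ b ≠ 0 := fun ψ => (map_ne_zero ψ).mpr hb0
  have hpos : 0 < (ι b * conjEmb ι τ b) ^ 2 := by
    have := mul_ne_zero (hι0 ι) (hι0 (conjEmb ι τ))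
    positivity
  refine ⟨σ₀, 1 / (ι b * conjEmb ι τ b) ^ 2, by positivity, fun 𝔟 σ h1 h hκ => ?_⟩
  have hq : (𝔟₀ : _ ⧸ (toPrincipalIdeal (𝓞 K) K).range) = 𝔟 :=
    (ClassGroup.equiv K).symm.injective (hκ₀.trans hκ.symm)
  obtain ⟨μ, hμ⟩ := QuotientGroup.eq.mp hq
  refine ⟨σ₀⁻¹ * (diagSL μ * σ), h₀.inv_mul_mem (h.diagSL_mul hμ), fun z => ?_⟩
  have h2 : hilbertAct ι τ σ₀ (hilbertAct ι τ (σ₀⁻¹ * (diagSL μ * σ)) z) =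
      hilbertAct ι τ (diagSL μ) (hilbertAct ι τ σ z) := by
    rw [← Equiv.Perm.mul_apply, ← map_mul, mul_inv_cancel_left, map_mul, Equiv.Perm.mul_apply]
  rw [h2, hilbertAct_apply ι τ (diagSL μ), diagSL_im, diagSL_im]
  have hint : IsIntegral ℤ ((μ : K) * b) := by
    refine mem_one_iff.mp (h1 (mul_mem_of_mul_eq (u := 𝔟₀⁻¹ * 𝔟) (v := 𝔟₀) ?_ ?_ hb))
    · rw [mul_comm, mul_inv_cancel_left]
    · rw [← hμ, coe_toPrincipalIdeal]
      exact FractionalIdeal.mem_spanSingleton_self _ _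
  have h3 := one_le_norm_sq hK ι τ hτ hint (mul_ne_zero μ.ne_zero hb0)
  rw [map_mul, map_mul] at h3
  have h4 : 1 / (ι b * conjEmb ι τ b) ^ 2 ≤ ι μ ^ 2 * conjEmb ι τ μ ^ 2 := by
    rw [div_le_iff₀ hpos]
    refine h3.trans (le_of_eq ?_)
    ring
  have hy := mul_pos (hilbertAct ι τ σ z).1.im_pos (hilbertAct ι τ σ z).2.im_pos
  refine (mul_le_mul_of_nonneg_right h4 hy.le).trans (le_of_eq ?_)
  ring

include hK hτ in
/-- Every point can be moved by `Γ(𝔞)` into a neighbourhood of one of finitely many cusps. -/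
theorem exists_cusps : ∃ (σ : ClassGroup (𝓞 K) → SL(2, K)) (c : ClassGroup (𝓞 K) → ℝ), (∀ κ, 0 < c κ) ∧
    ∀ z : ℍ × ℍ, ∃ κ, ∃ γ ∈ hilbertGroup 𝔞,
      c κ ≤ (hilbertAct ι τ (σ κ) (hilbertAct ι τ γ z)).1.im *
        (hilbertAct ι τ (σ κ) (hilbertAct ι τ γ z)).2.im := by
  choose σ c hc hσ using exists_cusp_of_class hK ι τ hτ 𝔞
  obtain ⟨C, hC, hsmall⟩ := exists_small_denom ι τ hτ 𝔞
  refine ⟨σ, fun κ => c κ * (1 / C), fun κ => mul_pos (hc κ) (by positivity), fun z => ?_⟩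
  obtain ⟨x, hx, y, hy, hxy, hle⟩ := hsmall z
  obtain ⟨𝔟, σ', h1, h2, rfl, rfl⟩ := exists_isAdapted 𝔞 hx hy hxy
  obtain ⟨γ, hγ, h⟩ := hσ _ 𝔟 σ' h1 h2 rfl
  refine ⟨_, γ, hγ, le_trans ?_ (h z)⟩
  refine mul_le_mul_of_nonneg_left ?_ (hc _).le
  have i1 := (moebius ι σ' z.1).im_pos
  have i2 := (moebius (conjEmb ι τ) σ' z.2).im_pos
  rw [hilbertAct_apply, moebius_im, moebius_im, div_mul_div_comm]
  rw [moebius_im] at i1 i2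
  have n1 := (div_pos_iff_of_pos_left z.1.im_pos).mp i1
  have n2 := (div_pos_iff_of_pos_left z.2.im_pos).mp i2
  rw [div_le_div_iff₀ hC (mul_pos n1 n2), one_mul, mul_comm _ C]
  exact hle

end Cusps

/-! ### Boxes for the stabilizers of the cusps -/

section CuspStabilizers

variable {K : Type*} [Field K] [NumberField K] (hK : Module.finrank ℚ K = 2) (ι : K →+* ℝ)
  (τ : K ≃ₐ[ℚ] K) (hτ : τ ≠ 1) (𝔞 : (FractionalIdeal (𝓞 K)⁰ K)ˣ)

include hτ in
-- Dirichlet's unit theorem provides a unit that is small at every place other than that of ι ∘ τ,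
-- in particular at ι; its inverse is taken.
theorem exists_unit_one_lt : ∃ u : (𝓞 K)ˣ, 1 < |ι u| := by
  let w₀ := InfinitePlace.mk (Complex.ofRealHom.comp ι)
  let w₁ := InfinitePlace.mk (Complex.ofRealHom.comp (conjEmb ι τ))
  have hne : w₀ ≠ w₁ := by
    intro h
    rcases InfinitePlace.mk_eq_iff.mp h with h | h
    · exact ofReal_comp_ne ι τ hτ h
    · refine ofReal_comp_ne ι τ hτ (Eq.trans ?_ h)
      ext x
      simp [ComplexEmbedding.conjugate]
  obtain ⟨u, hu⟩ := NumberField.Units.dirichletUnitTheorem.exists_unit K w₁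
  have h1 := hu w₀ hne
  have h2 : w₀ (u : K) = |ι u| := by
    simp only [w₀, InfinitePlace.apply]
    simp
  have h0 : 0 < |ι u| := abs_pos.mpr ((map_ne_zero ι).mpr (NumberField.Units.coe_ne_zero u))
  rw [h2, Real.log_neg_iff h0] at h1
  refine ⟨u⁻¹, ?_⟩
  have h3 : ι ((u⁻¹ : (𝓞 K)ˣ) : 𝓞 K) * ι u = 1 := by
    rw [← map_mul, ← map_mul, Units.inv_mul, map_one, map_one]
  rw [eq_inv_of_mul_eq_one_left h3, abs_inv]
  exact (one_lt_inv₀ h0).mpr h1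

include hτ in
-- The quotient 𝓞/(n) is finite, so a positive power of any unit is congruent to 1.
theorem exists_unit_congr_one {n : 𝓞 K} (hn : n ≠ 0) :
    ∃ u : (𝓞 K)ˣ, 1 < |ι u| ∧ n ∣ (u : 𝓞 K) - 1 ∧ n ∣ ((u⁻¹ : (𝓞 K)ˣ) : 𝓞 K) - 1 := by
  obtain ⟨u, hu⟩ := exists_unit_one_lt ι τ hτ
  have : Finite (𝓞 K ⧸ Ideal.span {n}) :=
    Ideal.finiteQuotientOfFreeOfNeBot _ (by simpa using hn)
  let f := Units.map (Ideal.Quotient.mk (Ideal.span {n})).toMonoidHom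
  obtain ⟨k, hk, h⟩ := (isOfFinOrder_of_finite (f u)).exists_pow_eq_one
  have hdvd : ∀ v : (𝓞 K)ˣ, f v = 1 → n ∣ (v : 𝓞 K) - 1 := by
    intro v hv
    rw [← Ideal.mem_span_singleton, ← Ideal.Quotient.eq]
    exact congrArg Units.val hv
  refine ⟨u ^ k, ?_, hdvd _ (by rw [map_pow, h]), hdvd _ (by rw [map_inv, map_pow, h, inv_one])⟩
  rw [NumberField.Units.coe_pow, map_pow, abs_pow]
  exact one_lt_pow₀ hu hk.ne'

theorem exists_int_mem (𝔟 : (FractionalIdeal (𝓞 K)⁰ K)ˣ) :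
    ∃ n : ℤ, n ≠ 0 ∧ (n : K) ∈ (𝔟 : FractionalIdeal (𝓞 K)⁰ K) := by
  obtain ⟨a, ha, ha0⟩ := exists_mem_ne_zero 𝔟
  obtain ⟨n, hn, h⟩ := exists_int_mul_isIntegral a⁻¹
  refine ⟨n, hn, ?_⟩
  have := one_mul_mem (mem_one_iff.mpr h) ha
  rwa [mul_assoc, inv_mul_cancel₀ ha0, mul_one] at this

theorem conj_one_add_smul_apply {σ δ : SL(2, K)} {x : Matrix (Fin 2) (Fin 2) K} {a b : K}
    (hδ : δ.1 = 1 + (a * b * a) • x) (i j : Fin 2) :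
    (σ⁻¹ * δ * σ).1 i j = (1 : Matrix (Fin 2) (Fin 2) K) i j +
      b * ∑ l, (∑ k, (a * σ⁻¹.1 i k) * x k l) * (a * σ.1 l j) := by
  have hinv : σ⁻¹.1 * σ.1 = 1 := by
    rw [← Matrix.SpecialLinearGroup.coe_mul, inv_mul_cancel, Matrix.SpecialLinearGroup.coe_one]
  rw [Matrix.SpecialLinearGroup.coe_mul, Matrix.SpecialLinearGroup.coe_mul, hδ, mul_add, add_mul, mul_one,
    hinv, Matrix.add_apply, add_right_inj]
  generalize σ⁻¹.1 = ρ
  simp only [Matrix.mul_apply, Matrix.smul_apply, smul_eq_mul, Fin.sum_univ_two]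
  ring

theorem mem_hilbertGroup_of_congr_one {n1 n2 : ℤ} (hm1 : (n1 : K) ∈ (𝔞 : FractionalIdeal (𝓞 K)⁰ K))
    (hm2 : (n2 : K) ∈ ((𝔞⁻¹ : (FractionalIdeal (𝓞 K)⁰ K)ˣ) : FractionalIdeal (𝓞 K)⁰ K)) {M : SL(2, K)}
    (hM : ∀ i j, ∃ y : K, IsIntegral ℤ y ∧
      M.1 i j = (1 : Matrix (Fin 2) (Fin 2) K) i j + ((n1 : K) * n2) * y) : M ∈ hilbertGroup 𝔞 := by
  have memI : ∀ (I : FractionalIdeal (𝓞 K)⁰ K) (n n' : ℤ) (y : K), (n : K) ∈ I → IsIntegral ℤ y →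
      (n' * n) * y ∈ I := fun I n n' y hn hy =>
    mul_one_mem (int_mul_mem n' hn) (mem_one_iff.mpr hy)
  have memd : ∀ y : K, IsIntegral ℤ y → 1 + ((n1 : K) * n2) * y ∈ (1 : FractionalIdeal (𝓞 K)⁰ K) :=
    fun y hy => mem_one_iff.mpr (isIntegral_one.add
      (((isIntegral_intCast n1).mul (isIntegral_intCast n2)).mul hy))
  refine ⟨?_, ?_, ?_, ?_⟩
  · obtain ⟨y, hy, h⟩ := hM 0 0
    rw [h, Matrix.one_apply_eq]
    exact memd y hy
  · obtain ⟨y, hy, h⟩ := hM 0 1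
    rw [h, Matrix.one_apply_ne (by decide), zero_add]
    exact memI _ _ _ _ hm2 hy
  · obtain ⟨y, hy, h⟩ := hM 1 0
    rw [h, Matrix.one_apply_ne (by decide), zero_add, mul_comm (n1 : K)]
    exact memI _ _ _ _ hm1 hy
  · obtain ⟨y, hy, h⟩ := hM 1 1
    rw [h, Matrix.one_apply_eq]
    exact memd y hy

/-- The congruence subgroups are contained in all conjugates of `Γ(𝔞)`. -/
theorem exists_conj_mem_hilbertGroup (σ : SL(2, K)) : ∃ n : ℤ, n ≠ 0 ∧ ∀ δ : SL(2, K),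
    (∀ i j, ∃ x : K, IsIntegral ℤ x ∧ δ.1 i j = (1 : Matrix (Fin 2) (Fin 2) K) i j + n * x) →
      σ⁻¹ * δ * σ ∈ hilbertGroup 𝔞 := by
  classical
  have hden : ∀ M : SL(2, K), ∃ d : ℤ, d ≠ 0 ∧ ∀ i j, IsIntegral ℤ ((d : K) * M.1 i j) := by
    intro M
    obtain ⟨d, hd, hint⟩ := exists_int_mul_isIntegral_finset
      (Finset.univ.image fun p : Fin 2 × Fin 2 => M.1 p.1 p.2)
    exact ⟨d, hd, fun i j => hint _
      (Finset.mem_image_of_mem (fun p : Fin 2 × Fin 2 => M.1 p.1 p.2) (Finset.mem_univ (i, j)))⟩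
  obtain ⟨d1, hd1, h1⟩ := hden σ
  obtain ⟨d2, hd2, h2⟩ := hden σ⁻¹
  obtain ⟨n1, hn1, hm1⟩ := exists_int_mem 𝔞
  obtain ⟨n2, hn2, hm2⟩ := exists_int_mem 𝔞⁻¹
  have h1' : ∀ i j, IsIntegral ℤ (((d1 * d2 : ℤ) : K) * σ.1 i j) := fun i j => by
    rw [Int.cast_mul, mul_comm (d1 : K), mul_assoc]
    exact (isIntegral_intCast _).mul (h1 i j)
  have h2' : ∀ i j, IsIntegral ℤ (((d1 * d2 : ℤ) : K) * σ⁻¹.1 i j) := fun i j => by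
    rw [Int.cast_mul, mul_assoc]
    exact (isIntegral_intCast _).mul (h2 i j)
  have hd : d1 * d2 ≠ 0 := mul_ne_zero hd1 hd2
  -- The two outer factors clear the denominators of σ⁻¹ and σ; the inner n₁n₂, with n₁ ∈ 𝔞 and n₂ ∈
  -- 𝔞⁻¹, puts the off-diagonal entries into their ideals.
  refine ⟨d1 * d2 * (n1 * n2) * (d1 * d2), mul_ne_zero (mul_ne_zero hd (mul_ne_zero hn1 hn2)) hd,
    fun δ hδ => ?_⟩
  choose x hx hδx using hδ
  have hδ' : δ.1 = 1 + (((d1 * d2 : ℤ) : K) * ((n1 : K) * n2) * ((d1 * d2 : ℤ) : K)) • Matrix.of x := by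
    ext i j
    rw [hδx]
    simp
  refine mem_hilbertGroup_of_congr_one 𝔞 hm1 hm2 fun i j =>
    ⟨_, ?_, conj_one_add_smul_apply hδ' i j⟩
  exact IsIntegral.sum _ fun l _ => (IsIntegral.sum _ fun k _ => (h2' i k).mul (hx k l)).mul (h1' l j)

/-- The unipotent matrix `(1, b; 0, 1)`. -/
def unipSL (b : K) : SL(2, K) := ⟨!![1, b; 0, 1], by simp⟩

theorem unipSL_coe (b : K) (z : ℍ) : (moebius ι (unipSL b) z : ℂ) = z + ι b := by
  rw [moebius_apply, coe_specialLinearGroup_apply]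
  simp only [map_coe, Algebra.algebraMap_self, RingHom.id_apply]
  simp [unipSL]

theorem unipSL_re (b : K) (z : ℍ) : (moebius ι (unipSL b) z).re = z.re + ι b := by
  rw [← coe_re, unipSL_coe]
  simp

theorem unipSL_im (b : K) (z : ℍ) : (moebius ι (unipSL b) z).im = z.im := by
  rw [← coe_im, unipSL_coe]
  simp

theorem diagSL_zpow (μ : Kˣ) (k : ℤ) : diagSL (μ ^ k) = diagSL μ ^ k := by
  have h : ∀ μ ν : Kˣ, diagSL (μ * ν) = diagSL μ * diagSL ν := by
    intro μ ν
    refine Matrix.SpecialLinearGroup.ext _ _ fun i j => ?_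
    rw [Matrix.SpecialLinearGroup.coe_mul]
    fin_cases i <;> fin_cases j <;> simp [diagSL, Matrix.mul_apply, Fin.sum_univ_two, mul_comm]
  exact map_zpow (MonoidHom.mk' diagSL h) μ k

/-- Choose m with V^(2m) ≤ y₁/y₂ < V^(2m+2) and take k = -m: the ratio of the new heights lies in
[1, V²). -/
theorem exists_balanced_zpow {V y1 y2 : ℝ} (hV : 1 < V) (hy1 : 0 < y1) (hy2 : 0 < y2) :
    ∃ k : ℤ, V ^ k * y1 ≤ V ^ 2 * ((V ^ k)⁻¹ * y2) ∧ (V ^ k)⁻¹ * y2 ≤ V ^ 2 * (V ^ k * y1) := by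
  have hV2 : 1 < V ^ 2 := one_lt_pow₀ hV two_ne_zero
  obtain ⟨m, hm1, hm2⟩ := exists_mem_Ico_zpow (div_pos hy1 hy2) hV2
  obtain ⟨P, hP⟩ : ∃ P, P = V ^ m := ⟨_, rfl⟩
  have hP0 : 0 < P := hP ▸ zpow_pos (by linarith) _
  have e1 : (V ^ 2) ^ m = P ^ 2 := by
    rw [hP, ← zpow_natCast, ← zpow_natCast, ← zpow_mul, ← zpow_mul, mul_comm]
  rw [e1, le_div_iff₀ hy2] at hm1
  rw [zpow_add_one₀ (by positivity), e1, div_lt_iff₀ hy2] at hm2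
  refine ⟨-m, ?_⟩
  rw [zpow_neg, ← hP, inv_inv]
  have e2 : P⁻¹ * y1 = P⁻¹ ^ 2 * P * y1 := by
    field_simp
  constructor
  · rw [inv_mul_le_iff₀ hP0]
    nlinarith
  · have h3 : P * y2 ≤ P⁻¹ * y1 := by
      rw [le_inv_mul_iff₀ hP0]
      linarith
    refine h3.trans (le_mul_of_one_le_left (by positivity) hV2.le)

include hK hτ in
-- The conjugate of Γ(𝔞) by σ contains diag(u, u⁻¹) for a unit u of infinite order congruent to 1
-- mod n, and all translations by n(ℤ + ℤθ). Powers of the first balance y₁ against y₂ without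
-- changing their product; the second then bound x₁ and x₂.
theorem exists_stab_reduction (σ : SL(2, K)) : ∃ R r : ℝ, 0 ≤ R ∧ 0 < r ∧ ∀ w : ℍ × ℍ,
    ∃ δ : SL(2, K), σ⁻¹ * δ * σ ∈ hilbertGroup 𝔞 ∧
      hilbertAct ι τ δ w ∈ cuspBox (w.1.im * w.2.im) R r := by
  obtain ⟨n, hn, hconj⟩ := exists_conj_mem_hilbertGroup 𝔞 σ
  let H : Subgroup SL(2, K) := (hilbertGroup 𝔞).comap (MulAut.conj σ⁻¹).toMonoidHom
  have hH : ∀ δ : SL(2, K), δ ∈ H ↔ σ⁻¹ * δ * σ ∈ hilbertGroup 𝔞 := fun δ => by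
    change σ⁻¹ * δ * σ⁻¹⁻¹ ∈ hilbertGroup 𝔞 ↔ _
    rw [inv_inv]
  have hn𝓞 : (n : 𝓞 K) ≠ 0 := by exact_mod_cast hn
  have hnR : (n : ℝ) ≠ 0 := by exact_mod_cast hn
  obtain ⟨u, hu, ⟨x, hx⟩, ⟨x', hx'⟩⟩ := exists_unit_congr_one ι τ hτ hn𝓞
  obtain ⟨θ, hθ, hθne⟩ := exists_integral_conj_ne τ hτ
  obtain ⟨t1, ht1⟩ : ∃ x, x = ι θ := ⟨_, rfl⟩
  obtain ⟨t2, ht2⟩ : ∃ x, x = conjEmb ι τ θ := ⟨_, rfl⟩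
  have ht : t1 - t2 ≠ 0 := by
    rw [ht1, ht2, sub_ne_zero]
    exact fun h => hθne (ι.injective h.symm)
  let μ : Kˣ := Units.map (algebraMap (𝓞 K) K).toMonoidHom u
  have hμ : (μ : K) = u := rfl
  have hμ' : ((μ⁻¹ : Kˣ) : K) = ((u⁻¹ : (𝓞 K)ˣ) : 𝓞 K) := by
    rw [← map_inv]
    rfl
  have hμH : diagSL μ ∈ H := by
    rw [hH]
    refine hconj _ fun i j => ?_
    fin_cases i <;> fin_cases j
    · refine ⟨x, x.isIntegral_coe, ?_⟩
      have := congrArg (algebraMap (𝓞 K) K) hx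
      simp only [map_sub, map_one, map_mul, map_intCast] at this
      change (μ : K) = _
      rw [hμ]
      simp only [Matrix.one_apply_eq]
      linear_combination this
    · exact ⟨0, isIntegral_zero, by simp [diagSL]⟩
    · exact ⟨0, isIntegral_zero, by simp [diagSL]⟩
    · refine ⟨x', x'.isIntegral_coe, ?_⟩
      have := congrArg (algebraMap (𝓞 K) K) hx'
      simp only [map_sub, map_one, map_mul, map_intCast] at this
      change ((μ⁻¹ : Kˣ) : K) = _
      rw [hμ']
      simp only [Matrix.one_apply_eq]
      linear_combination this
  have hbH : ∀ b : K, IsIntegral ℤ b → unipSL (n * b) ∈ H := by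
    intro b hb
    rw [hH]
    refine hconj _ fun i j => ?_
    fin_cases i <;> fin_cases j
    · exact ⟨0, isIntegral_zero, by simp [unipSL]⟩
    · exact ⟨b, hb, by simp [unipSL]⟩
    · exact ⟨0, isIntegral_zero, by simp [unipSL]⟩
    · exact ⟨0, isIntegral_zero, by simp [unipSL]⟩
  obtain ⟨V, hV⟩ : ∃ V, V = ι μ ^ 2 := ⟨_, rfl⟩
  have hV1 : 1 < V := by
    rw [hV, ← sq_abs]
    exact one_lt_pow₀ hu two_ne_zero
  have hV2 : conjEmb ι τ μ ^ 2 = V⁻¹ := by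
    have h1 := one_le_norm_sq hK ι τ hτ (x := (μ : K)) (u : 𝓞 K).isIntegral_coe μ.ne_zero
    have h2 := one_le_norm_sq hK ι τ hτ (x := ((μ⁻¹ : Kˣ) : K)) (by
      rw [hμ']
      exact RingOfIntegers.isIntegral_coe _) μ⁻¹.ne_zero
    rw [Units.val_inv_eq_inv_val, map_inv₀, map_inv₀, ← mul_inv, inv_pow] at h2
    -- Both μ and μ⁻¹ are nonzero integers, so the squared norm of each is at least 1.
    have h3 : (ι μ * conjEmb ι τ μ) ^ 2 = 1 :=
      le_antisymm (by
        by_contra! h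
        exact absurd h2 (not_le.mpr (inv_lt_one_of_one_lt₀ h))) h1
    rw [mul_pow, ← hV] at h3
    exact eq_inv_of_mul_eq_one_right h3
  have hVk : ∀ k : ℤ, ι ((μ ^ k : Kˣ) : K) ^ 2 = V ^ k ∧ conjEmb ι τ ((μ ^ k : Kˣ) : K) ^ 2 = (V ^ k)⁻¹ := by
    intro k
    rw [Units.val_zpow_eq_zpow_val, map_zpow₀, map_zpow₀, hV, ← inv_zpow, ← hV, ← hV2]
    constructor
    · rw [hV, ← zpow_natCast, ← zpow_natCast, ← zpow_mul, ← zpow_mul, mul_comm]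
    · rw [← zpow_natCast, ← zpow_natCast, ← zpow_mul, ← zpow_mul, mul_comm]
  refine ⟨|(n : ℝ)| * (1 + |t1| + |t2|), V ^ 2, by positivity, by positivity, fun w => ?_⟩
  obtain ⟨k, hk1, hk2⟩ := exists_balanced_zpow hV1 w.1.im_pos w.2.im_pos
  obtain ⟨w', hw'⟩ : ∃ w', w' = hilbertAct ι τ (diagSL (μ ^ k)) w := ⟨_, rfl⟩
  have hw1 : w'.1.im = V ^ k * w.1.im := by rw [hw', hilbertAct_apply, diagSL_im, (hVk k).1]
  have hw2 : w'.2.im = (V ^ k)⁻¹ * w.2.im := by rw [hw', hilbertAct_apply, diagSL_im, (hVk k).2]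
  -- P and Q solve x₁ + n(P + Qt₁) = 0 and x₂ + n(P + Qt₂) = 0; rounding them leaves errors of at
  -- most |n|(1 + |t₁| + |t₂|).
  obtain ⟨Q, hQ⟩ : ∃ Q, Q = (w'.2.re - w'.1.re) / (n * (t1 - t2)) := ⟨_, rfl⟩
  obtain ⟨P, hP⟩ : ∃ P, P = -w'.1.re / n - Q * t1 := ⟨_, rfl⟩
  have hround : ∀ X : ℝ, |(round X : ℝ) - X| ≤ 1 := fun X => by
    rw [abs_sub_comm]
    exact (abs_sub_round X).trans (by norm_num)
  have hbound : ∀ (X t : ℝ), X = -(n * (P + Q * t)) → |t| ≤ |t1| + |t2| →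
      |X + n * (round P + round Q * t)| ≤ |(n : ℝ)| * (1 + |t1| + |t2|) := by
    intro X t hX htt
    have : X + n * (round P + round Q * t) = n * ((round P - P) + (round Q - Q) * t) := by
      rw [hX]
      ring
    rw [this, abs_mul]
    refine mul_le_mul_of_nonneg_left ((abs_add_le _ _).trans ?_) (abs_nonneg _)
    rw [abs_mul, add_assoc]
    refine add_le_add (hround P) (le_trans ?_ htt)
    exact mul_le_of_le_one_left (abs_nonneg _) (hround Q)
  refine ⟨unipSL (n * (round P + round Q * θ)) * diagSL (μ ^ k), ?_, ?_⟩
  · rw [← hH, diagSL_zpow]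
    exact mul_mem (hbH _ ((isIntegral_intCast _).add ((isIntegral_intCast _).mul hθ))) (zpow_mem hμH k)
  · rw [map_mul, Equiv.Perm.mul_apply, ← hw', hilbertAct_apply]
    refine ⟨?_, ?_, ?_, ?_, ?_⟩
    · simp only [unipSL_re, map_mul, map_add, map_intCast, ← ht1]
      refine hbound _ _ ?_ (by linarith [abs_nonneg t2])
      rw [hP]
      field_simp
      ring
    · simp only [unipSL_re, map_mul, map_add, map_intCast, ← ht2]
      refine hbound _ _ ?_ (by linarith [abs_nonneg t1])
      rw [hP, hQ]
      field_simp
      ring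
    · simp only [unipSL_im, hw1, hw2]
      have : V ^ k ≠ 0 := zpow_ne_zero _ (by linarith)
      refine le_of_eq ?_
      field_simp
    · simp only [unipSL_im, hw1, hw2]
      exact hk1
    · simp only [unipSL_im, hw1, hw2]
      exact hk2

end CuspStabilizers

/-! ### Finiteness of the volume and convergence -/

section Convergence

variable {K : Type*} [Field K] [NumberField K] (hK : Module.finrank ℚ K = 2) (ι : K →+* ℝ)
  (τ : K ≃ₐ[ℚ] K) (hτ : τ ≠ 1) (𝔞 : (FractionalIdeal (𝓞 K)⁰ K)ˣ) {m : ℕ}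

include hK hτ in
theorem tsum_vectors_hilbertAct (hm : 0 < m) {M : SL(2, K)} (hM : M ∈ hilbertGroup 𝔞) (φ : ℝ → ℝ≥0∞)
    (z : ℍ × ℍ) : ∑' A : vectors τ 𝔞 m, φ (1 + 2 * gForm ι A.1 (hilbertAct ι τ M z)) =
      ∑' A : vectors τ 𝔞 m, φ (1 + 2 * gForm ι A.1 z) := by
  let e : vectors τ 𝔞 m ≃ vectors τ 𝔞 m :=
    { toFun := fun A => ⟨matAct τ M A.1, matAct_mem_vectors hK ι τ hτ hM A.2⟩
      invFun := fun A => ⟨matAct τ M⁻¹ A.1, matAct_mem_vectors hK ι τ hτ (inv_mem hM) A.2⟩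
      left_inv := fun A => Subtype.ext (matAct_inv_eq rfl)
      right_inv := fun A => Subtype.ext (by
        change matAct τ M (matAct τ M⁻¹ A.1) = A.1
        rw [← matAct_mul, mul_inv_cancel, matAct_one]) }
  rw [← e.tsum_eq]
  refine tsum_congr fun A => ?_
  change φ (1 + 2 * gForm ι (matAct τ M A.1) _) = _
  rw [gForm_matAct ι τ M A.1 (det_pos_of_mem_vectors hK ι τ hτ hm A.2)]

include hK hτ in
-- The unfolding identity for the indicator of t ≤ 3 expresses 4 vol(T) as an integral over F of a
-- counting function. That integral is at most the one over finitely many cuspidal boxes meeting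
-- every orbit, which is finite.
theorem volT_ne_top (hm : 0 < m) : volT ι τ 𝔞 m ≠ ⊤ := by
  obtain ⟨F, hF⟩ := hasFundamentalDomain_transfGroup hK ι τ hτ 𝔞
  obtain ⟨σ, c, hc, hcusp⟩ := exists_cusps hK ι τ hτ 𝔞
  choose R r hR hr hred using fun κ => exists_stab_reduction hK ι τ hτ 𝔞 (σ κ)
  let φ : ℝ → ℝ≥0∞ := (Set.Iic (3 : ℝ)).indicator fun _ => 1
  have hφ : Measurable φ := measurable_const.indicator measurableSet_Iic
  let S : Set (ℍ × ℍ) := ⋃ κ, hilbertAct ι τ (σ κ) ⁻¹' cuspBox (c κ) (R κ) (r κ)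
  have hS : ∀ z, ∃ g : transfGroup ι τ 𝔞, g • z ∈ S := by
    intro z
    obtain ⟨κ, γ, hγ, hle⟩ := hcusp z
    -- First γ makes the product of heights at the cusp κ at least c κ; then δ, acting at infinity,
    -- moves the point into the box.
    obtain ⟨δ, hδ, hbox⟩ := hred κ (hilbertAct ι τ (σ κ) (hilbertAct ι τ γ z))
    refine ⟨⟨hilbertAct ι τ ((σ κ)⁻¹ * δ * σ κ * γ), _, mul_mem hδ hγ, rfl⟩, ?_⟩
    refine Set.mem_iUnion.mpr ⟨κ, ?_⟩
    change hilbertAct ι τ (σ κ) (hilbertAct ι τ ((σ κ)⁻¹ * δ * σ κ * γ) z) ∈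
      cuspBox (c κ) (R κ) (r κ)
    have : σ κ * ((σ κ)⁻¹ * δ * σ κ * γ) = δ * (σ κ * γ) := by group
    rw [← Equiv.Perm.mul_apply, ← map_mul, this, map_mul, map_mul, Equiv.Perm.mul_apply,
      Equiv.Perm.mul_apply]
    obtain ⟨h1, h2, h3, h4, h5⟩ := hbox
    exact ⟨h1, h2, hle.trans h3, h4, h5⟩
  have hinv : ∀ (g : transfGroup ι τ 𝔞) (z : ℍ × ℍ),
      ∑' A : vectors τ 𝔞 m, φ (1 + 2 * gForm ι A.1 (g • z)) =
        ∑' A : vectors τ 𝔞 m, φ (1 + 2 * gForm ι A.1 z) := by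
    rintro ⟨_, M, hM, rfl⟩ z
    exact tsum_vectors_hilbertAct hK ι τ hτ 𝔞 hm hM φ z
  have hle := setLIntegral_le_of_covers hF hS (fun z => ∑' A : vectors τ 𝔞 m, φ (1 + 2 * gForm ι A.1 z)) hinv
  rw [setLIntegral_tsum_vectors hK ι τ hτ 𝔞 hm hF φ hφ] at hle
  have hfin : ∫⁻ z in S, ∑' A : vectors τ 𝔞 m, φ (1 + 2 * gForm ι A.1 z) ∂omegaSq < ⊤ := by
    refine (lintegral_iUnion_le _ _).trans_lt ?_
    rw [tsum_fintype]
    exact ENNReal.sum_lt_top.mpr fun κ _ =>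
      setLIntegral_preimage_cuspBox_lt_top hK ι τ hτ 𝔞 hm (σ κ) (hc κ) (hR κ) (hr κ)
  have hint : ∫⁻ t in Set.Ioi (1 : ℝ), φ t = 2 := by
    rw [lintegral_indicator measurableSet_Iic, Measure.restrict_restrict measurableSet_Iic,
      setLIntegral_const, one_mul, Set.inter_comm, Set.Ioi_inter_Iic, Real.volume_Ioc]
    norm_num
  rw [hint] at hle
  intro h
  rw [h] at hle
  simp at hle
  exact hfin.ne hle

theorem omegaSq_ne_zero : omegaSq ≠ 0 := by
  have h : eta Set.univ ≠ 0 := by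
    intro h0
    have h1 := lintegral_eta_cosh_dist (fun _ => 1) measurable_const I
    rw [lintegral_one, h0] at h1
    simp at h1
  intro h0
  have h1 : omegaSq Set.univ = 0 := by rw [h0]; rfl
  rw [omegaSq, Measure.smul_apply, ← Set.univ_prod_univ, Measure.prod_prod] at h1
  simp [h] at h1

theorem one_le_one_add_two_mul_gForm {A : Matrix (Fin 2) (Fin 2) K} (hA : 0 < ι A.det) (z : ℍ × ℍ) :
    1 ≤ 1 + 2 * gForm ι A z := by
  rw [one_add_two_mul_gForm ι A hA]
  exact Real.one_le_cosh _

/-- Since γ_A is an isometry, passing from z to w changes d(z₁, γ_A z₂) by at most d = d(w₁,z₁) +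
d(z₂,w₂), and cosh(x + d) ≤ e^d cosh x. The factor does not depend on A. -/
theorem one_add_two_mul_gForm_le {A : Matrix (Fin 2) (Fin 2) K} (hA : 0 < ι A.det) (z w : ℍ × ℍ) :
    1 + 2 * gForm ι A w ≤ Real.exp (dist w.1 z.1 + dist z.2 w.2) * (1 + 2 * gForm ι A z) := by
  rw [one_add_two_mul_gForm ι A hA, one_add_two_mul_gForm ι A hA]
  obtain ⟨g, hg⟩ : ∃ g, g = vectorSL ι A hA := ⟨_, rfl⟩
  rw [← hg]
  obtain ⟨x, hx⟩ : ∃ x, x = dist z.1 (g • z.2) := ⟨_, rfl⟩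
  obtain ⟨d, hd⟩ : ∃ d, d = dist w.1 z.1 + dist z.2 w.2 := ⟨_, rfl⟩
  have hx0 : 0 ≤ x := hx ▸ dist_nonneg
  have hd0 : 0 ≤ d := hd ▸ by positivity
  have h1 : dist w.1 (g • w.2) ≤ x + d := by
    have h2 := dist_triangle4 w.1 z.1 (g • z.2) (g • w.2)
    rw [dist_smul] at h2
    linarith
  rw [← hx, ← hd]
  calc Real.cosh (dist w.1 (g • w.2)) ≤ Real.cosh (x + d) := by
        rw [Real.cosh_le_cosh, abs_of_nonneg dist_nonneg, abs_of_nonneg (by positivity)]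
        exact h1
    _ = Real.cosh x * Real.cosh d + Real.sinh x * Real.sinh d := Real.cosh_add x d
    _ ≤ Real.cosh x * Real.cosh d + Real.cosh x * Real.sinh d := by
        have := Real.sinh_nonneg_iff.mpr hd0
        have := (Real.sinh_lt_cosh x).le
        gcongr
    _ = Real.exp d * Real.cosh x := by
        rw [← mul_add, Real.cosh_add_sinh, mul_comm]

include hK hτ in
-- Unfolding with φ(t) = t^(-p) shows that the sum is integrable over F, hence finite at some point
-- w of ℍ²; the uniform comparison of 1 + 2g at w and z carries convergence to z.
theorem summable_rpow (hm : 0 < m) {p : ℝ} (hp : 1 < p) (z : ℍ × ℍ) :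
    Summable fun A : vectors τ 𝔞 m => (1 + 2 * gForm ι A.1 z) ^ (-p) := by
  have hpos : ∀ (A : vectors τ 𝔞 m) (z : ℍ × ℍ), 0 < 1 + 2 * gForm ι A.1 z := fun A z =>
    one_pos.trans_le (one_le_one_add_two_mul_gForm ι (det_pos_of_mem_vectors hK ι τ hτ hm A.2) z)
  obtain ⟨w, hw⟩ : ∃ w : ℍ × ℍ, ∑' A : vectors τ 𝔞 m, ENNReal.ofReal ((1 + 2 * gForm ι A.1 w) ^ (-p)) < ⊤ := by
    obtain ⟨F, hF⟩ := hasFundamentalDomain_transfGroup hK ι τ hτ 𝔞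
    have hφ : Measurable fun t : ℝ => ENNReal.ofReal (t ^ (-p)) := by fun_prop
    have h1 := setLIntegral_tsum_vectors hK ι τ hτ 𝔞 hm hF _ hφ
    have h2 : ∫⁻ t in Set.Ioi (1 : ℝ), ENNReal.ofReal (t ^ (-p)) < ⊤ :=
      (integrableOn_Ioi_rpow_of_lt (by linarith) one_pos).lintegral_lt_top
    have h3 : ∫⁻ z in F, ∑' A : vectors τ 𝔞 m, ENNReal.ofReal ((1 + 2 * gForm ι A.1 z) ^ (-p)) ∂omegaSq ≠ ⊤ := by
      rw [h1]
      exact ENNReal.mul_ne_top (ENNReal.mul_ne_top ENNReal.ofNat_ne_top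
        (volT_ne_top hK ι τ hτ 𝔞 hm)) h2.ne
    have h4 := ae_lt_top (Measurable.tsum fun A : vectors τ 𝔞 m =>
      hφ.comp (((measurable_gForm ι A.1).const_mul 2).const_add 1)) h3
    -- A fundamental domain of a nonzero measure is not null, so an almost-everywhere statement on
    -- it has a witness.
    have : (ae (omegaSq.restrict F)).NeBot := by
      rw [ae_neBot, Ne, Measure.restrict_eq_zero]
      exact hF.measure_ne_zero omegaSq_ne_zero
    exact h4.exists
  have hsw : Summable fun A : vectors τ 𝔞 m => (1 + 2 * gForm ι A.1 w) ^ (-p) := by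
    have := ENNReal.summable_toReal hw.ne
    refine this.congr fun A => ?_
    rw [ENNReal.toReal_ofReal (Real.rpow_nonneg (hpos A w).le _)]
  obtain ⟨C, hC⟩ : ∃ C, C = Real.exp (dist w.1 z.1 + dist z.2 w.2) := ⟨_, rfl⟩
  have hC0 : 0 < C := hC ▸ Real.exp_pos _
  refine Summable.of_nonneg_of_le (fun A => Real.rpow_nonneg (hpos A z).le _) (fun A => ?_)
    (hsw.mul_left (C ^ p))
  have h1 := one_add_two_mul_gForm_le ι (det_pos_of_mem_vectors hK ι τ hτ hm A.2) z w
  rw [← hC] at h1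
  have h2 := Real.rpow_le_rpow_of_nonpos (hpos A w) h1 (by linarith : -p ≤ 0)
  rw [Real.mul_rpow hC0.le (hpos A z).le, Real.rpow_neg hC0.le, inv_mul_le_iff₀ (by positivity)] at h2
  exact h2

include hK hτ in
-- The terms of a convergent sum tend to 0, so 1 + 2g(A,z) ≥ 2 for all but finitely many A; for
-- these the decay of Q_{s-1} gives domination by (1 + 2g)^(-Re s).
theorem summable_greenTerm (hm : 0 < m) {s : ℂ} (hs : 1 < s.re) (z : ℍ × ℍ) :
    Summable fun A : vectors τ 𝔞 m => greenTerm ι s z A.1 := by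
  obtain ⟨C, hC, hQ⟩ := norm_legendreQ_le hs
  have hsum := summable_rpow hK ι τ hτ 𝔞 hm hs z
  refine Summable.of_norm_bounded_eventually (hsum.mul_left C) ?_
  have h2 : (0 : ℝ) < 2 ^ (-s.re) := by positivity
  filter_upwards [hsum.tendsto_cofinite_zero.eventually (gt_mem_nhds h2)] with A hA
  refine hQ _ ?_
  by_contra! hlt
  have hpos := one_pos.trans_le
    (one_le_one_add_two_mul_gForm ι (det_pos_of_mem_vectors hK ι τ hτ hm A.2) z)
  exact absurd hA (not_lt.mpr (Real.rpow_le_rpow_of_nonpos hpos hlt.le (by linarith)))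

include hK hτ in
/-- The unfolding identity as an equality of measures. -/
theorem sum_map_eq (hm : 0 < m) {F : Set (ℍ × ℍ)}
    (hF : IsFundamentalDomain (transfGroup ι τ 𝔞) F omegaSq) :
    Measure.sum (fun A : vectors τ 𝔞 m => (omegaSq.restrict F).map fun z => 1 + 2 * gForm ι A.1 z) =
      (2 * volT ι τ 𝔞 m) • volume.restrict (Set.Ioi (1 : ℝ)) := by
  have hT : ∀ A : vectors τ 𝔞 m, Measurable fun z => 1 + 2 * gForm ι A.1 z := fun A =>
    ((measurable_gForm ι A.1).const_mul 2).const_add 1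
  ext S hS
  have hφ : Measurable (S.indicator (1 : ℝ → ℝ≥0∞)) := measurable_one.indicator hS
  have h := setLIntegral_tsum_vectors hK ι τ hτ 𝔞 hm hF _ hφ
  have hφT : ∀ A : vectors τ 𝔞 m, Measurable fun z => S.indicator (1 : ℝ → ℝ≥0∞) (1 + 2 * gForm ι A.1 z) :=
    fun A => hφ.comp (hT A)
  rw [lintegral_tsum fun A => (hφT A).aemeasurable, lintegral_indicator_one hS] at h
  rw [Measure.sum_apply _ hS, Measure.smul_apply, smul_eq_mul, ← h]
  refine tsum_congr fun A => ?_
  rw [← lintegral_indicator_one hS, lintegral_map hφ (hT A)]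

include hK hτ in
-- Unfolding |Q_{s-1}| gives integrability and justifies integrating term by term. The complex value
-- is then the integral of Q_{s-1} against the sum of the image measures, which is 2 vol(T) times
-- Lebesgue measure on (1, ∞).
theorem integral_greenPhi (hm : 0 < m) {s : ℂ} (hs : 1 < s.re) {F : Set (ℍ × ℍ)}
    (hF : IsFundamentalDomain (transfGroup ι τ 𝔞) F omegaSq) :
    IntegrableOn (greenPhi ι τ 𝔞 m s) F omegaSq ∧
      ∫ z in F, greenPhi ι τ 𝔞 m s z ∂omegaSq = 2 * ((volT ι τ 𝔞 m).toReal : ℂ) / (s * (s - 1)) := by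
  have hT : ∀ A : vectors τ 𝔞 m, Measurable fun z => 1 + 2 * gForm ι A.1 z := fun A =>
    ((measurable_gForm ι A.1).const_mul 2).const_add 1
  have hQ := stronglyMeasurable_legendreQ s
  have hQi := integrableOn_legendreQ hs
  have hterm : ∀ A : vectors τ 𝔞 m, StronglyMeasurable fun z => greenTerm ι s z A.1 := fun A =>
    hQ.comp_measurable (hT A)
  have hc : 2 * volT ι τ 𝔞 m ≠ ⊤ := ENNReal.mul_ne_top ENNReal.ofNat_ne_top (volT_ne_top hK ι τ hτ 𝔞 hm)
  have hfin : ∫⁻ z in F, ∑' A : vectors τ 𝔞 m, ‖greenTerm ι s z A.1‖ₑ ∂omegaSq ≠ ⊤ := by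
    have := setLIntegral_tsum_vectors hK ι τ hτ 𝔞 hm hF (fun t => ‖legendreQ s t‖ₑ) hQ.enorm
    unfold greenTerm
    rw [this]
    exact ENNReal.mul_ne_top hc hQi.2.ne
  constructor
  · have hmeas : StronglyMeasurable (greenPhi ι τ 𝔞 m s) :=
      stronglyMeasurable_of_tendsto Filter.atTop
        (fun u : Finset (vectors τ 𝔞 m) => Finset.stronglyMeasurable_fun_sum u fun A _ => hterm A)
        (tendsto_pi_nhds.mpr fun z => (summable_greenTerm hK ι τ hτ 𝔞 hm hs z).hasSum)
    refine ⟨hmeas.aestronglyMeasurable, lt_of_le_of_lt (lintegral_mono fun z => ?_) hfin.lt_top⟩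
    exact enorm_tsum_le_tsum_enorm
  · have h1 : ∫ z in F, greenPhi ι τ 𝔞 m s z ∂omegaSq =
        ∑' A : vectors τ 𝔞 m, ∫ z in F, greenTerm ι s z A.1 ∂omegaSq := by
      refine integral_tsum (fun A => (hterm A).aestronglyMeasurable) ?_
      rwa [← lintegral_tsum fun A => (hterm A).enorm.aemeasurable]
    have hi : Integrable (legendreQ s) (Measure.sum fun A : vectors τ 𝔞 m =>
        (omegaSq.restrict F).map fun z => 1 + 2 * gForm ι A.1 z) := by
      rw [sum_map_eq hK ι τ hτ 𝔞 hm hF]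
      exact hQi.smul_measure hc
    have h2 := (hasSum_integral_measure hi).tsum_eq
    rw [sum_map_eq hK ι τ hτ 𝔞 hm hF, integral_smul_measure, integral_legendreQ hs] at h2
    rw [h1]
    refine (tsum_congr fun A => ?_).trans (h2.trans ?_)
    · rw [integral_map (hT A).aemeasurable hQ.aestronglyMeasurable]
      rfl
    · rw [ENNReal.toReal_mul, Complex.real_smul]
      push_cast
      rw [ENNReal.toReal_ofNat, mul_one_div]
      norm_num

end Convergence

end HilbertModular

end

theorem theorem5p4 {K : Type*} [Field K] [NumberField K] (hK : Module.finrank ℚ K = 2)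
    (ι : K →+* ℝ) (τ : K ≃ₐ[ℚ] K) (hτ : τ ≠ 1)
    (𝔞 : (FractionalIdeal (𝓞 K)⁰ K)ˣ) (m : ℕ) (hm : 0 < m) :
    -- the quotients `X(𝔞)` and `Γ(𝔞)'_{±A} \ ℍ` have fundamental domains
    HasFundamentalDomain (HilbertModular.transfGroup ι τ 𝔞) (ℍ × ℍ) HilbertModular.omegaSq ∧
    (∀ A ∈ HilbertModular.vectors τ 𝔞 m,
      HasFundamentalDomain (HilbertModular.stabTransfGroup ι τ 𝔞 A) ℍ HilbertModular.eta) ∧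
    -- `vol(T(𝔞, m))` is finite
    HilbertModular.volT ι τ 𝔞 m ≠ ⊤ ∧
    ∀ s : ℂ, 1 < s.re →
      -- the series `Φ(𝔞, m, s, z)` converges off `T(𝔞, m)`
      (∀ z : ℍ × ℍ, z ∉ HilbertModular.divisorT ι τ 𝔞 m →
        Summable fun A : HilbertModular.vectors τ 𝔞 m => HilbertModular.greenTerm ι s z A.1) ∧
      -- and is integrable over `X(𝔞)` with the stated integral
      ∀ F : Set (ℍ × ℍ),
        IsFundamentalDomain (HilbertModular.transfGroup ι τ 𝔞) F HilbertModular.omegaSq →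
        IntegrableOn (HilbertModular.greenPhi ι τ 𝔞 m s) F HilbertModular.omegaSq ∧
        ∫ z in F, HilbertModular.greenPhi ι τ 𝔞 m s z ∂HilbertModular.omegaSq =
          2 * ((HilbertModular.volT ι τ 𝔞 m).toReal : ℂ) / (s * (s - 1)) := by
  refine ⟨HilbertModular.hasFundamentalDomain_transfGroup hK ι τ hτ 𝔞,
    fun A hA => HilbertModular.hasFundamentalDomain_stabTransfGroup hK ι τ hτ 𝔞 A
      (HilbertModular.det_pos_of_mem_vectors hK ι τ hτ hm hA),
    HilbertModular.volT_ne_top hK ι τ hτ 𝔞 hm, fun s hs =>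
    ⟨fun z _ => HilbertModular.summable_greenTerm hK ι τ hτ 𝔞 hm hs z,
      fun F hF => HilbertModular.integral_greenPhi hK ι τ hτ 𝔞 hm hs hF⟩⟩
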